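/- Let $m\ge 2$, $c\in\mathbb R$, and let $\mathbb M^m(c)$ be the complete simply connected $m$-dimensional Riemannian manifold of constant sectional curvature $c$. Let $\kappa_1\le\kappa_2$ be real numbers with $\kappa_1>0$ if $c=0$, $\kappa_1\ge 0$ if $c>0$, and $\kappa_1>\sqrt{-c}$ if $c<0$. Let $R_i$ ($i=1,2$) be the radius of the geodesic spheres of normal curvature $\kappa_i$, that is, $R_i=1/\kappa_i$ if $c=0$, $R_i=\frac1k\operatorname{arccot}(\kappa_i/k)$ if $c=k^2$, and $R_i=\frac1k\operatorname{arccoth}(\kappa_i/k)$ if $c=-k^2$, where $k>0$. A closed domain $D\subset\mathbb M^m(c)$ (the closure of a nonempty connected open set) with nonempty boundary $\partial D$ is called $\kappa_1,\kappa_2$-convex if for every $P\in\partial D$ there are two geodesic spheres $S_1,S_2$ through $P$, of normal curvatures $\kappa_1$ and $\kappa_2$ respectively, with $S_2$ nested in $S_1$, such that near $P$ the hypersurface $\partial D$ lies inside $S_1$ and outside $S_2$, with $D$ on the inner side: near $P$, the domain $D$ lies inside $S_1$ and contains the inside of $S_2$. An inscribed ball of $D$ is a closed geodesic ball of maximal radius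 contained in $D$. For $r\in[R_2,R_1]$ put $$ b(r)=\begin{cases} \sqrt{(R_1-R_2)^2-(R_1-r)^2}+R_2, & c=0,\\[4pt] \dfrac1k\arccos\dfrac{\cos\bigl(k(R_1-R_2)\bigr)}{\cos\bigl(k(R_1-r)\bigr)}+R_2, & c=k^2,\ k>0,\\[8pt] \dfrac1k\operatorname{arccosh}\dfrac{\cosh\bigl(k(R_1-R_2)\bigr)}{\cosh\bigl(k(R_1-r)\bigr)}+R_2, & c=-k^2,\ k>0. \end{cases} $$ **Theorem.** Every $\kappa_1,\kappa_2$-convex domain $D\subset\mathbb M^m(c)$ has an inscribed ball. If $O$ is the centre and $r$ the radius of an inscribed ball of $D$, then $R_2\le r\le R_1$, and $\partial D$ lies in the closed spherical shell between the spheres of radii $r$ and $R$ centred at $O$, for some $R\ge r$ with $R\le b(r)$. Moreover, this estimate is sharp: for each $r\in[R_2,R_1]$ there is a rounded spindle-shaped domain $\tilde D$ that is $\kappa_1,\kappa_2$-convex and has an inscribed ball of radius $r$, with centre $O$ say, such that $\max_{x\in\partial\tilde D}\operatorname{dist}(O,x)=b(r)$. Here a rounded spindle-shaped domain is one bounded by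 the hypersurface obtained by rotating a circular arc of radius $R_1$ about the geodesic through its endpoints and rounding the two vertices by tangent spherical caps of radius $R_2$ with centres on that geodesic (for $r=R_2$ and $r=R_1$ it degenerates to a geodesic ball of radius $r$). -/

import Mathlib

open scoped RealInnerProductSpace

noncomputable section

/-- The standard model of the complete simply connected `m`-dimensional Riemannian manifold of
constant sectional curvature `c`: the quadric `t ^ 2 + c * ‖x‖ ^ 2 = 1` in `ℝ × ℝᵐ` (its upper
sheet `t > 0` if `c ≤ 0`) with the Riemannian metric induced by `dt ^ 2 / c + ‖dx‖ ^ 2`.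
For `c > 0` this is, after rescaling `t` by `1 / √c`, the round sphere of radius `1 / √c` in
`ℝ ^ (m + 1)`; for `c = 0` it is the hyperplane `t = 1`, that is Euclidean space; for `c < 0` it is
the hyperboloid model of the hyperbolic space of curvature `c`. -/
@[ext]
structure SpaceForm (m : ℕ) (c : ℝ) where
  /-- the vertical coordinate -/
  t : ℝ
  /-- the horizontal coordinates -/
  x : EuclideanSpace ℝ (Fin m)
  quadric : t ^ 2 + c * ‖x‖ ^ 2 = 1
  upper : c ≤ 0 → 0 < t

namespace SpaceForm

variable {m : ℕ} {c : ℝ}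

/-- The ambient bilinear form (rescaled by `c`); equals `1` on the diagonal. -/
def form (p q : SpaceForm m c) : ℝ := p.t * q.t + c * ⟪p.x, q.x⟫

/-- The Riemannian (geodesic) distance. -/
def gdist (p q : SpaceForm m c) : ℝ :=
  if c = 0 then ‖p.x - q.x‖
  else if 0 < c then Real.arccos (form p q) / √c
  else Real.arcosh (form p q) / √(-c)

section aux

variable {E : Type*} [NormedAddCommGroup E] [InnerProductSpace ℝ E]

lemma hyp_one_le {t s : ℝ} {u v : E} (ht : t ^ 2 = 1 + ‖u‖ ^ 2) (hs : s ^ 2 = 1 + ‖v‖ ^ 2)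
    (t0 : 0 < t) (s0 : 0 < s) : 1 ≤ t * s - ⟪u, v⟫ := by
  have h1 := real_inner_le_norm u v
  have h2 : 1 + ‖u‖ * ‖v‖ ≤ t * s := by
    apply le_of_sq_le_sq _ (by positivity)
    rw [mul_pow, ht, hs]
    nlinarith [sq_nonneg (‖u‖ - ‖v‖)]
  linarith

lemma hyp_eq {t s : ℝ} {u v : E} (ht : t ^ 2 = 1 + ‖u‖ ^ 2) (hs : s ^ 2 = 1 + ‖v‖ ^ 2)
    (t0 : 0 < t) (s0 : 0 < s) (h : t * s - ⟪u, v⟫ = 1) : t = s ∧ u = v := by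
  have h1 := real_inner_le_norm u v
  have h2 : t * s ≤ 1 + ‖u‖ * ‖v‖ := by linarith
  have h3 : (t * s) ^ 2 ≤ (1 + ‖u‖ * ‖v‖) ^ 2 := pow_le_pow_left₀ (by positivity) h2 2
  rw [mul_pow, ht, hs] at h3
  have h4 : (‖u‖ - ‖v‖) ^ 2 = 0 := le_antisymm (by nlinarith) (sq_nonneg _)
  have h5 : ‖u‖ = ‖v‖ := by
    have := pow_eq_zero_iff (two_ne_zero) |>.1 h4
    linarith
  have h6 : t = s := by
    have : t ^ 2 = s ^ 2 := by rw [ht, hs, h5]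
    exact (pow_left_inj₀ t0.le s0.le two_ne_zero).1 this
  refine ⟨h6, ?_⟩
  have h7 : ‖u - v‖ ^ 2 = 0 := by
    rw [norm_sub_sq_real]
    subst h6
    nlinarith
  have := pow_eq_zero_iff (two_ne_zero) |>.1 h7
  exact sub_eq_zero.1 (norm_eq_zero.1 this)

lemma hyp_nonneg {t τ : ℝ} {u w : E} (ht : t ^ 2 = 1 + ‖u‖ ^ 2) (h : t * τ = ⟪u, w⟫) :
    0 ≤ ‖w‖ ^ 2 - τ ^ 2 := by
  have h1 := abs_real_inner_le_norm u w
  have h2 : (t * τ) ^ 2 ≤ (‖u‖ * ‖w‖) ^ 2 := by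
    rw [h, ← sq_abs]
    exact pow_le_pow_left₀ (abs_nonneg _) h1 2
  rw [mul_pow, mul_pow, ht] at h2
  by_contra hc
  push Not at hc
  nlinarith [mul_nonneg (sq_nonneg ‖u‖) (sub_nonneg.2 (sub_neg.1 hc).le), sq_nonneg ‖w‖]

lemma hyp_triangle {a b d : ℝ} {u v w : E} (ha : a ^ 2 = 1 + ‖u‖ ^ 2) (hb : b ^ 2 = 1 + ‖v‖ ^ 2)
    (hd : d ^ 2 = 1 + ‖w‖ ^ 2) (a0 : 0 < a) (b0 : 0 < b) (d0 : 0 < d) :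
    Real.arcosh (a * d - ⟪u, w⟫) ≤
      Real.arcosh (a * b - ⟪u, v⟫) + Real.arcosh (b * d - ⟪v, w⟫) := by
  have hA := hyp_one_le ha hb a0 b0
  have hB := hyp_one_le hb hd b0 d0
  have hC := hyp_one_le ha hd a0 d0
  set A := a * b - ⟪u, v⟫ with hAdef
  set B := b * d - ⟪v, w⟫ with hBdef
  set C := a * d - ⟪u, w⟫ with hCdef
  set p : E := u - A • v with hp
  set q : E := w - B • v with hq
  set σ := a - A * b with hσ
  set τ := d - B * b with hτ
  have hvv : ⟪v, v⟫ = ‖v‖ ^ 2 := real_inner_self_eq_norm_sq v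
  have huu : ⟪u, u⟫ = ‖u‖ ^ 2 := real_inner_self_eq_norm_sq u
  have hww : ⟪w, w⟫ = ‖w‖ ^ 2 := real_inner_self_eq_norm_sq w
  have hvu : ⟪v, u⟫ = ⟪u, v⟫ := real_inner_comm _ _
  have hwv : ⟪w, v⟫ = ⟪v, w⟫ := real_inner_comm _ _
  have hop : b * σ = ⟪v, p⟫ := by
    simp only [hp, inner_sub_right, inner_smul_right, hvv, hvu, hσ]
    linear_combination A * hb * (-1) - hAdef
  have hoq : b * τ = ⟪v, q⟫ := by
    simp only [hq, inner_sub_right, inner_smul_right, hvv, hτ]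
    linear_combination B * hb * (-1) - hBdef
  have hpp : ‖p‖ ^ 2 - σ ^ 2 = A ^ 2 - 1 := by
    rw [← real_inner_self_eq_norm_sq]
    simp only [hp, inner_sub_right, inner_sub_left, inner_smul_right, inner_smul_left, hvv, hvu,
      hσ, huu, conj_trivial]
    linear_combination (-1) * ha - A ^ 2 * hb - 2 * A * hAdef
  have hqq : ‖q‖ ^ 2 - τ ^ 2 = B ^ 2 - 1 := by
    rw [← real_inner_self_eq_norm_sq]
    simp only [hq, inner_sub_right, inner_sub_left, inner_smul_right, inner_smul_left, hvv, hwv,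
      hτ, hww, conj_trivial]
    linear_combination (-1) * hd - B ^ 2 * hb - 2 * B * hBdef
  have hpq : C = A * B + (σ * τ - ⟪p, q⟫) := by
    simp only [hp, hq, inner_sub_right, inner_sub_left, inner_smul_right, inner_smul_left, hvv,
      hσ, hτ, conj_trivial]
    linear_combination hCdef - B * hAdef - A * hBdef - A * B * hb
  have hK : (σ * τ - ⟪p, q⟫) ^ 2 ≤ (A ^ 2 - 1) * (B ^ 2 - 1) := by
    have hdis := discrim_le_zero (a := ‖q‖ ^ 2 - τ ^ 2) (b := 2 * (⟪p, q⟫ - σ * τ))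
      (c := ‖p‖ ^ 2 - σ ^ 2) (fun s => by
        have h := hyp_nonneg (t := b) (τ := σ + s * τ) (u := v) (w := p + s • q) hb (by
          rw [inner_add_right, inner_smul_right, ← hop, ← hoq]; ring)
        rw [← real_inner_self_eq_norm_sq, inner_add_add_self, inner_smul_left, inner_smul_right,
          inner_smul_right, inner_smul_left, real_inner_self_eq_norm_sq,
          real_inner_self_eq_norm_sq, real_inner_comm p q] at h
        simp only [conj_trivial] at h
        linear_combination h)
    rw [discrim, hpp, hqq] at hdis
    linear_combination (1 / 4) * hdis
  have hle : C ≤ Real.cosh (Real.arcosh A + Real.arcosh B) := by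
    rw [Real.cosh_add, Real.cosh_arcosh hA, Real.cosh_arcosh hB, Real.sinh_arcosh hA,
      Real.sinh_arcosh hB, hpq, ← Real.sqrt_mul (sub_nonneg.2 (one_le_pow₀ hA))]
    have := Real.abs_le_sqrt hK
    have := le_abs_self (σ * τ - ⟪p, q⟫)
    linarith
  calc Real.arcosh C ≤ Real.arcosh (Real.cosh (Real.arcosh A + Real.arcosh B)) :=
        (Real.arcosh_le_arcosh (by linarith) (Real.cosh_pos _)).2 hle
    _ = _ := Real.arcosh_cosh (add_nonneg (Real.arcosh_nonneg hA) (Real.arcosh_nonneg hB))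

end aux

/-- The point of the unit sphere of `ℝ × ℝᵐ` corresponding to a point, for `c > 0`. -/
def sph (p : SpaceForm m c) : WithLp 2 (ℝ × EuclideanSpace ℝ (Fin m)) :=
  WithLp.toLp 2 (p.t, √c • p.x)

lemma inner_sph (hc : 0 < c) (p q : SpaceForm m c) : ⟪sph p, sph q⟫ = form p q := by
  have := Real.mul_self_sqrt hc.le
  simp only [sph, WithLp.prod_inner_apply, form, inner_smul_left, inner_smul_right]
  simp only [conj_trivial, RCLike.inner_apply]
  linear_combination ⟪p.x, q.x⟫ * this

lemma form_self (p : SpaceForm m c) : form p p = 1 := by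
  rw [form, real_inner_self_eq_norm_sq, ← p.quadric]; ring

lemma form_comm (p q : SpaceForm m c) : form p q = form q p := by
  rw [form, form, real_inner_comm, mul_comm]

lemma norm_sph (hc : 0 < c) (p : SpaceForm m c) : ‖sph p‖ = 1 := by
  have h : ‖sph p‖ ^ 2 = 1 := by rw [← real_inner_self_eq_norm_sq, inner_sph hc, form_self]
  exact (pow_eq_one_iff_of_nonneg (norm_nonneg _) two_ne_zero).1 h

lemma arccos_form (hc : 0 < c) (p q : SpaceForm m c) :
    Real.arccos (form p q) = InnerProductGeometry.angle (sph p) (sph q) := by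
  rw [InnerProductGeometry.angle, inner_sph hc, norm_sph hc, norm_sph hc]; simp

lemma hyp_quadric (hc : c < 0) (p : SpaceForm m c) :
    p.t ^ 2 = 1 + ‖√(-c) • p.x‖ ^ 2 := by
  have h := Real.sq_sqrt (neg_pos.2 hc).le
  rw [norm_smul, mul_pow, Real.norm_eq_abs, sq_abs, h]
  linear_combination p.quadric

lemma form_hyp (hc : c < 0) (p q : SpaceForm m c) :
    form p q = p.t * q.t - ⟪√(-c) • p.x, √(-c) • q.x⟫ := by
  have h := Real.mul_self_sqrt (neg_pos.2 hc).le
  simp only [form, inner_smul_left, inner_smul_right, conj_trivial]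
  linear_combination ⟪p.x, q.x⟫ * h

lemma gdist_self (p : SpaceForm m c) : gdist p p = 0 := by
  simp [gdist, form_self]

lemma gdist_comm (p q : SpaceForm m c) : gdist p q = gdist q p := by
  rw [gdist, gdist, form_comm p q, norm_sub_rev]

lemma gdist_triangle (p q r : SpaceForm m c) : gdist p r ≤ gdist p q + gdist q r := by
  rcases lt_trichotomy c 0 with hc | hc | hc
  · simp only [gdist, hc.ne, hc.not_gt, if_false, ← add_div]
    apply div_le_div_of_nonneg_right _ (Real.sqrt_nonneg _)
    rw [form_hyp hc, form_hyp hc, form_hyp hc]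
    exact hyp_triangle (hyp_quadric hc p) (hyp_quadric hc q) (hyp_quadric hc r)
      (p.upper hc.le) (q.upper hc.le) (r.upper hc.le)
  · simp only [gdist, hc, if_true]
    exact norm_sub_le_norm_sub_add_norm_sub _ _ _
  · simp only [gdist, hc.ne', hc, if_false, if_true, ← add_div]
    apply div_le_div_of_nonneg_right _ (Real.sqrt_nonneg _)
    rw [arccos_form hc, arccos_form hc, arccos_form hc]
    exact InnerProductGeometry.angle_le_angle_add_angle _ _ _

lemma eq_of_gdist_eq_zero {p q : SpaceForm m c} (h : gdist p q = 0) : p = q := by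
  rcases lt_trichotomy c 0 with hc | hc | hc
  · have hs : √(-c) ≠ 0 := (Real.sqrt_pos.2 (neg_pos.2 hc)).ne'
    simp only [gdist, hc.ne, hc.not_gt, if_false, div_eq_zero_iff, hs, or_false] at h
    rw [form_hyp hc] at h
    have h1 := hyp_one_le (hyp_quadric hc p) (hyp_quadric hc q) (p.upper hc.le) (q.upper hc.le)
    rw [Real.arcosh_eq_zero_iff h1] at h
    obtain ⟨h2, h3⟩ :=
      hyp_eq (hyp_quadric hc p) (hyp_quadric hc q) (p.upper hc.le) (q.upper hc.le) h
    exact SpaceForm.ext h2 (smul_right_injective _ hs h3)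
  · simp only [gdist, hc, if_true] at h
    have hp := p.quadric
    have hq := q.quadric
    simp only [hc, zero_mul, add_zero] at hp hq
    have h1 := (pow_eq_one_iff_of_nonneg (p.upper hc.le).le two_ne_zero).1 hp
    have h2 := (pow_eq_one_iff_of_nonneg (q.upper hc.le).le two_ne_zero).1 hq
    exact SpaceForm.ext (h1.trans h2.symm) (sub_eq_zero.1 (norm_eq_zero.1 h))
  · have hs : √c ≠ 0 := (Real.sqrt_pos.2 hc).ne'
    simp only [gdist, hc.ne', hc, if_false, if_true, div_eq_zero_iff, hs, or_false] at h
    rw [Real.arccos_eq_zero, ← inner_sph hc] at h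
    have h0 : ⟪sph p, sph q⟫ = 1 := le_antisymm
      (by simpa [norm_sph hc] using real_inner_le_norm (sph p) (sph q)) h
    have h1 := (inner_eq_one_iff_of_norm_eq_one (𝕜 := ℝ) (norm_sph hc p) (norm_sph hc q)).1 h0
    have h2 : (p.t, √c • p.x) = (q.t, √c • q.x) := congrArg WithLp.ofLp h1
    rw [Prod.mk.injEq] at h2
    exact SpaceForm.ext h2.1 (smul_right_injective _ hs h2.2)

instance : MetricSpace (SpaceForm m c) where
  dist := gdist
  dist_self := gdist_self
  dist_comm := gdist_comm
  dist_triangle := gdist_triangle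
  eq_of_dist_eq_zero := eq_of_gdist_eq_zero

end SpaceForm

/-- The radius of the geodesic spheres of normal curvature `κ` in the space of constant curvature
`c`, equivalently of the circles of geodesic curvature `κ` in the corresponding plane: `1 / κ` for
`c = 0`, `arccot (κ / k) / k` for `c = k ^ 2` and `arccoth (κ / k) / k` for `c = -k ^ 2`, `k > 0`.
(A geodesic sphere of radius `ρ` has normal curvature `1 / ρ`, `k * cot (k * ρ)`,
`k * coth (k * ρ)` in these three cases.) -/
def curvatureRadius (c κ : ℝ) : ℝ :=
  if c = 0 then 1 / κ
  else if 0 < c then (Real.pi / 2 - Real.arctan (κ / √c)) / √c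
  else Real.artanh (√(-c) / κ) / √(-c)

/-- `D` is a closed `κ₁, κ₂`-convex domain: it is the closure of a nonempty connected open set, it
has a boundary, and for each boundary point `P` there are geodesic spheres `S₁`, `S₂` of normal
curvatures `κ₁`, `κ₂` (centres `O₁`, `O₂`) through `P`, with `S₂` nested in `S₁`, such that locally
near `P` the boundary of `D` lies inside `S₁` and outside `S₂`, the domain being on the inner side:
`D` lies inside `S₁` and contains the inside of `S₂`. -/
structure IsConvexDomain {m : ℕ} {c : ℝ} (κ₁ κ₂ : ℝ) (D : Set (SpaceForm m c)) : Prop where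
  isConnected_interior : IsConnected (interior D)
  closure_interior : closure (interior D) = D
  frontier_nonempty : (frontier D).Nonempty
  pinched : ∀ P ∈ frontier D, ∃ O₁ O₂ : SpaceForm m c,
    P ∈ Metric.sphere O₁ (curvatureRadius c κ₁) ∧ P ∈ Metric.sphere O₂ (curvatureRadius c κ₂) ∧
    Metric.closedBall O₂ (curvatureRadius c κ₂) ⊆ Metric.closedBall O₁ (curvatureRadius c κ₁) ∧
    ∃ U ∈ nhds P, D ∩ U ⊆ Metric.closedBall O₁ (curvatureRadius c κ₁) ∧
      Metric.closedBall O₂ (curvatureRadius c κ₂) ∩ U ⊆ D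

/-- The ball of centre `O` and radius `r` is an inscribed ball of `D`: a ball of maximal radius
among those contained in `D`. -/
def IsInscribedBall {X : Type*} [MetricSpace X] (D : Set X) (O : X) (r : ℝ) : Prop :=
  Metric.closedBall O r ⊆ D ∧ ∀ (O' : X) (r' : ℝ), Metric.closedBall O' r' ⊆ D → r' ≤ r

/-- The closed spherical shell between the concentric spheres of radii `r` and `R` about `O`. -/
def sphericalShell {X : Type*} [MetricSpace X] (O : X) (r R : ℝ) : Set X :=
  {x | r ≤ dist O x ∧ dist O x ≤ R}

/-- The domain bounded by the rounded spindle-shaped hypersurface with arcs of radius `R₁` and caps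
of radius `R₂` centred at `A` and `B`. It consists of the balls of radius `R₂` about `A` and `B` and
of the region between the segment `AB` and the rotated arc. The centres `y` of the rotated copies of
the arc are the points at distance `R₁ - R₂` from both `A` and `B` (so that the circle of radius
`R₁` about `y` is tangent to both caps from outside), and the region swept by one copy consists of
the points `x` which, as seen from `y`, lie behind a point `z` of the segment `AB` and at distance
at most `R₁` from `y`. -/
def roundedSpindle {X : Type*} [MetricSpace X] (R₁ R₂ : ℝ) (A B : X) : Set X :=
  Metric.closedBall A R₂ ∪ Metric.closedBall B R₂ ∪
    {x | ∃ y z : X, dist y A = R₁ - R₂ ∧ dist y B = R₁ - R₂ ∧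
      dist A z + dist z B = dist A B ∧ dist y z + dist z x = dist y x ∧ dist y x ≤ R₁}

/-- The bound for the outer radius in terms of the inner radius `r`. -/
def outerRadiusBound (c R₁ R₂ r : ℝ) : ℝ :=
  if c = 0 then √((R₁ - R₂) ^ 2 - (R₁ - r) ^ 2) + R₂
  else if 0 < c then
    Real.arccos (Real.cos (√c * (R₁ - R₂)) / Real.cos (√c * (R₁ - r))) / √c + R₂
  else
    Real.arcosh (Real.cosh (√(-c) * (R₁ - R₂)) / Real.cosh (√(-c) * (R₁ - r))) / √(-c) + R₂

end

/-!
All curvatures are treated at once by means of the generalized cosine `cs`, the generalized sine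
`sn` and the modified distance `md`, the primitive of `sn`. In these terms the law of cosines
`md_dist_polar` has one form for all `c`, and along a unit speed geodesic `md c (dist · y)` solves
`f'' + c * f = 1`. This makes a one-dimensional comparison argument available
(`jacobi_comparison`): a function that is touched from below, at each point of a geodesic, by the
modified distance to some point satisfies `f'' ≥ 1 - c * f` weakly (`HasDistSupport`), hence it is
quasiconvex as long as its values `W` satisfy `c * W ≤ 1`, and it stays above the modified
distance to a point along the whole geodesic if it does so near one endpoint, with equality there.
Functions of this kind turn the local definition of a convex domain into global statements.

**From local to global outer balls.** Let `δ x` be the distance from `x` to the complement of `D`.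
At an interior point with nearest boundary point `P`, the outer ball at `P` shows that
`md (R₁ + ε - δ)` is touched from below by the modified distance to a point near the centre of this
ball; the small `ε` keeps `x` away from that point. So `δ` is quasiconcave
along geodesics inside `D`, and by connectedness the interior of `D` is geodesically convex
(`seg_subset_interior`). Comparison along geodesics from a point with foot `P` gives that `D` lies
in the outer ball at `P` (`subset_closedBall_of_local`).

**From local to global inner balls** (Blaschke's rolling theorem, `closedBall_subset_of_local`).
Dually, with `F x` the largest distance from `x` to a point of `D`, the inner ball at a farthest
point shows that `md (F - (R₂ - ε))` has supports of the same kind. Comparison along the geodesic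
between the centres `y`, `y'` of two outer balls of `D` shows that the inner ball that touches
the first outer ball lies in the second one. So an inner ball lies in all outer balls, and it cannot
leave `D` without leaving one of them.

**The estimate.** Let `O` be the centre of an inscribed ball of radius `r`, and `z` the centre of an
inner ball of radius `R₂` at a boundary point. Moving from `O` towards `z` cannot increase the
depth, so in the limit there is an outer ball with centre `y` that touches the inscribed ball on the
side of `z`: the angle at `O` between `y` and `z` is at least `π / 2`, and `dist O y = R₁ - r`. As
`dist z y ≤ R₁ - R₂`, the law of cosines bounds `dist O z` by the leg of the right triangle with
hypotenuse `R₁ - R₂` and other leg `R₁ - r` (`md_le_of_inscribed`, `outerRadiusBound_spec`), and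
the boundary point is at distance `R₂` from `z`.

**Sharpness.** Place the centres `A`, `B` of the caps symmetrically about the base point, so that
the same right triangle (`SpindleTriangle`) occurs with vertices the base point, `A` and the centre
of an arc. Let the lens be the set of points at distance at most `R₁ - R₂` from `A` and `B`. The
rounded spindle is the intersection of the balls of radius `R₁` with centres in the lens
(`mem_spindle_iff`), and also a union of balls of radius `R₂`, whose centres have distance at most
`R₁ - R₂` from the whole lens (`exists_of_mem_spindle`, `closedBall_subset_spindle`). Both halves of
the pinching condition follow. The base point is the centre of an inscribed ball of radius `r`, the
apex has distance `b(r)` from it, and no boundary point is farther, by the estimate.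
-/

noncomputable section

namespace SpaceForm

/-! ### Trigonometric functions of constant curvature -/

section

open Real

/-- The generalized cosine: the solution of `y'' + c * y = 0` with `y 0 = 1`, `y' 0 = 0`. -/
def cs (c s : ℝ) : ℝ :=
  if c = 0 then 1 else if 0 < c then cos (√c * s) else cosh (√(-c) * s)

/-- The generalized sine: the solution of `y'' + c * y = 0` with `y 0 = 0`, `y' 0 = 1`. -/
def sn (c s : ℝ) : ℝ :=
  if c = 0 then s else if 0 < c then sin (√c * s) / √c else sinh (√(-c) * s) / √(-c)

/-- The modified distance: the primitive of `sn c` that vanishes at `0`. It is the solution of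
`y'' + c * y = 1` with vanishing initial values, and equals `s ^ 2 / 2` for `c = 0`. -/
def md (c s : ℝ) : ℝ :=
  if c = 0 then s ^ 2 / 2 else (1 - cs c s) / c

/-- The length `s` subtends an angle less than `θ` on the sphere of curvature `c`; no condition
if `c ≤ 0`. -/
abbrev AngleLT (c s θ : ℝ) : Prop := 0 < c → √c * s < θ

/-- The length `s` subtends an angle at most `θ` on the sphere of curvature `c`; no condition
if `c ≤ 0`. -/
abbrev AngleLE (c s θ : ℝ) : Prop := 0 < c → √c * s ≤ θ

variable {c s t θ : ℝ}

lemma AngleLT.mono (h : AngleLT c t θ) (hst : s ≤ t) : AngleLT c s θ := fun hc =>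
  (mul_le_mul_of_nonneg_left hst (sqrt_nonneg c)).trans_lt (h hc)

lemma AngleLE.mono (h : AngleLE c t θ) (hst : s ≤ t) : AngleLE c s θ := fun hc =>
  (mul_le_mul_of_nonneg_left hst (sqrt_nonneg c)).trans (h hc)

lemma AngleLT.le (h : AngleLT c t θ) : AngleLE c t θ := fun hc => (h hc).le

lemma AngleLE.of_lt (h : AngleLE c t θ) (hst : s < t) : AngleLT c s θ := fun hc =>
  (mul_lt_mul_of_pos_left hst (sqrt_pos.2 hc)).trans_le (h hc)

lemma AngleLE.lt_pi (h : AngleLE c t (π / 2)) : AngleLT c t π := fun hc =>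
  (h hc).trans_lt (by linarith [pi_pos])

lemma AngleLT.half_lt_pi (h : AngleLT c t (π / 2)) : AngleLT c t π := h.le.lt_pi

lemma AngleLT.exists_gt (h : AngleLT c t θ) : ∃ ε > 0, AngleLT c (t + ε) θ := by
  by_cases hc : 0 < c
  · have hs := sqrt_pos.2 hc
    have h1 := h hc
    refine ⟨(θ - √c * t) / (2 * √c), by have := sub_pos.2 h1; positivity, fun _ => ?_⟩
    have : √c * (t + (θ - √c * t) / (2 * √c)) = (θ + √c * t) / 2 := by field_simp; ring
    rw [this]; linarith
  · exact ⟨1, one_pos, fun h => absurd h hc⟩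

lemma cs_of_zero : cs 0 s = 1 := by simp [cs]
lemma sn_of_zero : sn 0 s = s := by simp [sn]
lemma md_of_zero : md 0 s = s ^ 2 / 2 := by simp [md]
lemma cs_of_pos (hc : 0 < c) : cs c s = cos (√c * s) := by simp [cs, hc, hc.ne']
lemma sn_of_pos (hc : 0 < c) : sn c s = sin (√c * s) / √c := by simp [sn, hc, hc.ne']
lemma cs_of_neg (hc : c < 0) : cs c s = cosh (√(-c) * s) := by simp [cs, hc.not_gt, hc.ne]
lemma sn_of_neg (hc : c < 0) : sn c s = sinh (√(-c) * s) / √(-c) := by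
  simp [sn, hc.not_gt, hc.ne]
lemma md_of_ne (hc : c ≠ 0) : md c s = (1 - cs c s) / c := by simp [md, hc]

lemma cs_eq (c s : ℝ) : cs c s = 1 - c * md c s := by
  by_cases hc : c = 0
  · subst hc; simp [cs_of_zero]
  · rw [md_of_ne hc]; field_simp; ring

@[simp] lemma cs_zero (c : ℝ) : cs c 0 = 1 := by simp [cs]
@[simp] lemma sn_zero (c : ℝ) : sn c 0 = 0 := by simp [sn]
@[simp] lemma md_zero (c : ℝ) : md c 0 = 0 := by simp [md]
@[simp] lemma cs_neg (c s : ℝ) : cs c (-s) = cs c s := by simp [cs]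
@[simp] lemma sn_neg (c s : ℝ) : sn c (-s) = -sn c s := by
  unfold sn; split_ifs <;> simp [neg_div]
@[simp] lemma md_neg (c s : ℝ) : md c (-s) = md c s := by simp [md]

lemma cs_add (c s t : ℝ) : cs c (s + t) = cs c s * cs c t - c * (sn c s * sn c t) := by
  rcases lt_trichotomy c 0 with hc | hc | hc
  · have h := sqrt_pos.2 (neg_pos.2 hc)
    have h2 := mul_self_sqrt (neg_pos.2 hc).le
    simp only [cs_of_neg hc, sn_of_neg hc, mul_add, cosh_add]
    field_simp
    linear_combination sinh (√(-c) * s) * sinh (√(-c) * t) * h2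
  · subst hc; simp [cs_of_zero]
  · have h := sqrt_pos.2 hc
    have h2 := mul_self_sqrt hc.le
    simp only [cs_of_pos hc, sn_of_pos hc, mul_add, cos_add]
    field_simp
    linear_combination -sin (√c * s) * sin (√c * t) * h2

lemma sn_add (c s t : ℝ) : sn c (s + t) = sn c s * cs c t + cs c s * sn c t := by
  rcases lt_trichotomy c 0 with hc | hc | hc
  · simp only [cs_of_neg hc, sn_of_neg hc, mul_add, sinh_add]; ring
  · subst hc; simp [cs_of_zero, sn_of_zero]
  · simp only [cs_of_pos hc, sn_of_pos hc, mul_add, sin_add]; ring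

lemma md_add (c s t : ℝ) :
    md c (s + t) = md c s + md c t - c * md c s * md c t + sn c s * sn c t := by
  by_cases hc : c = 0
  · subst hc; simp only [md_of_zero, sn_of_zero]; ring
  · have h := cs_add c s t
    rw [cs_eq c s, cs_eq c t, cs_eq c (s + t)] at h
    have : c * md c (s + t) =
        c * (md c s + md c t - c * md c s * md c t + sn c s * sn c t) := by
      linear_combination -h
    exact mul_left_cancel₀ hc this

lemma cs_sub (c s t : ℝ) : cs c (s - t) = cs c s * cs c t + c * (sn c s * sn c t) := by
  rw [sub_eq_add_neg, cs_add]; simp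

lemma sn_sub (c s t : ℝ) : sn c (s - t) = sn c s * cs c t - cs c s * sn c t := by
  rw [sub_eq_add_neg, sn_add]; simp; ring

lemma md_sub (c s t : ℝ) :
    md c (s - t) = md c s + md c t - c * md c s * md c t - sn c s * sn c t := by
  rw [sub_eq_add_neg, md_add]; simp; ring

lemma cs_sq (c s : ℝ) : cs c s ^ 2 + c * sn c s ^ 2 = 1 := by
  have h := cs_sub c s s
  rw [sub_self, cs_zero] at h
  linear_combination -h

lemma sn_sq (c s : ℝ) : sn c s ^ 2 = md c s * (2 - c * md c s) := by
  have h := md_sub c s s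
  rw [sub_self, md_zero] at h
  linear_combination h

lemma hasDerivAt_cs (c s : ℝ) : HasDerivAt (cs c) (-c * sn c s) s := by
  rcases lt_trichotomy c 0 with hc | hc | hc
  · have h2 := mul_self_sqrt (neg_pos.2 hc).le
    have h3 := sqrt_pos.2 (neg_pos.2 hc)
    have h : HasDerivAt (fun s => cosh (√(-c) * s)) (sinh (√(-c) * s) * √(-c)) s := by
      simpa using ((hasDerivAt_id s).const_mul (√(-c))).cosh
    have e : cs c = fun s => cosh (√(-c) * s) := funext fun s => cs_of_neg hc
    rw [e, sn_of_neg hc]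
    convert h using 1
    field_simp
    linear_combination -sinh (√(-c) * s) * h2
  · subst hc
    have e : cs 0 = fun _ => (1 : ℝ) := funext fun s => cs_of_zero
    rw [e]; simpa using hasDerivAt_const s (1 : ℝ)
  · have h2 := mul_self_sqrt hc.le
    have h3 := sqrt_pos.2 hc
    have h : HasDerivAt (fun s => cos (√c * s)) (-sin (√c * s) * √c) s := by
      simpa using ((hasDerivAt_id s).const_mul (√c)).cos
    have e : cs c = fun s => cos (√c * s) := funext fun s => cs_of_pos hc
    rw [e, sn_of_pos hc]
    convert h using 1
    field_simp
    linear_combination sin (√c * s) * h2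

lemma hasDerivAt_sn (c s : ℝ) : HasDerivAt (sn c) (cs c s) s := by
  rcases lt_trichotomy c 0 with hc | hc | hc
  · have h3 := sqrt_pos.2 (neg_pos.2 hc)
    have h : HasDerivAt (fun s => sinh (√(-c) * s) / √(-c))
        (cosh (√(-c) * s) * √(-c) / √(-c)) s := by
      simpa using ((hasDerivAt_id s).const_mul (√(-c))).sinh.div_const (√(-c))
    have e : sn c = fun s => sinh (√(-c) * s) / √(-c) := funext fun s => sn_of_neg hc
    rw [e, cs_of_neg hc]
    convert h using 1
    field_simp
  · subst hc
    have e : sn 0 = fun s => s := funext fun s => sn_of_zero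
    rw [e, cs_of_zero]; exact hasDerivAt_id s
  · have h3 := sqrt_pos.2 hc
    have h : HasDerivAt (fun s => sin (√c * s) / √c) (cos (√c * s) * √c / √c) s := by
      simpa using ((hasDerivAt_id s).const_mul (√c)).sin.div_const (√c)
    have e : sn c = fun s => sin (√c * s) / √c := funext fun s => sn_of_pos hc
    rw [e, cs_of_pos hc]
    convert h using 1
    field_simp

lemma hasDerivAt_md (c s : ℝ) : HasDerivAt (md c) (sn c s) s := by
  by_cases hc : c = 0
  · subst hc
    have e : md 0 = fun s => s ^ 2 / 2 := funext fun s => md_of_zero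
    rw [e, sn_of_zero]
    simpa using ((hasDerivAt_id s).pow 2).div_const 2
  · have e : md c = fun s => (1 - cs c s) / c := funext fun s => md_of_ne hc
    rw [e]
    exact (((hasDerivAt_cs c s).const_sub 1).div_const c).congr_deriv (by
      rw [neg_mul, neg_neg, mul_div_cancel_left₀ _ hc])

@[fun_prop] lemma continuous_cs (c : ℝ) : Continuous (cs c) :=
  continuous_iff_continuousAt.2 fun s => (hasDerivAt_cs c s).continuousAt
@[fun_prop] lemma continuous_sn (c : ℝ) : Continuous (sn c) :=
  continuous_iff_continuousAt.2 fun s => (hasDerivAt_sn c s).continuousAt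
@[fun_prop] lemma continuous_md (c : ℝ) : Continuous (md c) :=
  continuous_iff_continuousAt.2 fun s => (hasDerivAt_md c s).continuousAt

lemma sn_pos (hs : 0 < s) (h : AngleLT c s π) : 0 < sn c s := by
  rcases lt_trichotomy c 0 with hc | hc | hc
  · have h3 := sqrt_pos.2 (neg_pos.2 hc)
    rw [sn_of_neg hc]
    exact div_pos (sinh_pos_iff.2 (mul_pos h3 hs)) h3
  · subst hc; rwa [sn_of_zero]
  · have h3 := sqrt_pos.2 hc
    rw [sn_of_pos hc]
    exact div_pos (sin_pos_of_pos_of_lt_pi (mul_pos h3 hs) (h hc)) h3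

lemma sn_nonneg (hs : 0 ≤ s) (h : AngleLE c s π) : 0 ≤ sn c s := by
  rcases lt_trichotomy c 0 with hc | hc | hc
  · rcases hs.eq_or_lt with rfl | hs
    · simp
    · exact (sn_pos hs fun h' => absurd hc h'.not_gt).le
  · subst hc; rwa [sn_of_zero]
  · rw [sn_of_pos hc]
    exact div_nonneg (sin_nonneg_of_nonneg_of_le_pi (mul_nonneg (sqrt_nonneg c) hs) (h hc))
      (sqrt_nonneg c)

lemma cs_pos_of_nonpos (hc : c ≤ 0) : 0 < cs c s := by
  rcases hc.eq_or_lt with rfl | hc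
  · simp [cs_of_zero]
  · rw [cs_of_neg hc]; exact cosh_pos _

lemma cs_pos (hs : 0 ≤ s) (h : AngleLT c s (π / 2)) : 0 < cs c s := by
  rcases le_or_gt c 0 with hc | hc
  · exact cs_pos_of_nonpos hc
  · rw [cs_of_pos hc]
    have := mul_nonneg (sqrt_nonneg c) hs
    exact cos_pos_of_mem_Ioo ⟨by linarith [pi_pos], h hc⟩

lemma cs_nonneg (hs : 0 ≤ s) (h : AngleLE c s (π / 2)) : 0 ≤ cs c s := by
  rcases le_or_gt c 0 with hc | hc
  · exact (cs_pos_of_nonpos hc).le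
  · rw [cs_of_pos hc]
    have := mul_nonneg (sqrt_nonneg c) hs
    exact cos_nonneg_of_mem_Icc ⟨by linarith [pi_pos], h hc⟩

lemma md_lt_md (hs : 0 ≤ s) (hst : s < t) (h : AngleLE c t π) : md c s < md c t := by
  rcases lt_trichotomy c 0 with hc | hc | hc
  · have h3 := sqrt_pos.2 (neg_pos.2 hc)
    rw [md_of_ne hc.ne, md_of_ne hc.ne]
    apply div_lt_div_of_neg_of_lt hc
    rw [cs_of_neg hc, cs_of_neg hc]
    have : cosh (√(-c) * s) < cosh (√(-c) * t) := by
      rw [cosh_lt_cosh, abs_of_nonneg (by positivity),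
        abs_of_nonneg (mul_nonneg h3.le (by linarith))]
      exact mul_lt_mul_of_pos_left hst h3
    linarith
  · subst hc; simp only [md_of_zero]; nlinarith
  · have h3 := sqrt_pos.2 hc
    rw [md_of_ne hc.ne', md_of_ne hc.ne']
    apply div_lt_div_of_pos_right _ hc
    rw [cs_of_pos hc, cs_of_pos hc]
    have : cos (√c * t) < cos (√c * s) :=
      cos_lt_cos_of_nonneg_of_le_pi (by positivity) (h hc) (mul_lt_mul_of_pos_left hst h3)
    linarith

lemma md_le_md (hs : 0 ≤ s) (hst : s ≤ t) (h : AngleLE c t π) : md c s ≤ md c t := by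
  rcases hst.eq_or_lt with rfl | hst
  · exact le_rfl
  · exact (md_lt_md hs hst h).le

lemma le_of_md_le (ht : 0 ≤ t) (hs : AngleLE c s π) (h : md c s ≤ md c t) : s ≤ t := by
  by_contra! hlt
  exact absurd (md_lt_md ht hlt hs) h.not_gt

lemma lt_of_md_lt (ht : 0 ≤ t) (hs : AngleLE c s π) (h : md c s < md c t) : s < t := by
  by_contra! hlt
  exact absurd (md_le_md ht hlt hs) h.not_ge

lemma eq_of_md_eq (hs : 0 ≤ s) (ht : 0 ≤ t) (hs' : AngleLE c s π) (ht' : AngleLE c t π)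
    (h : md c s = md c t) : s = t :=
  le_antisymm (le_of_md_le ht hs' h.le) (le_of_md_le hs ht' h.ge)

lemma md_nonneg (hs : 0 ≤ s) (h : AngleLE c s π) : 0 ≤ md c s := by
  simpa using md_le_md le_rfl hs h

lemma md_pos (hs : 0 < s) (h : AngleLE c s π) : 0 < md c s := by
  simpa using md_lt_md le_rfl hs h

/-- A multiple of `md c` is negligible against a multiple of `sn c` near `0`. -/
lemma exists_md_lt_sn (a : ℝ) {b : ℝ} (hb : 0 < b) :
    ∃ η > 0, ∀ s, 0 < s → s < η → md c s * a < sn c s * b := by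
  have h1 : ∀ᶠ s in nhds 0, sn c s * a < (1 + cs c s) * b ∧ 0 < 1 + cs c s := by
    apply Filter.Eventually.and
    · exact (by fun_prop : Continuous fun s => sn c s * a).continuousAt.eventually_lt
        (by fun_prop : Continuous fun s => (1 + cs c s) * b).continuousAt (by simp; linarith)
    · exact continuousAt_const.eventually_lt
        (by fun_prop : Continuous fun s => 1 + cs c s).continuousAt (by simp)
  obtain ⟨η, hη, h2⟩ := Metric.eventually_nhds_iff.1 h1
  have h0 : AngleLT c 0 π := fun _ => by simpa using pi_pos
  obtain ⟨ε, hε, h3⟩ := h0.exists_gt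
  refine ⟨min η ε, lt_min hη hε, fun s hs0 hs => ?_⟩
  obtain ⟨h4, h5⟩ := h2 (y := s) (by
    rw [dist_zero_right, norm_eq_abs, abs_of_pos hs0]; exact hs.trans_le (min_le_left _ _))
  have h6 : 0 < sn c s := sn_pos hs0 (h3.mono (by linarith [min_le_right η ε]))
  refine lt_of_mul_lt_mul_right ?_ h5.le
  have h7 := sn_sq c s
  rw [cs_eq] at h4 ⊢
  have h8 := mul_lt_mul_of_pos_left h4 h6
  linear_combination h8 - a * h7

/-- A combination of `cs c` and `sn c` is determined by its two boundary values. -/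
lemma jacobi_interpolation (A B s L : ℝ) :
    (A * cs c s + B * sn c s) * sn c L =
      A * sn c (L - s) + (A * cs c L + B * sn c L) * sn c s := by
  rw [sn_sub]; ring

/-- On an interval shorter than a half period, `y'' + c * y = 0` has a positive solution. -/
lemma exists_pos_jacobi {L : ℝ} (hL : AngleLT c L π) :
    ∃ a b : ℝ, ∀ s ∈ Set.Icc 0 L, 0 < a * cs c s + b * sn c s := by
  rcases le_or_gt c 0 with hc | hc
  · exact ⟨1, 0, fun s _ => by simpa using cs_pos_of_nonpos hc⟩
  · obtain ⟨ε, hε, h⟩ := hL.exists_gt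
    refine ⟨sn c ε, cs c ε, fun s hs => ?_⟩
    have := sn_pos (c := c) (s := s + ε) (by linarith [hs.1]) (h.mono (by linarith [hs.2]))
    rw [sn_add] at this
    linarith

end

/-! ### Polar coordinates and the law of cosines -/

section

open Real

variable {m : ℕ} {c : ℝ}

lemma abs_form_le_one (hc : 0 < c) (p q : SpaceForm m c) : |form p q| ≤ 1 := by
  rw [← inner_sph hc]
  simpa [norm_sph hc] using abs_real_inner_le_norm (sph p) (sph q)

lemma one_le_form (hc : c < 0) (p q : SpaceForm m c) : 1 ≤ form p q := by
  rw [form_hyp hc]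
  exact hyp_one_le (hyp_quadric hc p) (hyp_quadric hc q) (p.upper hc.le) (q.upper hc.le)

lemma t_eq_one (p : SpaceForm m 0) : p.t = 1 := by
  have h := p.quadric
  rw [zero_mul, add_zero] at h
  exact (pow_eq_one_iff_of_nonneg (p.upper le_rfl).le two_ne_zero).1 h

lemma dist_eq_gdist (p q : SpaceForm m c) : dist p q = gdist p q := rfl

lemma dist_angleLE (p q : SpaceForm m c) : AngleLE c (dist p q) π := by
  intro hc
  rw [dist_eq_gdist, gdist, if_neg hc.ne', if_pos hc, mul_div_cancel₀ _ (sqrt_pos.2 hc).ne']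
  exact arccos_le_pi _

lemma cs_dist (hc : c ≠ 0) (p q : SpaceForm m c) : cs c (dist p q) = form p q := by
  rcases lt_or_gt_of_ne hc with hc | hc
  · rw [dist_eq_gdist, gdist, if_neg hc.ne, if_neg hc.not_gt, cs_of_neg hc,
      mul_div_cancel₀ _ (sqrt_pos.2 (neg_pos.2 hc)).ne', cosh_arcosh (one_le_form hc p q)]
  · rw [dist_eq_gdist, gdist, if_neg hc.ne', if_pos hc, cs_of_pos hc,
      mul_div_cancel₀ _ (sqrt_pos.2 hc).ne']
    have := abs_le.1 (abs_form_le_one hc p q)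
    exact cos_arccos this.1 this.2

/-- The modified distance is a chordal expression in the ambient coordinates (the second summand
vanishes for `c = 0`, where `t = 1`). -/
lemma md_dist (p q : SpaceForm m c) :
    md c (dist p q) = ‖p.x - q.x‖ ^ 2 / 2 + (p.t - q.t) ^ 2 / (2 * c) := by
  by_cases hc : c = 0
  · subst hc
    simp [md_of_zero, dist_eq_gdist, gdist]
  · rw [md_of_ne hc, cs_dist hc, norm_sub_sq_real, form]
    field_simp
    linear_combination -p.quadric - q.quadric

/-- The base point of the model. -/
def base (m : ℕ) (c : ℝ) : SpaceForm m c := ⟨1, 0, by simp, fun _ => one_pos⟩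

lemma form_pos_of_nonpos (hc : c ≤ 0) (p q : SpaceForm m c) : 0 < form p q := by
  rcases hc.eq_or_lt with rfl | hc
  · simp [form, t_eq_one]
  · linarith [one_le_form hc p q]

/-- The only point at height `-1` is the antipode of the base point (which needs `c > 0`). -/
lemma x_eq_zero_of_t {a : SpaceForm m c} (h : 1 + a.t = 0) : a.x = 0 := by
  have h1 : a.t = -1 := by linarith
  have h2 : c * ‖a.x‖ ^ 2 = 0 := by have ha := a.quadric; rw [h1] at ha; linarith
  rcases mul_eq_zero.1 h2 with h2 | h2
  · exact absurd h1 (by linarith [a.upper h2.le])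
  · exact norm_eq_zero.1 (pow_eq_zero_iff two_ne_zero |>.1 h2)

lemma swap_quadric (a q : SpaceForm m c) :
    form a q ^ 2 + c * ‖((q.t + form a q) / (1 + a.t)) • a.x - q.x‖ ^ 2 = 1 := by
  have ha := a.quadric
  have hq := q.quadric
  rw [norm_sub_sq_real, norm_smul, inner_smul_left, mul_pow, norm_eq_abs, sq_abs]
  simp only [conj_trivial]
  by_cases h : 1 + a.t = 0
  · have h1 : a.t = -1 := by linarith
    rw [form, h1, x_eq_zero_of_t h]
    simp
    linarith
  · have hf : form a q = a.t * q.t + c * ⟪a.x, q.x⟫ := rfl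
    set f := form a q
    field_simp
    linear_combination (1 + a.t) ^ 2 * hq + (q.t + f) ^ 2 * ha +
      2 * (q.t + f) * (1 + a.t) * hf

/-- The point symmetry about the midpoint of the base point and `a`: an isometric involution that
exchanges the base point and `a`. If `a` is the antipode of the base point, the division by zero
is harmless, since then `a.x = 0`, and this is the antipodal map. -/
def swap (a q : SpaceForm m c) : SpaceForm m c where
  t := form a q
  x := ((q.t + form a q) / (1 + a.t)) • a.x - q.x
  quadric := swap_quadric a q
  upper hc := form_pos_of_nonpos hc a q

lemma form_swap (a p q : SpaceForm m c) : form (swap a p) (swap a q) = form p q := by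
  have ha := a.quadric
  have hp : form a p = a.t * p.t + c * ⟪a.x, p.x⟫ := rfl
  have hq : form a q = a.t * q.t + c * ⟪a.x, q.x⟫ := rfl
  have hpq : form p q = p.t * q.t + c * ⟪p.x, q.x⟫ := rfl
  have hpa : ⟪p.x, a.x⟫ = ⟪a.x, p.x⟫ := real_inner_comm _ _
  rw [hpq, form]
  simp only [swap, inner_sub_left, inner_sub_right, inner_smul_left, inner_smul_right,
    conj_trivial, real_inner_self_eq_norm_sq, hpa]
  by_cases h : 1 + a.t = 0
  · have h1 : a.t = -1 := by linarith
    rw [hp, hq, h1, x_eq_zero_of_t h]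
    simp
  · set f := form a p
    set g := form a q
    field_simp
    linear_combination (p.t + f) * (q.t + g) * ha + (1 + a.t) * (q.t + g) * hp +
      (1 + a.t) * (p.t + f) * hq

lemma form_base (q : SpaceForm m c) : form (base m c) q = q.t := by simp [form, base]

lemma swap_base (a : SpaceForm m c) : swap a (base m c) = a := by
  have h1 : form a (base m c) = a.t := by simp [form, base]
  ext1
  · exact h1
  · simp only [swap, h1]
    by_cases h : 1 + a.t = 0
    · simp [x_eq_zero_of_t h, base]
    · rw [show (base m c).t = 1 from rfl, div_self h]; simp [base]

lemma swap_swap (a q : SpaceForm m c) : swap a (swap a q) = q := by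
  have h1 : form a (swap a q) = q.t := by
    rw [← form_base q, ← form_swap a (base m c) q, swap_base]
  ext1
  · exact h1
  · have h2 : (swap a q).x = ((q.t + form a q) / (1 + a.t)) • a.x - q.x := rfl
    have h3 : (swap a q).t = form a q := rfl
    change (((swap a q).t + form a (swap a q)) / (1 + a.t)) • a.x - (swap a q).x = q.x
    rw [h1, h2, h3, add_comm (form a q)]; simp

lemma dist_swap (a p q : SpaceForm m c) : dist (swap a p) (swap a q) = dist p q := by
  by_cases hc : c = 0
  · subst hc
    have h (q : SpaceForm m 0) : (swap a q).x = a.x - q.x := by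
      simp [swap, t_eq_one, form]
    simp only [dist_eq_gdist, gdist, if_true, h]
    rw [sub_sub_sub_cancel_left, norm_sub_rev]
  · rw [dist_eq_gdist, dist_eq_gdist, gdist, gdist, form_swap, if_neg hc, if_neg hc]

/-- The unit vectors, as directions at a point. -/
abbrev Dir (m : ℕ) : Type := Metric.sphere (0 : EuclideanSpace ℝ (Fin m)) 1

lemma Dir.inner_self (u : Dir m) :
    ⟪(u : EuclideanSpace ℝ (Fin m)), (u : EuclideanSpace ℝ (Fin m))⟫ = 1 := by
  rw [real_inner_self_eq_norm_sq, norm_eq_of_mem_sphere u, one_pow]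

/-- Polar coordinates at the base point. -/
def basePolar (c s : ℝ) (u : Dir m) : SpaceForm m c where
  t := cs c s
  x := sn c s • (u : EuclideanSpace ℝ (Fin m))
  quadric := by
    rw [norm_smul, norm_eq_of_mem_sphere, mul_one, norm_eq_abs, sq_abs]; exact cs_sq c s
  upper hc := cs_pos_of_nonpos hc

/-- Geodesic polar coordinates at `a`: the point reached from `a` by the unit speed geodesic of
direction `u` at time `s`. The tangent space at `a` is identified with the one at the base point by
the symmetry `swap a`. -/
def polar (a : SpaceForm m c) (s : ℝ) (u : Dir m) : SpaceForm m c := swap a (basePolar c s u)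

/-- The **law of cosines**, in a form that makes sense for all curvatures. -/
lemma md_dist_polar (a : SpaceForm m c) (s t : ℝ) (u v : Dir m) :
    md c (dist (polar a s u) (polar a t v)) =
      md c s + md c t - c * md c s * md c t -
        sn c s * sn c t * ⟪(u : EuclideanSpace ℝ (Fin m)), (v : EuclideanSpace ℝ (Fin m))⟫ := by
  rw [polar, polar, dist_swap, md_dist]
  simp only [basePolar]
  rw [norm_sub_sq_real, norm_smul, norm_smul, norm_eq_of_mem_sphere, norm_eq_of_mem_sphere,
    inner_smul_left, inner_smul_right, conj_trivial, mul_one, mul_one, norm_eq_abs, norm_eq_abs,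
    sq_abs, sq_abs, sn_sq, sn_sq, cs_eq, cs_eq]
  by_cases hc : c = 0
  · simp only [hc]; ring
  · field_simp; ring

lemma polar_zero (a : SpaceForm m c) (u : Dir m) : polar a 0 u = a := by
  have : basePolar c 0 u = base m c := by ext1 <;> simp [basePolar, base]
  rw [polar, this, swap_base]

lemma md_dist_left_polar (a : SpaceForm m c) (s : ℝ) (u : Dir m) :
    md c (dist a (polar a s u)) = md c s := by
  have h := md_dist_polar a 0 s u u
  rw [polar_zero] at h
  simpa using h

lemma dist_left_polar (a : SpaceForm m c) {s : ℝ} (u : Dir m) (hs : 0 ≤ s) (h : AngleLE c s π) :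
    dist a (polar a s u) = s :=
  eq_of_md_eq dist_nonneg hs (dist_angleLE _ _) h (md_dist_left_polar a s u)

lemma dist_polar_polar (a : SpaceForm m c) {s t : ℝ} (u : Dir m) (hs : s ≤ t)
    (h : AngleLE c (t - s) π) : dist (polar a s u) (polar a t u) = t - s := by
  refine eq_of_md_eq dist_nonneg (by linarith) (dist_angleLE _ _) h ?_
  rw [md_dist_polar, Dir.inner_self, md_sub]
  ring

lemma polar_neg (a : SpaceForm m c) (s : ℝ) (u : Dir m) : polar a s (-u) = polar a (-s) u := by
  have : basePolar c s (-u) = basePolar c (-s) u := by ext1 <;> simp [basePolar]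
  rw [polar, polar, this]

/-- The horizontal coordinates of a geodesic satisfy the Jacobi equation. -/
lemma exists_polar_x (a : SpaceForm m c) (u : Dir m) :
    ∃ w, ∀ s, (polar a s u).x = cs c s • a.x + sn c s • w := by
  by_cases h : 1 + a.t = 0
  · exact ⟨-u, fun s => by simp [polar, swap, basePolar, x_eq_zero_of_t h]⟩
  · refine ⟨(c * ⟪a.x, (u : EuclideanSpace ℝ (Fin m))⟫ / (1 + a.t)) • a.x - u, fun s => ?_⟩
    have e : (cs c s + (a.t * cs c s +
        c * (sn c s * ⟪a.x, (u : EuclideanSpace ℝ (Fin m))⟫))) / (1 + a.t) =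
        cs c s + sn c s * (c * ⟪a.x, (u : EuclideanSpace ℝ (Fin m))⟫ / (1 + a.t)) := by
      field_simp
      ring
    simp only [polar, swap, basePolar, form, inner_smul_right, e, add_smul, smul_sub, smul_smul]
    abel

lemma polar_base_x (s : ℝ) (u : Dir m) : (polar (base m c) s u).x = -(sn c s • u) := by
  simp [polar, swap, basePolar, base]

lemma exists_basePolar [NeZero m] (p : SpaceForm m c) :
    ∃ u, basePolar c (dist (base m c) p) u = p := by
  have h := md_dist (base m c) p
  have hp := p.quadric
  simp only [base, zero_sub, norm_neg] at h
  have hcs : cs c (dist (base m c) p) = p.t := by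
    by_cases hc : c = 0
    · subst hc; rw [cs_of_zero, t_eq_one]
    · rw [cs_dist hc, form_base]
  have hsn : sn c (dist (base m c) p) = ‖p.x‖ := by
    refine (pow_left_inj₀ (sn_nonneg dist_nonneg (dist_angleLE _ _)) (norm_nonneg _)
      two_ne_zero).1 ?_
    by_cases hc : c = 0
    · subst hc
      rw [sn_sq]
      change md 0 (dist (base m 0) p) = _ at h
      rw [h, t_eq_one]; simp
    · have := cs_sq c (dist (base m c) p)
      rw [hcs] at this
      exact mul_left_cancel₀ hc (by linear_combination this - hp)
  have : ∃ u : Dir m, ‖p.x‖ • (u : EuclideanSpace ℝ (Fin m)) = p.x := by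
    by_cases hx : p.x = 0
    · exact ⟨⟨EuclideanSpace.single 0 1, by simp⟩, by simp [hx]⟩
    · refine ⟨⟨‖p.x‖⁻¹ • p.x, by simp [norm_smul, hx]⟩, ?_⟩
      simp [smul_smul, hx]
  obtain ⟨u, hu⟩ := this
  refine ⟨u, ?_⟩
  ext1
  · exact hcs
  · simp only [basePolar, hsn, hu]

lemma exists_polar [NeZero m] (a p : SpaceForm m c) : ∃ u, polar a (dist a p) u = p := by
  obtain ⟨u, hu⟩ := exists_basePolar (swap a p)
  have : dist (base m c) (swap a p) = dist a p := by
    rw [← dist_swap a, swap_base, swap_swap]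
  rw [this] at hu
  exact ⟨u, by rw [polar, hu, swap_swap]⟩

end

/-! ### Geodesic segments -/

section

open Real Filter Topology Metric

variable {m : ℕ} {c : ℝ}

lemma continuousAt_of_md_dist {Y : Type*} [TopologicalSpace Y] {f : Y → SpaceForm m c} {y : Y}
    (h : Tendsto (fun z => md c (dist (f z) (f y))) (𝓝 y) (𝓝 0)) : ContinuousAt f y := by
  refine Metric.tendsto_nhds.2 fun ε hε => ?_
  have h0 : AngleLT c 0 π := fun _ => by simpa using pi_pos
  obtain ⟨η, hη, hη'⟩ := h0.exists_gt
  rw [zero_add] at hη'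
  have h1 : AngleLE c (min η ε) π := hη'.le.mono (min_le_left _ _)
  have h2 : 0 < min η ε := lt_min hη hε
  filter_upwards [h.eventually_lt_const (md_pos h2 h1)] with z hz
  exact (lt_of_md_lt h2.le (dist_angleLE _ _) hz).trans_le (min_le_right _ _)

lemma continuous_polar (a : SpaceForm m c) :
    Continuous fun y : ℝ × Dir m => polar a y.1 y.2 := by
  refine continuous_iff_continuousAt.2 fun y => continuousAt_of_md_dist ?_
  simp only [md_dist_polar]
  refine Continuous.tendsto' (by fun_prop) _ _ ?_
  rw [Dir.inner_self]
  linear_combination -sn_sq c y.1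

/-- The geodesic segment: the points between `a` and `p`. For antipodal points of the sphere this
is the whole space. -/
def seg (a p : SpaceForm m c) : Set (SpaceForm m c) := {z | dist a z + dist z p = dist a p}

lemma eq_of_inner_eq_one {u v : Dir m}
    (h : ⟪(u : EuclideanSpace ℝ (Fin m)), (v : EuclideanSpace ℝ (Fin m))⟫ = 1) : u = v :=
  Subtype.ext ((inner_eq_one_iff_of_norm_eq_one (𝕜 := ℝ) (norm_eq_of_mem_sphere u)
    (norm_eq_of_mem_sphere v)).1 h)

lemma dir_eq_of_dist {a : SpaceForm m c} {s t : ℝ} {u v : Dir m} (hs : 0 < sn c s)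
    (ht : 0 < sn c t) (h : dist (polar a s u) (polar a t v) = t - s) : u = v := by
  have h1 := md_dist_polar a s t u v
  rw [h, md_sub] at h1
  have h2 : sn c s * sn c t *
      (1 - ⟪(u : EuclideanSpace ℝ (Fin m)), (v : EuclideanSpace ℝ (Fin m))⟫) = 0 := by
    linear_combination -h1
  have h3 := (mul_eq_zero.1 h2).resolve_left (mul_pos hs ht).ne'
  exact eq_of_inner_eq_one (by linarith)

lemma polar_mem_seg (a : SpaceForm m c) {s t : ℝ} (u : Dir m) (hs : 0 ≤ s) (hst : s ≤ t)
    (h : AngleLE c t π) : polar a s u ∈ seg a (polar a t u) := by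
  rw [seg, Set.mem_ofPred_eq, dist_left_polar a u hs (h.mono hst),
    dist_left_polar a u (hs.trans hst) h, dist_polar_polar a u hst (h.mono (by linarith))]
  ring

variable [NeZero m]

instance : ProperSpace (SpaceForm m c) := ⟨fun a r => by
  refine ((isCompact_Icc (a := 0) (b := r)).prod isCompact_univ).image (continuous_polar a)
    |>.of_isClosed_subset isClosed_closedBall fun p hp => ?_
  obtain ⟨u, hu⟩ := exists_polar a p
  exact ⟨(dist a p, u), ⟨⟨dist_nonneg, by rw [dist_comm]; exact hp⟩, trivial⟩, hu⟩⟩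

lemma exists_extension (a x : SpaceForm m c) {T : ℝ} (hT : dist a x ≤ T) (h : AngleLE c T π) :
    ∃ p, dist a p = T ∧ dist x p = T - dist a x := by
  obtain ⟨u, hu⟩ := exists_polar a x
  refine ⟨polar a T u, dist_left_polar a u (dist_nonneg.trans hT) h, ?_⟩
  conv_lhs => rw [← hu]
  exact dist_polar_polar a u hT (h.mono (by linarith [dist_nonneg (x := a) (y := x)]))

lemma exists_between (a p : SpaceForm m c) {s : ℝ} (hs : 0 ≤ s) (hs' : s ≤ dist a p) :
    ∃ z, dist a z = s ∧ dist z p = dist a p - s := by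
  obtain ⟨u, hu⟩ := exists_polar a p
  have h := dist_angleLE a p
  refine ⟨polar a s u, dist_left_polar a u hs (h.mono hs'), ?_⟩
  conv_lhs => rw [← hu]
  exact dist_polar_polar a u hs' (h.mono (by linarith))

lemma eq_polar_of_mem_seg {a z : SpaceForm m c} {t : ℝ} {u : Dir m} (ht : 0 ≤ t)
    (h : AngleLT c t π) (hz : z ∈ seg a (polar a t u)) : z = polar a (dist a z) u := by
  obtain ⟨v, hv⟩ := exists_polar a z
  have h1 : dist a z + dist z (polar a t u) = t := by
    rw [seg, Set.mem_ofPred_eq, dist_left_polar a u ht h.le] at hz; exact hz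
  have h2 : dist a z ≤ t := by linarith [dist_nonneg (x := z) (y := polar a t u)]
  rcases (dist_nonneg (x := a) (y := z)).eq_or_lt with h0 | h0
  · rw [← h0, polar_zero]; exact (eq_of_dist_eq_zero h0.symm).symm
  · have : v = u := by
      refine dir_eq_of_dist (a := a) (s := dist a z) (t := t) (sn_pos h0 (h.mono h2))
        (sn_pos (h0.trans_le h2) h) ?_
      rw [hv]; linarith
    rw [← this, hv]

lemma seg_unique {a p z z' : SpaceForm m c} (h : AngleLT c (dist a p) π) (hz : z ∈ seg a p)
    (hz' : z' ∈ seg a p) (hd : dist a z = dist a z') : z = z' := by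
  obtain ⟨u, hu⟩ := exists_polar a p
  rw [← hu] at hz hz'
  rw [eq_polar_of_mem_seg dist_nonneg h hz, eq_polar_of_mem_seg dist_nonneg h hz', hd]

/-- Geodesics do not branch. -/
lemma extension_unique {a x p p' : SpaceForm m c} (hax : a ≠ x)
    (hp : dist a x + dist x p = dist a p) (hp' : dist a x + dist x p' = dist a p')
    (h : dist a p = dist a p') : p = p' := by
  obtain ⟨v, hv⟩ := exists_polar a p
  obtain ⟨v', hv'⟩ := exists_polar a p'
  obtain ⟨u, hu⟩ := exists_polar a x
  have h0 : 0 < dist a x := dist_pos.2 hax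
  have h1 : dist a x ≤ dist a p := by linarith [dist_nonneg (x := x) (y := p)]
  by_cases hT : AngleLT c (dist a p) π
  · have hs := sn_pos h0 (hT.mono h1)
    have hs' := sn_pos (h0.trans_le h1) hT
    have e1 : u = v := dir_eq_of_dist (a := a) hs hs' (by rw [hu, hv]; linarith)
    have e2 : u = v' := dir_eq_of_dist (a := a) hs hs' (by rw [hu, h, hv']; linarith)
    rw [← hv, ← hv', ← e1, ← e2, h]
  -- otherwise `p` and `p'` are both the antipode of `a`
  · simp only [AngleLT, Classical.not_imp, not_lt] at hT
    have h2 : sn c (dist a p) = 0 := by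
      rw [sn_of_pos hT.1, le_antisymm (dist_angleLE a p hT.1) hT.2, sin_pi, zero_div]
    have h3 : md c (dist p p') = 0 := by
      rw [← hv, ← hv', ← h, md_dist_polar]
      have := sn_sq c (dist a p)
      rw [h2] at this ⊢
      linear_combination -this
    rw [← md_zero c] at h3
    exact eq_of_dist_eq_zero (eq_of_md_eq dist_nonneg le_rfl (dist_angleLE _ _)
      (fun _ => by simpa using pi_pos.le) h3)

/-- Along a geodesic the modified distance to a point is a solution of `y'' + c * y = 1`. -/
lemma exists_md_dist_polar (a z : SpaceForm m c) (u : Dir m) :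
    ∃ B, ∀ s, md c (dist (polar a s u) z) = md c (dist a z) * cs c s + B * sn c s + md c s := by
  obtain ⟨v, hv⟩ := exists_polar a z
  refine ⟨-(sn c (dist a z) *
    ⟪(u : EuclideanSpace ℝ (Fin m)), (v : EuclideanSpace ℝ (Fin m))⟫), fun s => ?_⟩
  conv_lhs => rw [← hv]
  rw [md_dist_polar, cs_eq]
  ring

lemma closedBall_subset_closure_ball (a : SpaceForm m c) {r : ℝ} (hr : 0 < r) :
    closedBall a r ⊆ closure (ball a r) := by
  intro p hp
  rw [mem_closedBall, dist_comm] at hp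
  refine Metric.mem_closure_iff.2 fun ε hε => ?_
  rcases hp.lt_or_eq with h | h
  · exact ⟨p, by rw [mem_ball, dist_comm]; exact h, by simpa⟩
  · obtain ⟨z, h1, h2⟩ := exists_between a p (s := r - min r (ε / 2))
      (by linarith [min_le_left r (ε / 2)]) (by have := lt_min hr (half_pos hε); linarith)
    refine ⟨z, ?_, ?_⟩
    · rw [mem_ball, dist_comm, h1]; have := lt_min hr (half_pos hε); linarith
    · rw [dist_comm, h2, h]; linarith [min_le_right r (ε / 2)]

lemma closedBall_subset_of_isClosed {D : Set (SpaceForm m c)} (hD : IsClosed D)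
    {a : SpaceForm m c} {r : ℝ} (hr : 0 < r) (h : ball a r ⊆ D) : closedBall a r ⊆ D :=
  (closedBall_subset_closure_ball a hr).trans (closure_minimal h hD)

/-- A ball contained in another ball (of angular radius less than `π`) has its centre at least the
own radius away from the boundary. -/
lemma dist_add_le_of_closedBall_subset {x y : SpaceForm m c} {r R : ℝ} (hr : 0 ≤ r)
    (hR : AngleLT c R π) (h : closedBall x r ⊆ closedBall y R) : dist y x + r ≤ R := by
  by_contra! hlt
  have hx : dist y x ≤ R := by
    rw [dist_comm]; exact h (mem_closedBall_self hr)
  obtain ⟨ε, hε, hε'⟩ := hR.exists_gt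
  obtain ⟨p, hp1, hp2⟩ := exists_extension y x (T := min (dist y x + r) (R + ε))
    (le_min (by linarith) (by linarith)) (hε'.le.mono (min_le_right _ _))
  have h1 : p ∈ closedBall y R := h (by
    rw [mem_closedBall, dist_comm, hp2]; linarith [min_le_left (dist y x + r) (R + ε)])
  rw [mem_closedBall, dist_comm, hp1] at h1
  exact absurd h1 (not_le.2 (lt_min hlt (by linarith)))

/-- A point of `D` on the boundary of a ball containing `D` is a boundary point of `D`. -/
lemma mem_frontier_of_subset_closedBall {D : Set (SpaceForm m c)} {y P : SpaceForm m c} {R : ℝ}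
    (hR : AngleLT c R π) (h : D ⊆ closedBall y R) (hP : P ∈ D) (hd : dist y P = R) :
    P ∈ frontier D := by
  rw [frontier_eq_closure_inter_closure]
  refine ⟨subset_closure hP, Metric.mem_closure_iff.2 fun δ hδ => ?_⟩
  obtain ⟨ε, hε, hε'⟩ := hR.exists_gt
  have h2 := lt_min hε (half_pos hδ)
  obtain ⟨p, hp1, hp2⟩ := exists_extension y P (T := R + min ε (δ / 2))
    (by linarith) (hε'.le.mono (by linarith [min_le_left ε (δ / 2)]))
  refine ⟨p, fun hpD => ?_, by rw [hp2]; linarith [min_le_right ε (δ / 2)]⟩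
  have := h hpD
  rw [mem_closedBall, dist_comm, hp1] at this
  linarith

/-! ### Comparison with Jacobi functions -/

/-- Maximum principle: a continuous function that at each interior point of `[0, L]` is touched
from below by a local subsolution `A * cs + B * sn + k * md` (`k ≥ 0`) of `y'' + c * y = 0` is
nonpositive if its boundary values are, provided `L` is less than a half period. -/
theorem jacobi_comparison {L : ℝ} {g : ℝ → ℝ} (hL : AngleLT c L π)
    (hg : ContinuousOn g (Set.Icc 0 L))
    (hsupp : ∀ s₀ ∈ Set.Ioo 0 L, ∃ A B k : ℝ, 0 ≤ k ∧
      A * cs c s₀ + B * sn c s₀ + k * md c s₀ = g s₀ ∧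
      ∀ᶠ s in 𝓝 s₀, A * cs c s + B * sn c s + k * md c s ≤ g s)
    (h0 : g 0 ≤ 0) (h1 : g L ≤ 0) : ∀ s ∈ Set.Icc 0 L, g s ≤ 0 := by
  obtain ⟨a, b, hθ⟩ := exists_pos_jacobi hL
  intro s₁ hs₁
  by_contra! hpos
  have hqc : ContinuousOn (fun s => g s / (a * cs c s + b * sn c s)) (Set.Icc 0 L) :=
    hg.div (by fun_prop) fun s hs => (hθ s hs).ne'
  obtain ⟨σ, hσ, hmax⟩ := isCompact_Icc.exists_isMaxOn ⟨s₁, hs₁⟩ hqc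
  set M := g σ / (a * cs c σ + b * sn c σ) with hM
  have hle : ∀ s ∈ Set.Icc 0 L, g s ≤ M * (a * cs c s + b * sn c s) := fun s hs =>
    (div_le_iff₀ (hθ s hs)).1 (hmax hs)
  have hMpos : 0 < M := (div_pos hpos (hθ s₁ hs₁)).trans_le (hmax hs₁)
  -- the first point where the maximum of the quotient is attained
  have hS : IsCompact (Set.Icc 0 L ∩ (fun s => g s / (a * cs c s + b * sn c s)) ⁻¹' Set.Ici M) :=
    isCompact_Icc.of_isClosed_subset (hqc.preimage_isClosed_of_isClosed isClosed_Icc isClosed_Ici)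
      Set.inter_subset_left
  obtain ⟨s₀, ⟨hs₀, hs₀M⟩, hleast⟩ := hS.exists_isLeast
    ⟨σ, hσ, Set.mem_preimage.2 (Set.mem_Ici.2 hM.le)⟩
  have hs₀M : M * (a * cs c s₀ + b * sn c s₀) ≤ g s₀ := (le_div_iff₀ (hθ s₀ hs₀)).1 hs₀M
  have heq : g s₀ = M * (a * cs c s₀ + b * sn c s₀) := le_antisymm (hle s₀ hs₀) hs₀M
  have hgpos : 0 < g s₀ := heq ▸ mul_pos hMpos (hθ s₀ hs₀)
  have hs₀' : s₀ ∈ Set.Ioo 0 L := by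
    refine ⟨lt_of_le_of_ne hs₀.1 ?_, lt_of_le_of_ne hs₀.2 ?_⟩
    · rintro rfl; linarith
    · rintro rfl; linarith
  obtain ⟨A, B, k, hk, hval, hloc⟩ := hsupp s₀ hs₀'
  have hmin : IsLocalMin (fun s => M * (a * cs c s + b * sn c s) -
      (A * cs c s + B * sn c s + k * md c s)) s₀ := by
    filter_upwards [hloc, Ioo_mem_nhds hs₀'.1 hs₀'.2] with s h1 h2
    have := hle s ⟨h2.1.le, h2.2.le⟩
    linarith
  have hder : HasDerivAt (fun s => M * (a * cs c s + b * sn c s) -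
      (A * cs c s + B * sn c s + k * md c s))
      (M * (a * (-c * sn c s₀) + b * cs c s₀) -
        (A * (-c * sn c s₀) + B * cs c s₀ + k * sn c s₀)) s₀ :=
    ((((hasDerivAt_cs c s₀).const_mul a).add ((hasDerivAt_sn c s₀).const_mul b)).const_mul M).sub
      ((((hasDerivAt_cs c s₀).const_mul A).add ((hasDerivAt_sn c s₀).const_mul B)).add
        ((hasDerivAt_md c s₀).const_mul k))
  have hzero := hmin.hasDerivAt_eq_zero hder
  -- so the difference of the two sides is exactly `-k * md (s - s₀)`
  have hdiff (h : ℝ) : M * (a * cs c (s₀ + h) + b * sn c (s₀ + h)) -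
      (A * cs c (s₀ + h) + B * sn c (s₀ + h) + k * md c (s₀ + h)) = -k * md c h := by
    rw [md_add, sn_add, cs_add]
    have e0 : M * (a * cs c s₀ + b * sn c s₀) - (A * cs c s₀ + B * sn c s₀ + k * md c s₀) = 0 := by
      linarith
    have e1 := cs_eq c h
    linear_combination cs c h * e0 + sn c h * hzero + k * md c s₀ * e1
  obtain ⟨η, hη, hball⟩ := Metric.eventually_nhds_iff.1 hloc
  have hm := lt_min hη hs₀'.1
  set h := -(min η s₀ / 2) with hh
  have h2 := hball (y := s₀ + h) (by
    rw [dist_eq_norm, add_sub_cancel_left, hh, norm_neg, norm_eq_abs, abs_of_pos (by positivity)]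
    linarith [min_le_left η s₀])
  have h3 := hdiff h
  have hIcc : s₀ + h ∈ Set.Icc 0 L := ⟨by linarith [min_le_right η s₀], by linarith [hs₀.2]⟩
  have h4 : 0 ≤ md c h := by
    rw [hh, md_neg]
    exact md_nonneg (by positivity) (hL.le.mono (by linarith [min_le_right η s₀, hs₀.2]))
  have h5 : M ≤ g (s₀ + h) / (a * cs c (s₀ + h) + b * sn c (s₀ + h)) := by
    rw [le_div_iff₀ (hθ _ hIcc)]
    nlinarith [mul_nonneg hk h4]
  have := hleast ⟨hIcc, h5⟩
  linarith

end

/-! ### Functions supported by modified distances -/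

section

open Real Filter Topology Metric

variable {m : ℕ} {c : ℝ}

/-- The function `H` is touched from below at `z`, in a neighbourhood of `z`, by the modified
distance to some point. -/
def HasDistSupport (H : SpaceForm m c → ℝ) (z : SpaceForm m c) : Prop :=
  ∃ y, md c (dist z y) = H z ∧ ∀ᶠ z' in 𝓝 z, md c (dist z' y) ≤ H z'

lemma continuous_polar_left (a : SpaceForm m c) (u : Dir m) : Continuous fun s => polar a s u := by
  have := (continuous_polar a).comp (continuous_id.prodMk (continuous_const (y := u)))
  exact this

lemma polar_mem_seg_interior {x p : SpaceForm m c} {u : Dir m} (hu : polar x (dist x p) u = p)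
    {s : ℝ} (hs : s ∈ Set.Ioo 0 (dist x p)) :
    polar x s u ∈ seg x p ∧ polar x s u ≠ x ∧ polar x s u ≠ p := by
  have hL := dist_angleLE x p
  have h2 : dist x (polar x s u) = s := dist_left_polar x u hs.1.le (hL.mono hs.2.le)
  refine ⟨?_, ?_, ?_⟩
  · have := polar_mem_seg x u hs.1.le hs.2.le hL
    rwa [hu] at this
  · intro h; rw [h, dist_self] at h2; exact hs.1.ne h2
  · intro h; rw [h] at h2; exact hs.2.ne' h2

/-- If a compact set misses the solutions `y` of an equation with parameter `x`, it misses the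
solutions for all nearby parameters. -/
lemma eventually_forall_ne {Y Z : Type*} [TopologicalSpace Y] [TopologicalSpace Z] {K : Set Z}
    (hK : IsCompact K) {f g : Y → Z → ℝ} (hf : Continuous fun q : Y × Z => f q.1 q.2)
    (hg : Continuous fun q : Y × Z => g q.1 q.2) {x : Y}
    (h : ∀ y ∈ K, f x y ≠ g x y) : ∀ᶠ x' in 𝓝 x, ∀ y ∈ K, f x' y ≠ g x' y :=
  hK.eventually_forall_of_forall_eventually fun y hy =>
    (isOpen_ne_fun hf hg).mem_nhds (x := (x, y)) (h y hy)

lemma exists_orthogonal_dir (hm : 2 ≤ m) (u : Dir m) : ∃ n : Dir m,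
    ⟪(u : EuclideanSpace ℝ (Fin m)), (n : EuclideanSpace ℝ (Fin m))⟫ = 0 := by
  obtain ⟨k, rfl⟩ : ∃ k, m = k + 1 := ⟨m - 1, by omega⟩
  have hu : (u : EuclideanSpace ℝ (Fin (k + 1))) ≠ 0 := by
    intro h; have := norm_eq_of_mem_sphere u; rw [h, norm_zero] at this; exact zero_ne_one this
  have : Fact (Module.finrank ℝ (EuclideanSpace ℝ (Fin (k + 1))) = k + 1) := ⟨by simp⟩
  have h1 := Submodule.finrank_orthogonal_span_singleton (𝕜 := ℝ) (n := k) hu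
  have : Nontrivial (ℝ ∙ (u : EuclideanSpace ℝ (Fin (k + 1))))ᗮ :=
    Module.nontrivial_of_finrank_pos (R := ℝ) (by omega)
  obtain ⟨v, hv⟩ := exists_ne (0 : (ℝ ∙ (u : EuclideanSpace ℝ (Fin (k + 1))))ᗮ)
  have hv' : (v : EuclideanSpace ℝ (Fin (k + 1))) ≠ 0 := fun h => hv (Subtype.ext h)
  have h2 := Submodule.mem_orthogonal_singleton_iff_inner_right.1 v.2
  refine ⟨⟨‖(v : EuclideanSpace ℝ (Fin (k + 1)))‖⁻¹ • v, by simp [norm_smul, hv']⟩, ?_⟩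
  simp [inner_smul_right, h2]

variable [NeZero m]

/-- A function supported from below by modified distances lies, along a geodesic, below each
solution of `y'' + c * y = k` that it does not exceed at the endpoints, if `k ≤ 1`. -/
lemma le_of_hasDistSupport {x : SpaceForm m c} {u : Dir m} {L : ℝ} {H : SpaceForm m c → ℝ}
    (hL : AngleLT c L π) (hH : Continuous H)
    (hs : ∀ s ∈ Set.Ioo 0 L, HasDistSupport H (polar x s u)) {A B k : ℝ} (hk : k ≤ 1)
    (h0 : H x ≤ A) (h1 : H (polar x L u) ≤ A * cs c L + B * sn c L + k * md c L) :
    ∀ s ∈ Set.Icc 0 L, H (polar x s u) ≤ A * cs c s + B * sn c s + k * md c s := by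
  have hcont := continuous_polar_left x u
  have key := jacobi_comparison (g := fun s => H (polar x s u) -
    (A * cs c s + B * sn c s + k * md c s)) hL (by fun_prop) ?_ (by simp [polar_zero, h0])
    (by simpa using h1)
  · intro s hs'
    exact sub_nonpos.1 (key s hs')
  · intro s₀ hs₀
    obtain ⟨y, hy, hy'⟩ := hs s₀ hs₀
    obtain ⟨b, hb⟩ := exists_md_dist_polar x y u
    refine ⟨md c (dist x y) - A, b - B, 1 - k, by linarith, ?_, ?_⟩
    · rw [← hy, hb]; ring
    · filter_upwards [hcont.continuousAt.eventually hy'] with s h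
      rw [hb] at h
      linarith

/-- Quasiconvexity of functions supported by modified distances: the constant `W` solves
`y'' + c * y = c * W`, and `c * W ≤ 1`. -/
lemma le_const_of_hasDistSupport {x p : SpaceForm m c} {H : SpaceForm m c → ℝ}
    (hL : AngleLT c (dist x p) π) (hH : Continuous H)
    (hs : ∀ z ∈ seg x p, z ≠ x → z ≠ p → HasDistSupport H z) {W : ℝ} (hW : c * W ≤ 1)
    (h0 : H x ≤ W) (h1 : H p ≤ W) : ∀ z ∈ seg x p, H z ≤ W := by
  obtain ⟨u, hu⟩ := exists_polar x p
  intro z hz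
  have hz' : dist x z ≤ dist x p := by
    rw [seg, Set.mem_ofPred_eq] at hz
    linarith [dist_nonneg (x := z) (y := p)]
  have e (s : ℝ) : W * cs c s + 0 * sn c s + c * W * md c s = W := by rw [cs_eq]; ring
  have := le_of_hasDistSupport (x := x) (u := u) (A := W) (B := 0) (k := c * W) hL hH ?_ hW h0
    (by rw [hu, e]; exact h1) (dist x z) ⟨dist_nonneg, hz'⟩
  · rw [e] at this
    rw [← hu] at hz
    rwa [eq_polar_of_mem_seg dist_nonneg hL hz]
  · intro s hs'
    obtain ⟨h1, h2, h3⟩ := polar_mem_seg_interior hu hs'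
    exact hs _ h1 h2 h3

/-- A local lower support by a modified distance at the initial point of a geodesic persists along
the geodesic. -/
lemma md_dist_le_of_hasDistSupport {x p y : SpaceForm m c} {H : SpaceForm m c → ℝ}
    (hL : AngleLT c (dist x p) π) (hH : Continuous H)
    (hs : ∀ z ∈ seg x p, z ≠ x → z ≠ p → HasDistSupport H z)
    (h0 : md c (dist x y) = H x) (h1 : ∀ᶠ z in 𝓝 x, md c (dist z y) ≤ H z) :
    md c (dist p y) ≤ H p := by
  rcases (dist_nonneg (x := x) (y := p)).eq_or_lt with hxp | hxp
  · rw [← eq_of_dist_eq_zero hxp.symm, h0]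
  obtain ⟨u, hu⟩ := exists_polar x p
  obtain ⟨b, hb⟩ := exists_md_dist_polar x y u
  have hsn := sn_pos hxp hL
  by_contra! hlt
  set L := dist x p with hLdef
  have hpL := hb L
  rw [hu] at hpL
  have key := le_of_hasDistSupport (x := x) (u := u) (A := H x)
    (B := b + (H p - md c (dist p y)) / sn c L) (k := 1) hL hH ?_ le_rfl le_rfl ?_
  · have hcont := continuous_polar_left x u
    have h2 : ∀ᶠ s in 𝓝 (0 : ℝ), md c (dist (polar x s u) y) ≤ H (polar x s u) :=
      (hcont.tendsto' 0 x (polar_zero x u)).eventually h1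
    obtain ⟨η, hη, h3⟩ := Metric.eventually_nhds_iff.1 h2
    have h4 := lt_min hη hxp
    set s := min η L / 2 with hsdef
    have hs0 : 0 < s := by positivity
    have hsL : s < L := by linarith [min_le_right η L]
    have h5 := h3 (y := s) (by
      rw [dist_zero_right, norm_eq_abs, abs_of_pos hs0]; linarith [min_le_left η L])
    have h6 := key s ⟨hs0.le, hsL.le⟩
    rw [hb, h0] at h5
    have h7 := sn_pos hs0 (hL.mono hsL.le)
    have h8 : (H p - md c (dist p y)) / sn c L * sn c s < 0 :=
      mul_neg_of_neg_of_pos (div_neg_of_neg_of_pos (by linarith) hsn) h7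
    linarith
  · intro s hs'
    obtain ⟨h1, h2, h3⟩ := polar_mem_seg_interior hu hs'
    exact hs _ h1 h2 h3
  · rw [hu, ← h0, add_mul, div_mul_cancel₀ _ hsn.ne', hpL]
    linarith

/-- On the sphere, a function supported by modified distances controls the length of a geodesic,
which bounds it away from a half great circle. -/
lemma add_le_two_mul_cs_of_hasDistSupport {x p : SpaceForm m c} {H : SpaceForm m c → ℝ}
    (hc : 0 < c) (hL : AngleLT c (dist x p) π) (hH : Continuous H) (hxp : x ≠ p)
    (hs : ∀ z ∈ seg x p, z ≠ x → z ≠ p → HasDistSupport H z) (hpos : ∀ z ∈ seg x p, 0 ≤ H z) :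
    (1 - c * H x) + (1 - c * H p) ≤ 2 * cs c (dist x p / 2) := by
  have hxp' : 0 < dist x p := dist_pos.2 hxp
  obtain ⟨u, hu⟩ := exists_polar x p
  have hsn := sn_pos hxp' hL
  set L := dist x p with hLdef
  set B := (H p - H x * cs c L - md c L) / sn c L with hB
  have hBL : B * sn c L = H p - H x * cs c L - md c L := div_mul_cancel₀ _ hsn.ne'
  have hmem (s : ℝ) (hs' : s ∈ Set.Ioo 0 L) : polar x s u ∈ seg x p :=
    (polar_mem_seg_interior hu hs').1
  have key := le_of_hasDistSupport (x := x) (u := u) (A := H x) (B := B) (k := 1) hL hH ?_ le_rfl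
    le_rfl (by rw [hu, hBL]; linarith) (L / 2) ⟨by linarith, by linarith⟩
  · have h0 := hpos _ (hmem (L / 2) ⟨by linarith, by linarith⟩)
    have h1 : 0 ≤ H x * cs c (L / 2) + B * sn c (L / 2) + 1 * md c (L / 2) := h0.trans key
    have h2 := jacobi_interpolation (c := c) (1 - c * H x) (-c * B) (L / 2) L
    rw [show L - L / 2 = L / 2 by ring] at h2
    have h3 : sn c L = 2 * (sn c (L / 2) * cs c (L / 2)) := by
      rw [show L = L / 2 + L / 2 by ring, sn_add, show (L / 2 + L / 2) / 2 = L / 2 by ring]; ring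
    have h4 := sn_pos (c := c) (s := L / 2) (by linarith) (hL.mono (by linarith))
    have h5 := cs_pos (c := c) (s := L / 2) (by linarith) (fun hc' => by
      have := hL hc'; rw [mul_div_assoc']; linarith)
    have e1 : (1 - c * H x) * cs c L + -c * B * sn c L = 1 - c * H p := by
      rw [mul_assoc, hBL, cs_eq]; ring
    have e2 : (1 - c * H x) * cs c (L / 2) + -c * B * sn c (L / 2) ≤ 1 := by
      have := cs_eq c (L / 2)
      nlinarith [mul_nonneg hc.le h1]
    rw [e1, h3] at h2
    have h6 : sn c (L / 2) * ((1 - c * H x) + (1 - c * H p)) =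
        sn c (L / 2) * (((1 - c * H x) * cs c (L / 2) + -c * B * sn c (L / 2)) *
          (2 * cs c (L / 2))) := by linear_combination -h2
    rw [mul_left_cancel₀ h4.ne' h6]
    nlinarith
  · intro s hs'
    obtain ⟨h1, h2, h3⟩ := polar_mem_seg_interior hu hs'
    exact hs _ h1 h2 h3

/-- Balls of angular radius at most `π / 2` are convex. -/
lemma dist_le_of_mem_seg {x p y z : SpaceForm m c} {R : ℝ} (hR : AngleLE c R (π / 2))
    (hL : AngleLT c (dist x p) π) (hx : dist x y ≤ R) (hp : dist p y ≤ R) (hz : z ∈ seg x p) :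
    dist z y ≤ R := by
  have hR0 : 0 ≤ R := dist_nonneg.trans hx
  have hR' : AngleLE c R π := hR.lt_pi.le
  have hcs := cs_nonneg hR0 hR
  rw [cs_eq] at hcs
  refine le_of_md_le hR0 (dist_angleLE _ _)
    (le_const_of_hasDistSupport (H := fun z => md c (dist z y)) hL (by fun_prop)
      (fun z _ _ _ => ⟨y, rfl, Eventually.of_forall fun _ => le_rfl⟩) (by linarith)
      (md_le_md dist_nonneg hx hR') (md_le_md dist_nonneg hp hR') z hz)

/-! ### Tangent balls -/

/-- Two balls touching at `P`, one of which contains the other near `P`, are nested: the centre of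
the smaller one lies on the radius of the larger one to `P`. On a line (`m = 1`) every ball through
`P` on the correct side contains the other one near `P`, so `m ≥ 2` is needed for `ρ ≤ R`. -/
lemma tangent_ball (hm : 2 ≤ m) {P x O : SpaceForm m c} {ρ R : ℝ} (hρ : 0 < ρ) (hR : 0 < R)
    (hρ' : AngleLT c ρ π) (hR' : AngleLT c R π) (hx : dist P x = ρ) (hO : dist P O = R)
    {U : Set (SpaceForm m c)} (hU : U ∈ 𝓝 P) (h : closedBall x ρ ∩ U ⊆ closedBall O R) :
    ρ ≤ R ∧ dist x O = R - ρ := by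
  obtain ⟨u, hu⟩ := exists_polar P x
  obtain ⟨v, hv⟩ := exists_polar P O
  rw [hx] at hu
  rw [hO] at hv
  -- a point near `P` belongs to a ball through `P` iff its direction at `P` is not too far from
  -- that of the centre
  have crit (y : SpaceForm m c) (r : ℝ) (hr : 0 < r) (hr' : AngleLT c r π) (w : Dir m)
      (hy : polar P r w = y) (s : ℝ) (n : Dir m) : polar P s n ∈ closedBall y r ↔
      md c s * cs c r ≤ sn c s * (sn c r *
        ⟪(n : EuclideanSpace ℝ (Fin m)), (w : EuclideanSpace ℝ (Fin m))⟫) := by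
    have e : md c (dist (polar P s n) y) ≤ md c r ↔ polar P s n ∈ closedBall y r :=
      ⟨fun h => le_of_md_le hr.le (dist_angleLE _ _) h, fun h => md_le_md dist_nonneg h hr'.le⟩
    rw [← e, ← hy, md_dist_polar, cs_eq c r]
    constructor <;> intro h <;> linarith
  obtain ⟨η, hη, hηU⟩ := Metric.mem_nhds_iff.1 hU
  have h0 : AngleLT c 0 π := fun _ => by simpa using pi_pos
  obtain ⟨ε, hε, hε'⟩ := h0.exists_gt
  rw [zero_add] at hε'
  have hnear (s : ℝ) (hs : 0 < s) (h1 : s < η) (h2 : s < ε) (n : Dir m) : polar P s n ∈ U :=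
    hηU (by rw [mem_ball, dist_comm, dist_left_polar P n hs.le (hε'.le.mono h2.le)]; exact h1)
  have himp (s : ℝ) (hs : 0 < s) (h1 : s < η) (h2 : s < ε) (n : Dir m)
      (h3 : md c s * cs c ρ ≤ sn c s * (sn c ρ *
        ⟪(n : EuclideanSpace ℝ (Fin m)), (u : EuclideanSpace ℝ (Fin m))⟫)) :
      md c s * cs c R ≤ sn c s * (sn c R *
        ⟪(n : EuclideanSpace ℝ (Fin m)), (v : EuclideanSpace ℝ (Fin m))⟫) :=
    (crit O R hR hR' v hv s n).1 (h ⟨(crit x ρ hρ hρ' u hu s n).2 h3, hnear s hs h1 h2 n⟩)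
  have hsρ := sn_pos hρ hρ'
  have hsR := sn_pos hR hR'
  have huv : u = v := by
    by_contra hne
    have hlt : ⟪(u : EuclideanSpace ℝ (Fin m)), (v : EuclideanSpace ℝ (Fin m))⟫ < 1 := by
      refine lt_of_le_of_ne ?_ fun h => hne (eq_of_inner_eq_one h)
      simpa [norm_eq_of_mem_sphere] using
        real_inner_le_norm (u : EuclideanSpace ℝ (Fin m)) (v : EuclideanSpace ℝ (Fin m))
    -- a short way in the direction `u - v` one is inside the first ball but outside the second
    set d : EuclideanSpace ℝ (Fin m) := u - v with hd
    have hd0 : d ≠ 0 := fun h => hne (Subtype.ext (sub_eq_zero.1 h))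
    set a := 1 - ⟪(u : EuclideanSpace ℝ (Fin m)), (v : EuclideanSpace ℝ (Fin m))⟫ with ha
    have ha' : 0 < a / ‖d‖ := div_pos (by linarith) (norm_pos_iff.2 hd0)
    set n : Dir m := ⟨‖d‖⁻¹ • d, by simp [norm_smul, hd0]⟩ with hn
    have hnu : ⟪(n : EuclideanSpace ℝ (Fin m)), (u : EuclideanSpace ℝ (Fin m))⟫ = a / ‖d‖ := by
      simp only [hn, inner_smul_left, hd, inner_sub_left, Dir.inner_self, conj_trivial]
      rw [real_inner_comm]; ring
    have hnv : ⟪(n : EuclideanSpace ℝ (Fin m)), (v : EuclideanSpace ℝ (Fin m))⟫ =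
        -(a / ‖d‖) := by
      simp only [hn, inner_smul_left, hd, inner_sub_left, Dir.inner_self, conj_trivial]
      ring
    obtain ⟨s₁, hs₁, h1⟩ := exists_md_lt_sn (c := c) (cs c ρ) (mul_pos hsρ ha')
    obtain ⟨s₂, hs₂, h2⟩ := exists_md_lt_sn (c := c) (-cs c R) (mul_pos hsR ha')
    have hmin : 0 < min (min s₁ s₂) (min η ε) := by positivity
    set s := min (min s₁ s₂) (min η ε) / 2 with hs
    have hs0 : 0 < s := by positivity
    have hs1 : s < min (min s₁ s₂) (min η ε) := by linarith
    simp only [lt_min_iff] at hs1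
    have h3 := himp s hs0 hs1.2.1 hs1.2.2 n (by rw [hnu]; exact (h1 s hs0 hs1.1.1).le)
    have h4 := h2 s hs0 hs1.1.2
    rw [hnv] at h3
    linarith
  subst huv
  have hle : ρ ≤ R := by
    obtain ⟨n, hn⟩ := exists_orthogonal_dir hm u
    obtain ⟨s₁, hs₁, h1⟩ := exists_md_lt_sn (c := c) (cs c ρ) hsρ
    obtain ⟨s₂, hs₂, h2⟩ := exists_md_lt_sn (c := c) (-cs c ρ) hsρ
    have hmin : 0 < min (min s₁ s₂) (min η ε) := by positivity
    set s := min (min s₁ s₂) (min η ε) / 2 with hs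
    have hs0 : 0 < s := by positivity
    have hs1 : s < min (min s₁ s₂) (min η ε) := by linarith
    simp only [lt_min_iff] at hs1
    have hsn := sn_pos hs0 (hε'.mono hs1.2.2.le)
    have hmd := md_pos hs0 (hε'.le.mono hs1.2.2.le)
    -- the cosine of the angle at which the smaller sphere is hit
    set τ := md c s * cs c ρ / (sn c s * sn c ρ) with hτ
    have hτ1 : τ * (sn c s * sn c ρ) = md c s * cs c ρ :=
      div_mul_cancel₀ _ (mul_pos hsn hsρ).ne'
    have hτsq : τ ^ 2 ≤ 1 := by
      rw [sq_le_one_iff_abs_le_one, abs_le]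
      have := mul_pos hsn hsρ
      refine ⟨?_, (div_le_one this).2 (h1 s hs0 hs1.1.1).le⟩
      rw [hτ, le_div_iff₀ this]
      linarith [h2 s hs0 hs1.1.2]
    set w : Dir m := ⟨τ • (u : EuclideanSpace ℝ (Fin m)) +
        √(1 - τ ^ 2) • (n : EuclideanSpace ℝ (Fin m)), by
      rw [mem_sphere_zero_iff_norm, ← pow_eq_one_iff_of_nonneg (norm_nonneg _) two_ne_zero,
        norm_add_sq_real, norm_smul, norm_smul, inner_smul_left, inner_smul_right, hn,
        norm_eq_of_mem_sphere, norm_eq_of_mem_sphere, norm_eq_abs, norm_eq_abs, mul_one, mul_one,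
        sq_abs, sq_abs, sq_sqrt (by linarith)]
      simp⟩ with hw
    have hwu : ⟪(w : EuclideanSpace ℝ (Fin m)), (u : EuclideanSpace ℝ (Fin m))⟫ = τ := by
      simp only [hw, inner_add_left, inner_smul_left, Dir.inner_self, conj_trivial]
      rw [real_inner_comm, hn]; ring
    have h3 := himp s hs0 hs1.2.1 hs1.2.2 w (by rw [hwu]; linarith)
    rw [hwu] at h3
    by_contra! hlt
    have h4 := sn_pos (c := c) (s := ρ - R) (by linarith) (hρ'.mono (by linarith))
    rw [sn_sub] at h4
    have h5 := mul_le_mul_of_nonneg_right h3 hsρ.le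
    have h6 : md c s * (cs c R * sn c ρ) ≤ md c s * (cs c ρ * sn c R) := by
      linear_combination h5 + sn c R * hτ1
    have h7 := le_of_mul_le_mul_left h6 hmd
    linarith
  refine ⟨hle, ?_⟩
  rw [← hu, ← hv]
  exact dist_polar_polar P u hle (hR'.le.mono (by linarith))

end

/-! ### Depth, and balls supporting a domain from outside -/

section

open Real Filter Topology Metric

variable {m : ℕ} {c : ℝ} [NeZero m] {D : Set (SpaceForm m c)} {R : ℝ}

/-- Near each boundary point, `D` lies inside a ball of radius `R` through that point. -/
def HasOuterBalls (R : ℝ) (D : Set (SpaceForm m c)) : Prop :=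
  ∀ P ∈ frontier D, ∃ O, dist P O = R ∧ ∃ U ∈ 𝓝 P, D ∩ U ⊆ closedBall O R

/-- Near each boundary point, `D` contains a ball of radius `R` through that point. -/
def HasInnerBalls (R : ℝ) (D : Set (SpaceForm m c)) : Prop :=
  ∀ P ∈ frontier D, ∃ O, dist P O = R ∧ ∃ U ∈ 𝓝 P, closedBall O R ∩ U ⊆ D

lemma exists_closer {V : Set (SpaceForm m c)} (hV : IsOpen V) {x q : SpaceForm m c} (hq : q ∈ V)
    (hxq : x ≠ q) : ∃ z ∈ V, dist x z < dist x q := by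
  obtain ⟨ε, hε, hball⟩ := Metric.isOpen_iff.1 hV q hq
  have h := lt_min (half_pos hε) (dist_pos.2 hxq)
  obtain ⟨z, h1, h2⟩ := exists_between x q (s := dist x q - min (ε / 2) (dist x q))
    (by linarith [min_le_right (ε / 2) (dist x q)]) (by linarith)
  exact ⟨z, hball (by rw [mem_ball, h2]; linarith [min_le_left (ε / 2) (dist x q)]),
    by linarith⟩

omit [NeZero m] in
lemma mem_interior_iff_depth_pos (hne : Dᶜ.Nonempty) (x : SpaceForm m c) :
    x ∈ interior D ↔ 0 < infDist x Dᶜ := by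
  rw [← infDist_closure, ← isClosed_closure.notMem_iff_infDist_pos hne.closure, closure_compl,
    Set.notMem_compl_iff]

/-- Each point of a closed set has a nearest boundary point, at the distance of the complement. -/
lemma exists_foot (hD : IsClosed D) (hne : Dᶜ.Nonempty) {x : SpaceForm m c} (hx : x ∈ D) :
    ∃ P ∈ frontier D, dist x P = infDist x Dᶜ := by
  obtain ⟨P, hP, hd⟩ := isClosed_closure.exists_infDist_eq_dist hne.closure x
  rw [infDist_closure] at hd
  refine ⟨P, ?_, hd.symm⟩
  rw [frontier_eq_closure_inter_closure]
  refine ⟨?_, hP⟩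
  by_contra hPD
  rw [hD.closure_eq] at hPD
  obtain ⟨z, hz, hlt⟩ := exists_closer hD.isOpen_compl hPD (x := x) (by rintro rfl; exact hPD hx)
  exact absurd (infDist_le_dist_of_mem hz) (by rw [hd]; exact not_le.2 hlt)

lemma depth_angleLT (hD : IsClosed D) (hne : Dᶜ.Nonempty) (x : SpaceForm m c) :
    AngleLT c (infDist x Dᶜ) π := by
  obtain ⟨q, hq⟩ := hne
  by_cases hxq : x = q
  · subst hxq
    intro _
    rw [infDist_zero_of_mem hq, mul_zero]
    exact pi_pos
  · obtain ⟨z, hz, hlt⟩ := exists_closer hD.isOpen_compl hq hxq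
    exact (dist_angleLE x q).of_lt ((infDist_le_dist_of_mem hz).trans_lt hlt)

lemma closedBall_depth_subset (hD : IsClosed D) {x : SpaceForm m c} (hx : x ∈ D) :
    closedBall x (infDist x Dᶜ) ⊆ D := by
  rcases (infDist_nonneg (x := x) (s := Dᶜ)).eq_or_lt with h | h
  · rw [← h, closedBall_zero]; exact Set.singleton_subset_iff.2 hx
  · exact closedBall_subset_of_isClosed hD h ball_infDist_compl_subset

omit [NeZero m] in
lemma le_depth_of_closedBall_subset (hne : Dᶜ.Nonempty) {x : SpaceForm m c} {r : ℝ}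
    (h : closedBall x r ⊆ D) : r ≤ infDist x Dᶜ := by
  refine (le_infDist hne).2 fun y hy => ?_
  by_contra! hlt
  exact hy (h (by rw [mem_closedBall, dist_comm]; exact hlt.le))

/-- Suppose `P` is a boundary point nearest to `x`, and let the slightly larger ball of radius
`R + ε` and centre `O'` contain a local outer ball at `P`, touching it at `P`. Then near `x` the
depth is at most the distance to the sphere about `O'`, with equality at `x`. The enlargement
makes `x ≠ O'`, so that the radii from `O'` through points near `x` hit the sphere near `P`. -/
lemma depth_support (hm : 2 ≤ m) (hD : IsClosed D) (hne : Dᶜ.Nonempty) (hR : 0 < R)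
    (hRa : AngleLE c R (π / 2)) {x P O O' : SpaceForm m c} (hx : x ∈ interior D)
    (hP : P ∈ frontier D) (hxP : dist x P = infDist x Dᶜ) (hPO : dist P O = R)
    {U : Set (SpaceForm m c)} (hU : U ∈ 𝓝 P) (hDU : D ∩ U ⊆ closedBall O R) {ε : ℝ} (hε : 0 < ε)
    (hεa : AngleLT c (R + ε) π) (hPO' : dist P O' = R + ε) (hOO' : dist O O' = ε) :
    infDist x Dᶜ ≤ R ∧ dist x O' = R + ε - infDist x Dᶜ ∧
      ∀ᶠ z in 𝓝 x, dist z O' ≤ R + ε - infDist z Dᶜ := by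
  have hxD := interior_subset hx
  have hδ := (mem_interior_iff_depth_pos hne x).1 hx
  have hball := closedBall_depth_subset hD hxD
  have hPx : dist P x = infDist x Dᶜ := by rw [dist_comm, hxP]
  have hsub : closedBall O R ⊆ closedBall O' (R + ε) :=
    closedBall_subset_closedBall' (by rw [hOO'])
  have h1 := (tangent_ball hm hδ hR (depth_angleLT hD hne x) hRa.lt_pi hPx hPO hU
    ((Set.inter_subset_inter_left U hball).trans hDU)).1
  have h2 := (tangent_ball hm hδ (by linarith) (depth_angleLT hD hne x) hεa hPx hPO' hU
    ((Set.inter_subset_inter_left U hball).trans (hDU.trans hsub))).2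
  refine ⟨h1, h2, ?_⟩
  have hO'x : dist O' x = R + ε - infDist x Dᶜ := by rw [dist_comm, h2]
  have hne' : O' ≠ x := by
    intro h; rw [h, dist_self] at h2; linarith
  have hK : IsCompact (sphere O' (R + ε) \ interior U) :=
    (isCompact_sphere O' (R + ε)).diff isOpen_interior
  have hev := eventually_forall_ne hK (f := fun z p => dist O' z + dist z p)
    (g := fun _ _ => R + ε) (x := x) (by fun_prop) (by fun_prop) (by
      rintro p ⟨hp, hpU⟩ heq
      rw [mem_sphere, dist_comm] at hp
      have : p = P := extension_unique hne' (by rw [heq, hp])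
        (by rw [hO'x, hxP, dist_comm O' P, hPO']; ring) (by rw [hp, dist_comm O' P, hPO'])
      exact hpU (this ▸ mem_interior_iff_mem_nhds.2 hU))
  have hcl : ∀ᶠ z in 𝓝 x, dist O' z < R + ε :=
    (by fun_prop : Continuous fun z => dist O' z).continuousAt.eventually_lt continuousAt_const
      (by rw [hO'x]; linarith)
  filter_upwards [hev, hcl] with z hz hzlt
  obtain ⟨p, hp1, hp2⟩ := exists_extension O' z hzlt.le hεa.le
  have hpU : p ∈ U := by
    by_contra hpU
    exact hz p ⟨by rw [mem_sphere, dist_comm, hp1], fun h => hpU (interior_subset h)⟩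
      (by rw [hp2]; ring)
  have hpcl : p ∈ closure Dᶜ := by
    by_cases hpD : p ∈ D
    · have h3 : dist O p ≤ R := by rw [dist_comm]; exact hDU ⟨hpD, hpU⟩
      have h4 := dist_triangle O' O p
      rw [dist_comm O' O, hOO', hp1] at h4
      have : p = P := extension_unique (a := O') (x := O)
        (by rintro rfl; rw [dist_self] at hOO'; linarith)
        (by rw [dist_comm O' O, hOO', hp1]; linarith)
        (by rw [dist_comm O' O, hOO', dist_comm O P, hPO, dist_comm O' P, hPO']; ring)
        (by rw [hp1, dist_comm O' P, hPO'])
      rw [this]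
      rw [frontier_eq_closure_inter_closure] at hP
      exact hP.2
    · exact subset_closure hpD
  have h5 : infDist z Dᶜ ≤ dist z p := by
    rw [← infDist_closure]; exact infDist_le_dist_of_mem hpcl
  rw [dist_comm]
  linarith

/-- The ball about `x` that touches the boundary from inside is not larger than the outer ball at the
point of contact. -/
lemma depth_le (hm : 2 ≤ m) (hD : IsClosed D) (hne : Dᶜ.Nonempty) (hR : 0 < R)
    (hRa : AngleLE c R (π / 2)) (hloc : HasOuterBalls R D) {x : SpaceForm m c} (hx : x ∈ D) :
    infDist x Dᶜ ≤ R := by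
  rcases (infDist_nonneg (x := x) (s := Dᶜ)).eq_or_lt with h | h
  · linarith
  obtain ⟨P, hP, hxP⟩ := exists_foot hD hne hx
  obtain ⟨O, hPO, U, hU, hDU⟩ := hloc P hP
  exact (tangent_ball hm h hR (depth_angleLT hD hne x) hRa.lt_pi (by rw [dist_comm, hxP]) hPO hU
    ((Set.inter_subset_inter_left U (closedBall_depth_subset hD hx)).trans hDU)).1

/-- The key convexity property of the depth of a domain with local outer balls. -/
lemma hasDistSupport_depth (hm : 2 ≤ m) (hD : IsClosed D) (hne : Dᶜ.Nonempty) (hR : 0 < R)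
    (hRa : AngleLE c R (π / 2)) (hloc : HasOuterBalls R D) {ε : ℝ} (hε : 0 < ε)
    (hεa : AngleLT c (R + ε) π) {x : SpaceForm m c} (hx : x ∈ interior D) :
    HasDistSupport (fun z => md c (R + ε - infDist z Dᶜ)) x := by
  obtain ⟨P, hP, hxP⟩ := exists_foot hD hne (interior_subset hx)
  obtain ⟨O, hPO, U, hU, hDU⟩ := hloc P hP
  obtain ⟨O', h1, h2⟩ := exists_extension P O (T := R + ε) (by linarith) hεa.le
  obtain ⟨-, h3, h4⟩ := depth_support hm hD hne hR hRa hx hP hxP hPO hU hDU hε hεa h1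
    (by rw [h2, hPO]; ring)
  refine ⟨O', by rw [h3], h4.mono fun z hz => md_le_md dist_nonneg hz ?_⟩
  exact hεa.le.mono (by linarith [infDist_nonneg (x := z) (s := Dᶜ)])

/-- Quasiconcavity of the depth along geodesics in the interior. -/
lemma min_depth_le (hm : 2 ≤ m) (hD : IsClosed D) (hne : Dᶜ.Nonempty) (hR : 0 < R)
    (hRa : AngleLE c R (π / 2)) (hloc : HasOuterBalls R D) {x p : SpaceForm m c}
    (hL : AngleLT c (dist x p) π) (hx : x ∈ interior D) (hp : p ∈ interior D)
    (hseg : seg x p ⊆ interior D) {z : SpaceForm m c} (hz : z ∈ seg x p) :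
    min (infDist x Dᶜ) (infDist p Dᶜ) ≤ infDist z Dᶜ := by
  set μ := min (infDist x Dᶜ) (infDist p Dᶜ) with hμ
  have hμ0 : 0 < μ := lt_min ((mem_interior_iff_depth_pos hne x).1 hx)
    ((mem_interior_iff_depth_pos hne p).1 hp)
  have hμR : μ ≤ R :=
    (min_le_left _ _).trans (depth_le hm hD hne hR hRa hloc (interior_subset hx))
  obtain ⟨ε₀, hε₀, hε₀a⟩ := hRa.lt_pi.exists_gt
  set ε := min ε₀ μ with hε
  have hε0 : 0 < ε := lt_min hε₀ hμ0
  have hεa : AngleLT c (R + ε) π := hε₀a.mono (by linarith [min_le_left ε₀ μ])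
  have hcs := cs_nonneg (c := c) (s := R + ε - μ) (by linarith)
    (hRa.mono (by linarith [min_le_right ε₀ μ]))
  rw [cs_eq] at hcs
  have hmono (y : SpaceForm m c) (hy : μ ≤ infDist y Dᶜ) (hy' : y ∈ D) :
      md c (R + ε - infDist y Dᶜ) ≤ md c (R + ε - μ) :=
    md_le_md (by linarith [depth_le hm hD hne hR hRa hloc hy']) (by linarith)
      (hεa.le.mono (by linarith))
  have key := le_const_of_hasDistSupport (H := fun z => md c (R + ε - infDist z Dᶜ)) hL
    ((continuous_md c).comp (continuous_const.sub (continuous_infDist_pt _)))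
    (fun w hw _ _ => hasDistSupport_depth hm hD hne hR hRa hloc hε0 hεa (hseg hw))
    (W := md c (R + ε - μ)) (by linarith) (hmono x (min_le_left _ _) (interior_subset hx))
    (hmono p (min_le_right _ _) (interior_subset hp)) z hz
  have := le_of_md_le (by linarith)
    (hεa.le.mono (by linarith [infDist_nonneg (x := z) (s := Dᶜ)])) key
  linarith

/-- On the sphere, geodesics in the interior that start at `x` are bounded away from half great
circles, by a bound that depends only on the depth of `x`. -/
lemma cs_le_two_mul_cs (hm : 2 ≤ m) (hD : IsClosed D) (hne : Dᶜ.Nonempty) (hR : 0 < R)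
    (hRa : AngleLE c R (π / 2)) (hloc : HasOuterBalls R D) (hc : 0 < c) {x p : SpaceForm m c}
    (hL : AngleLT c (dist x p) π) (hx : x ∈ interior D) (hp : p ∈ interior D)
    (hseg : seg x p ⊆ interior D) :
    cs c (R - infDist x Dᶜ / 2) ≤ 2 * cs c (dist x p / 2) := by
  have hx0 := (mem_interior_iff_depth_pos hne x).1 hx
  have hp0 := (mem_interior_iff_depth_pos hne p).1 hp
  have hdR {y : SpaceForm m c} (hy : y ∈ interior D) : infDist y Dᶜ ≤ R :=
    depth_le hm hD hne hR hRa hloc (interior_subset hy)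
  have hle1 (s : ℝ) : cs c s ≤ 1 := by rw [cs_of_pos hc]; exact cos_le_one _
  by_cases hxp : x = p
  · subst hxp
    rw [dist_self, zero_div, cs_zero]
    linarith [hle1 (R - infDist x Dᶜ / 2)]
  obtain ⟨ε₀, hε₀, hε₀a⟩ := hRa.lt_pi.exists_gt
  set ε := min ε₀ (min (infDist x Dᶜ / 2) (infDist p Dᶜ)) with hε
  have hε0 : 0 < ε := lt_min hε₀ (lt_min (half_pos hx0) hp0)
  have hεx : ε ≤ infDist x Dᶜ / 2 := (min_le_right _ _).trans (min_le_left _ _)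
  have hεp : ε ≤ infDist p Dᶜ := (min_le_right _ _).trans (min_le_right _ _)
  have hεa : AngleLT c (R + ε) π :=
    hε₀a.mono (by linarith [min_le_left ε₀ (min (infDist x Dᶜ / 2) (infDist p Dᶜ))])
  have key := add_le_two_mul_cs_of_hasDistSupport
    (H := fun z => md c (R + ε - infDist z Dᶜ)) hc hL
    ((continuous_md c).comp (continuous_const.sub (continuous_infDist_pt _))) hxp
    (fun w hw _ _ => hasDistSupport_depth hm hD hne hR hRa hloc hε0 hεa (hseg hw))
    (fun w hw => md_nonneg (by linarith [hdR (hseg hw)])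
      (hεa.le.mono (by linarith [infDist_nonneg (x := w) (s := Dᶜ)])))
  simp only [← cs_eq] at key
  have h1 := cs_nonneg (c := c) (s := R + ε - infDist p Dᶜ) (by linarith [hdR hp])
    (hRa.mono (by linarith))
  have h2 : md c (R + ε - infDist x Dᶜ) ≤ md c (R - infDist x Dᶜ / 2) :=
    md_le_md (by linarith [hdR hx]) (by linarith) (hRa.lt_pi.le.mono (by linarith))
  have h3 := mul_le_mul_of_nonneg_left h2 hc.le
  rw [cs_eq] at h1 key ⊢
  rw [cs_eq] at key
  linarith

/-- Geodesic segments depend lower semicontinuously on their endpoint. -/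
lemma eventually_exists_mem_seg {x p z : SpaceForm m c} (hL : AngleLT c (dist x p) π)
    (hz : z ∈ seg x p) {U : Set (SpaceForm m c)} (hU : U ∈ 𝓝 z) :
    ∀ᶠ q in 𝓝 p, ∃ w ∈ seg x q, w ∈ U := by
  have hzp : dist x z ≤ dist x p := by
    rw [seg, Set.mem_ofPred_eq] at hz
    linarith [dist_nonneg (x := z) (y := p)]
  have hK : IsCompact (closedBall x (dist x z) \ interior U) :=
    (isCompact_closedBall x (dist x z)).diff isOpen_interior
  have hev := eventually_forall_ne hK
    (f := fun q w => |dist x w - min (dist x z) (dist x q)| + |dist x w + dist w q - dist x q|)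
    (g := fun _ _ => 0) (x := p) (by fun_prop) (by fun_prop) (by
      rintro w ⟨-, hwU⟩ heq
      rw [min_eq_left hzp] at heq
      have h1 : |dist x w - dist x z| = 0 := by
        linarith [abs_nonneg (dist x w - dist x z), abs_nonneg (dist x w + dist w p - dist x p)]
      have h2 : |dist x w + dist w p - dist x p| = 0 := by linarith
      rw [abs_eq_zero, sub_eq_zero] at h1 h2
      exact hwU (seg_unique hL h2 hz h1 ▸ mem_interior_iff_mem_nhds.2 hU))
  filter_upwards [hev] with q hq
  obtain ⟨w, h1, h2⟩ := exists_between x q (s := min (dist x z) (dist x q))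
    (le_min dist_nonneg dist_nonneg) (min_le_right _ _)
  refine ⟨w, by rw [seg, Set.mem_ofPred_eq, h1, h2]; ring, ?_⟩
  by_contra hwU
  refine hq w ⟨by rw [mem_closedBall, dist_comm, h1]; exact min_le_left _ _,
    fun h => hwU (interior_subset h)⟩ ?_
  rw [h1, h2]; simp

/-- The interior of a domain with local outer balls is strictly geodesically convex. -/
theorem seg_subset_interior (hm : 2 ≤ m) (hD : IsClosed D) (hne : Dᶜ.Nonempty) (hR : 0 < R)
    (hRa : AngleLE c R (π / 2)) (hloc : HasOuterBalls R D) (hconn : IsPreconnected (interior D))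
    {x p : SpaceForm m c} (hx : x ∈ interior D) (hp : p ∈ interior D) :
    AngleLT c (dist x p) π ∧ seg x p ⊆ interior D := by
  -- the points that can be reached from `x` form a relatively clopen subset of the interior
  set G : Set (SpaceForm m c) :=
    {p | p ∈ interior D ∧ AngleLT c (dist x p) π ∧ seg x p ⊆ interior D} with hG
  have hmem (q : SpaceForm m c) : q ∈ G ↔
    q ∈ interior D ∧ AngleLT c (dist x q) π ∧ seg x q ⊆ interior D := Iff.rfl
  suffices h : interior D ⊆ G from ((hmem p).1 (h hp)).2
  refine hconn.subset_of_closure_inter_subset ?_ ⟨x, hx, (hmem x).2 ⟨hx, ?_, ?_⟩⟩ ?_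
  · rw [isOpen_iff_mem_nhds]
    intro p hpG
    obtain ⟨hp, hL, hseg⟩ := (hmem p).1 hpG
    have hK : IsCompact (closedBall x (dist x p + 1) \ interior D) :=
      (isCompact_closedBall _ _).diff isOpen_interior
    have hev := eventually_forall_ne hK (f := fun q z => dist x z + dist z q)
      (g := fun q _ => dist x q) (x := p) (by fun_prop) (by fun_prop)
      (fun z hz heq => hz.2 (hseg heq))
    have hcl : ∀ᶠ q in 𝓝 p, dist x q < dist x p + 1 :=
      (by fun_prop : Continuous fun q => dist x q).continuousAt.eventually_lt continuousAt_const
        (by linarith)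
    obtain ⟨ε, hε, hε'⟩ := hL.exists_gt
    have hcl' : ∀ᶠ q in 𝓝 p, dist x q < dist x p + ε :=
      (by fun_prop : Continuous fun q => dist x q).continuousAt.eventually_lt continuousAt_const
        (by linarith)
    filter_upwards [hev, hcl, hcl', isOpen_interior.mem_nhds hp] with q h1 h2 h3 h4
    refine (hmem q).2 ⟨h4, hε'.mono h3.le, fun z hz => ?_⟩
    by_contra hzD
    rw [seg, Set.mem_ofPred_eq] at hz
    refine h1 z ⟨?_, hzD⟩ hz
    rw [mem_closedBall, dist_comm]
    linarith [dist_nonneg (x := z) (y := q)]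
  · intro _; rw [dist_self, mul_zero]; exact pi_pos
  · intro z hz
    rw [seg, Set.mem_ofPred_eq, dist_self] at hz
    have : dist x z = 0 := by
      linarith [dist_nonneg (x := x) (y := z), dist_nonneg (x := z) (y := x)]
    rwa [← eq_of_dist_eq_zero this]
  · rintro p ⟨hpG, hp⟩
    have hL : AngleLT c (dist x p) π := by
      intro hc
      have hcl : IsClosed {q | cs c (R - infDist x Dᶜ / 2) ≤ 2 * cs c (dist x q / 2)} :=
        isClosed_le continuous_const (by fun_prop)
      have hpc : cs c (R - infDist x Dᶜ / 2) ≤ 2 * cs c (dist x p / 2) := by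
        refine closure_minimal (fun q hq => ?_) hcl hpG
        obtain ⟨h1, h2, h3⟩ := (hmem q).1 hq
        exact cs_le_two_mul_cs hm hD hne hR hRa hloc hc h2 hx h1 h3
      have hx0 := (mem_interior_iff_depth_pos hne x).1 hx
      have hpos : 0 < cs c (R - infDist x Dᶜ / 2) := cs_pos
        (by linarith [depth_le hm hD hne hR hRa hloc (interior_subset hx)])
        (hRa.of_lt (by linarith))
      refine lt_of_le_of_ne (dist_angleLE x p hc) fun heq => ?_
      rw [cs_of_pos hc (s := dist x p / 2), mul_div_assoc', heq, cos_pi_div_two] at hpc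
      linarith
    refine (hmem p).2 ⟨hp, hL, fun z hz => ?_⟩
    rw [mem_interior_iff_depth_pos hne]
    have hx0 := (mem_interior_iff_depth_pos hne x).1 hx
    have hp0 := (mem_interior_iff_depth_pos hne p).1 hp
    by_contra! hle
    obtain ⟨μ, hμ0, hμ⟩ := _root_.exists_between (lt_min hx0 hp0)
    have hcont := continuous_infDist_pt (Dᶜ)
    have h1 : {w | infDist w Dᶜ < μ} ∈ 𝓝 z :=
      hcont.continuousAt.eventually_lt continuousAt_const (by linarith)
    have h2 : ∀ᶠ q in 𝓝 p, μ < infDist q Dᶜ :=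
      continuousAt_const.eventually_lt hcont.continuousAt (hμ.trans_le (min_le_right _ _))
    obtain ⟨q, ⟨⟨w, hw, hwμ⟩, hqμ⟩, hqG⟩ :=
      (mem_closure_iff_nhds.1 hpG) _ ((eventually_exists_mem_seg hL hz h1).and h2)
    obtain ⟨h3, h4, h5⟩ := (hmem q).1 hqG
    have h6 := min_depth_le hm hD hne hR hRa hloc h4 hx h3 h5 hw
    have h7 : infDist w Dᶜ < μ := hwμ
    have h8 := lt_min (hμ.trans_le (min_le_left _ _)) hqμ
    linarith

/-- A local outer ball contains the whole domain, at a boundary point where there is also an inner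
ball, of any radius. -/
theorem subset_closedBall_of_local (hm : 2 ≤ m) (hne : Dᶜ.Nonempty)
    (hcl : closure (interior D) = D) (hR : 0 < R)
    (hRa : AngleLE c R (π / 2)) (hloc : HasOuterBalls R D) (hconn : IsPreconnected (interior D))
    {P O : SpaceForm m c} (hP : P ∈ frontier D) (hPO : dist P O = R)
    {U : Set (SpaceForm m c)} (hU : U ∈ 𝓝 P) (hDU : D ∩ U ⊆ closedBall O R) {R' : ℝ}
    (hR' : 0 < R') (hin : HasInnerBalls R' D) : D ⊆ closedBall O R := by
  have hD : IsClosed D := hcl ▸ isClosed_closure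
  -- an interior point whose nearest boundary point is `P`
  obtain ⟨x, hx, hxP⟩ : ∃ x ∈ interior D, dist x P = infDist x Dᶜ := by
    obtain ⟨Q, hPQ, V, hV, hQV⟩ := hin P hP
    obtain ⟨η, hη, hηV⟩ := Metric.mem_nhds_iff.1 hV
    have hs := lt_min (half_pos hη) hR'
    obtain ⟨x, h1, h2⟩ := exists_between P Q (s := min (η / 2) R' / 2) (by positivity)
      (by rw [hPQ]; linarith [min_le_right (η / 2) R'])
    have h3 : closedBall x (min (η / 2) R' / 2) ⊆ D := by
      refine subset_trans (Set.subset_inter ?_ ?_) hQV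
      · exact closedBall_subset_closedBall' (by rw [h2, hPQ]; linarith)
      · refine subset_trans (closedBall_subset_ball' ?_) hηV
        rw [dist_comm, h1]; linarith [min_le_left (η / 2) R']
    have h4 := le_depth_of_closedBall_subset hne h3
    have h5 : infDist x Dᶜ ≤ dist x P := by
      rw [← infDist_closure]
      rw [frontier_eq_closure_inter_closure] at hP
      exact infDist_le_dist_of_mem hP.2
    refine ⟨x, (mem_interior_iff_depth_pos hne x).2 (by linarith), le_antisymm ?_ h5⟩
    rw [dist_comm, h1]; exact h4
  rw [← hcl]
  refine closure_minimal (fun p hp => ?_) isClosed_closedBall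
  obtain ⟨hL, hseg⟩ := seg_subset_interior hm hD hne hR hRa hloc hconn hx hp
  rw [mem_closedBall]
  refine le_of_forall_pos_le_add fun η hη => ?_
  obtain ⟨ε₀, hε₀, hε₀a⟩ := hRa.lt_pi.exists_gt
  have hε := lt_min hε₀ (half_pos hη)
  set ε := min ε₀ (η / 2) with hεdef
  have hεa : AngleLT c (R + ε) π := hε₀a.mono (by linarith [min_le_left ε₀ (η / 2)])
  obtain ⟨O', h1, h2⟩ := exists_extension P O (T := R + ε) (by linarith) hεa.le
  rw [hPO, add_sub_cancel_left] at h2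
  obtain ⟨-, h3, h4⟩ := depth_support hm hD hne hR hRa hx hP hxP hPO hU hDU hε hεa h1 h2
  have hang (z : SpaceForm m c) : AngleLE c (R + ε - infDist z Dᶜ) π :=
    hεa.le.mono (by linarith [infDist_nonneg (x := z) (s := Dᶜ)])
  have key := md_dist_le_of_hasDistSupport (H := fun z => md c (R + ε - infDist z Dᶜ)) (y := O') hL
    ((continuous_md c).comp (continuous_const.sub (continuous_infDist_pt _)))
    (fun w hw _ _ => hasDistSupport_depth hm hD hne hR hRa hloc hε hεa (hseg hw))
    (by rw [h3]) (h4.mono fun z hz => md_le_md dist_nonneg hz (hang z))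
  have h5 := le_of_md_le (by linarith [depth_le hm hD hne hR hRa hloc (interior_subset hp)])
    (dist_angleLE _ _) key
  have h6 := dist_triangle p O' O
  rw [dist_comm O' O, h2] at h6
  linarith [min_le_right ε₀ (η / 2), infDist_nonneg (x := p) (s := Dᶜ)]

end

/-! ### Farthest distance, and balls rolling inside a domain -/

section

open Real Filter Topology Metric

variable {m : ℕ} {c : ℝ} {D : Set (SpaceForm m c)} {R : ℝ}

/-- The largest distance from `x` to a point of `D`. -/
def farDist (D : Set (SpaceForm m c)) (x : SpaceForm m c) : ℝ := sSup (dist x '' D)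

lemma dist_le_farDist (hD : IsCompact D) (x : SpaceForm m c) {q : SpaceForm m c} (hq : q ∈ D) :
    dist x q ≤ farDist D x :=
  le_csSup (hD.image (by fun_prop)).bddAbove ⟨q, hq, rfl⟩

lemma exists_dist_eq_farDist (hD : IsCompact D) (hne : D.Nonempty) (x : SpaceForm m c) :
    ∃ q ∈ D, dist x q = farDist D x := by
  obtain ⟨q, hq, h⟩ := hD.exists_sSup_image_eq hne (f := dist x) (by fun_prop)
  exact ⟨q, hq, h.symm⟩

lemma continuous_farDist (hD : IsCompact D) (hne : D.Nonempty) : Continuous (farDist D) := by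
  refine (LipschitzWith.of_le_add fun x y => ?_).continuous
  obtain ⟨q, hq, h⟩ := exists_dist_eq_farDist hD hne x
  linarith [dist_triangle x y q, dist_le_farDist hD y hq]

lemma farDist_le (hD : IsCompact D) (hne : D.Nonempty) {x : SpaceForm m c}
    (h : D ⊆ closedBall x R) : farDist D x ≤ R := by
  obtain ⟨q, hq, h'⟩ := exists_dist_eq_farDist hD hne x
  have := h hq
  rw [mem_closedBall, dist_comm] at this
  linarith

variable [NeZero m]

/-- Suppose `q` is a point of `D` farthest from `x`, and the ball of radius `ρ` and centre `O'` is
contained in a local inner ball at `q` and touches it at `q`. Then near `x` the farthest distance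
is at least the distance to `O'` plus `ρ`, with equality at `x`. -/
lemma farDist_support (hm : 2 ≤ m) (hD : IsCompact D) {x q O O' : SpaceForm m c}
    (hxq : dist x q = farDist D x) (hFa : AngleLT c (farDist D x) π)
    (hR : 0 < R) (hRa : AngleLT c R π) (hqO : dist q O = R) {U : Set (SpaceForm m c)}
    (hU : U ∈ 𝓝 q) (hDU : closedBall O R ∩ U ⊆ D) {ρ : ℝ} (hρ : 0 < ρ) (hρR : ρ < R)
    (hqO' : dist q O' = ρ) (hOO' : dist O' O = R - ρ) (hF0 : 0 < farDist D x) :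
    R ≤ farDist D x ∧ dist x O' = farDist D x - ρ ∧
      ∀ᶠ z in 𝓝 x, dist z O' ≤ farDist D z - ρ := by
  have hqx : dist q x = farDist D x := by rw [dist_comm, hxq]
  have hDx : D ⊆ closedBall x (farDist D x) := fun p hp => by
    rw [mem_closedBall, dist_comm]; exact dist_le_farDist hD x hp
  have hsub : closedBall O' ρ ⊆ closedBall O R :=
    closedBall_subset_closedBall' (by rw [hOO']; linarith)
  have hDU' : closedBall O' ρ ∩ U ⊆ D := (Set.inter_subset_inter_left U hsub).trans hDU
  have h1 := (tangent_ball hm hR hF0 hRa hFa hqO hqx hU (hDU.trans hDx)).1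
  have h2 := (tangent_ball hm hρ hF0 (hRa.mono hρR.le) hFa hqO' hqx hU (hDU'.trans hDx)).2
  rw [dist_comm] at h2
  refine ⟨h1, h2, ?_⟩
  have hne' : x ≠ O' := by
    intro h; rw [h, dist_self, ← h] at h2; linarith
  have hK : IsCompact (sphere O' ρ \ interior U) := (isCompact_sphere O' ρ).diff isOpen_interior
  have hev := eventually_forall_ne hK (f := fun z p => dist z O' + dist O' p)
    (g := fun z p => dist z p) (x := x) (by fun_prop) (by fun_prop) (by
      rintro p ⟨hp, hpU⟩ heq
      rw [mem_sphere, dist_comm] at hp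
      have : p = q := extension_unique hne' heq
        (by rw [h2, hxq, dist_comm O' q, hqO']; ring) (by rw [← heq, h2, hp, hxq]; ring)
      exact hpU (this ▸ mem_interior_iff_mem_nhds.2 hU))
  obtain ⟨ε, hε, hε'⟩ := hFa.exists_gt
  have hcl : ∀ᶠ z in 𝓝 x, dist z O' < farDist D x - ρ + ε :=
    (by fun_prop : Continuous fun z => dist z O').continuousAt.eventually_lt continuousAt_const
      (by rw [h2]; linarith)
  filter_upwards [hev, hcl] with z hz hzlt
  obtain ⟨p, hp1, hp2⟩ := exists_extension z O' (T := dist z O' + ρ) (by linarith)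
    (hε'.le.mono (by linarith))
  rw [add_sub_cancel_left] at hp2
  have hpU : p ∈ U := by
    by_contra hpU
    exact hz p ⟨by rw [mem_sphere, dist_comm, hp2], fun h => hpU (interior_subset h)⟩
      (by rw [hp2, hp1])
  have := dist_le_farDist hD z (hDU' ⟨by rw [mem_closedBall, dist_comm, hp2], hpU⟩)
  linarith

/-- The key convexity property of the farthest distance to a domain with local inner balls. -/
lemma hasDistSupport_farDist (hm : 2 ≤ m) (hD : IsCompact D) (hne : D.Nonempty) (hR : 0 < R)
    (hRa : AngleLT c R π) (hloc : HasInnerBalls R D) {ρ : ℝ} (hρ : 0 < ρ) (hρR : ρ < R)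
    {x : SpaceForm m c} (hFa : AngleLT c (farDist D x) π) (hF0 : 0 < farDist D x) :
    R ≤ farDist D x ∧ HasDistSupport (fun z => md c (farDist D z - ρ)) x := by
  obtain ⟨q, hq, hxq⟩ := exists_dist_eq_farDist hD hne x
  have hqf : q ∈ frontier D := mem_frontier_of_subset_closedBall hFa
    (fun p hp => by rw [mem_closedBall, dist_comm]; exact dist_le_farDist hD x hp) hq hxq
  obtain ⟨O, hqO, U, hU, hDU⟩ := hloc q hqf
  obtain ⟨O', h1, h2⟩ := exists_between q O hρ.le (by rw [hqO]; exact hρR.le)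
  obtain ⟨h3, h4, h5⟩ := farDist_support hm hD hxq hFa hR hRa hqO hU hDU hρ hρR h1
    (by rw [h2, hqO]) hF0
  refine ⟨h3, O', by rw [h4], h5.mono fun z hz => md_le_md dist_nonneg hz ?_⟩
  obtain ⟨p, -, hp⟩ := exists_dist_eq_farDist hD hne z
  exact (dist_angleLE z p).mono (by rw [hp]; linarith)

/-- Balls of angular radius at most `π / 2` are strictly convex. -/
lemma dist_lt_of_mem_seg {x p y z : SpaceForm m c} (hR : AngleLE c R (π / 2))
    (hL : AngleLT c (dist x p) π) (hx : dist x y < R) (hp : dist p y ≤ R) (hz : z ∈ seg x p)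
    (hzp : z ≠ p) : dist z y < R := by
  obtain ⟨u, hu⟩ := exists_polar x p
  have hR0 : 0 ≤ R := dist_nonneg.trans hx.le
  have hR' : AngleLE c R π := hR.lt_pi.le
  have hcs := cs_nonneg hR0 hR
  rw [cs_eq] at hcs
  have hz' : dist x z < dist x p := by
    rw [seg, Set.mem_ofPred_eq] at hz
    linarith [dist_pos.2 hzp]
  have hsn := sn_pos (dist_nonneg.trans_lt hz') hL
  have hWA := md_lt_md dist_nonneg hx hR'
  have e (s : ℝ) : md c (dist x y) * cs c s +
      (md c R - md c (dist x y)) * cs c (dist x p) / sn c (dist x p) * sn c s +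
      c * md c R * md c s =
      md c R - (md c R - md c (dist x y)) * sn c (dist x p - s) / sn c (dist x p) := by
    rw [sn_sub]
    have := cs_eq c s
    field_simp
    linear_combination sn c (dist x p) * md c R * this
  have key := le_of_hasDistSupport (x := x) (u := u) (H := fun z => md c (dist z y))
    (A := md c (dist x y))
    (B := (md c R - md c (dist x y)) * cs c (dist x p) / sn c (dist x p)) (k := c * md c R) hL
    (by fun_prop) (fun s _ => ⟨y, rfl, Eventually.of_forall fun _ => le_rfl⟩) (by linarith)
    le_rfl (by rw [e, hu]; simpa using md_le_md dist_nonneg hp hR') (dist x z)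
    ⟨dist_nonneg, hz'.le⟩
  rw [e] at key
  have hz2 : z = polar x (dist x z) u := by
    rw [← hu] at hz
    exact eq_polar_of_mem_seg dist_nonneg hL hz
  rw [← hz2] at key
  have h3 := sn_pos (c := c) (s := dist x p - dist x z) (by linarith)
    (hL.mono (by linarith [dist_nonneg (x := x) (y := z)]))
  have h4 : 0 < (md c R - md c (dist x y)) * sn c (dist x p - dist x z) / sn c (dist x p) :=
    div_pos (mul_pos (by linarith) h3) hsn
  exact lt_of_md_lt hR0 (dist_angleLE _ _) (by linarith)

/-- The centre of a local inner ball stays as far from the boundary of each large ball containing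
the domain as if the inner ball were contained in it. -/
lemma dist_add_le_of_local (hm : 2 ≤ m) (hD : IsCompact D) (hint : (interior D).Nonempty)
    {R₁ R₂ : ℝ} (hR₁a : AngleLE c R₁ (π / 2)) (hR₂ : 0 < R₂)
    (hR₂a : AngleLT c R₂ π) (hloc : HasInnerBalls R₂ D) {Q y y' O₂ : SpaceForm m c} (hQ : Q ∈ D)
    (hQy : dist Q y = R₁) (hDy : D ⊆ closedBall y R₁) (hDy' : D ⊆ closedBall y' R₁)
    (hQO : dist Q O₂ = R₂) {U : Set (SpaceForm m c)} (hU : U ∈ 𝓝 Q)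
    (hDU : closedBall O₂ R₂ ∩ U ⊆ D) : dist y' O₂ + R₂ ≤ R₁ := by
  have hne : D.Nonempty := ⟨Q, hQ⟩
  obtain ⟨x, hx⟩ := hint
  have hxD := interior_subset hx
  have hxlt {y : SpaceForm m c} (h : D ⊆ closedBall y R₁) : dist y x < R₁ := by
    refine lt_of_le_of_ne (by rw [dist_comm]; exact h hxD) fun heq => ?_
    exact (mem_frontier_of_subset_closedBall hR₁a.lt_pi h hxD heq).2 hx
  have hL : AngleLT c (dist y y') π := by
    intro hc
    have h1 := mul_lt_mul_of_pos_left
      ((dist_triangle_right y y' x).trans_lt (add_lt_add (hxlt hDy) (hxlt hDy')))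
      (sqrt_pos.2 hc)
    linarith [hR₁a hc]
  have hF {z : SpaceForm m c} (hz : D ⊆ closedBall z R₁) : farDist D z ≤ R₁ :=
    farDist_le hD hne hz
  have hball {z : SpaceForm m c} (hz : z ∈ seg y y') : D ⊆ closedBall z R₁ := fun q hq => by
    rw [mem_closedBall, dist_comm]
    refine dist_le_of_mem_seg hR₁a hL ?_ ?_ hz
    · rw [dist_comm]; exact hDy hq
    · rw [dist_comm]; exact hDy' hq
  -- `D` is not a single point
  have hF0 (z : SpaceForm m c) : 0 < farDist D z := by
    by_contra! h0
    have h1 (q : SpaceForm m c) (hq : q ∈ D) : q = z :=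
      (eq_of_dist_eq_zero (le_antisymm ((dist_le_farDist hD z hq).trans h0) dist_nonneg)).symm
    have h2 := hxlt hDy
    rw [h1 x hxD, ← h1 Q hQ, dist_comm, hQy] at h2
    exact lt_irrefl _ h2
  have hFy : farDist D y = R₁ :=
    le_antisymm (hF hDy) (by rw [← hQy, dist_comm]; exact dist_le_farDist hD y hQ)
  refine le_of_forall_pos_le_add fun η hη => ?_
  have hε := lt_min hR₂ hη
  set ε := min R₂ η / 2 with hεdef
  have hε0 : 0 < ε := by positivity
  have hεR : ε < R₂ := by linarith [min_le_left R₂ η]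
  obtain ⟨O', h1, h2⟩ := exists_between Q O₂ (s := R₂ - ε) (by linarith) (by rw [hQO]; linarith)
  rw [hQO] at h2
  obtain ⟨h3, h4, h5⟩ := farDist_support hm hD (x := y) (by rw [dist_comm, hQy, hFy])
    (by rw [hFy]; exact hR₁a.lt_pi) hR₂ hR₂a hQO hU hDU (ρ := R₂ - ε) (by linarith) (by linarith)
    h1 (by rw [h2]) (hF0 y)
  have hFle (z : SpaceForm m c) : AngleLE c (farDist D z) π := by
    obtain ⟨p, -, hp⟩ := exists_dist_eq_farDist hD hne z
    rw [← hp]; exact dist_angleLE z p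
  have hcont := continuous_farDist hD hne
  have hsupp {z : SpaceForm m c} (hz : D ⊆ closedBall z R₁) :=
    hasDistSupport_farDist hm hD hne hR₂ hR₂a hloc (ρ := R₂ - ε) (by linarith) (by linarith)
      (hR₁a.lt_pi.mono (hF hz)) (hF0 z)
  have key := md_dist_le_of_hasDistSupport (H := fun z => md c (farDist D z - (R₂ - ε))) (y := O')
    hL (by fun_prop) (fun w hw _ _ => (hsupp (hball hw)).2) (by rw [h4])
    (h5.mono fun z hz => md_le_md dist_nonneg hz ((hFle z).mono (by linarith)))
  have h6 := le_of_md_le (by linarith [(hsupp hDy').1]) (dist_angleLE _ _) key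
  have h7 := dist_triangle y' O' O₂
  linarith [hF hDy', min_le_right R₂ η]

/-- **Blaschke's rolling theorem**: a local inner ball is contained in the domain, if the domain is
contained in a ball of angular radius at most `π / 2` supporting it, at each boundary point. -/
theorem closedBall_subset_of_local (hm : 2 ≤ m) (hD : IsCompact D) (hint : (interior D).Nonempty)
    {R₁ R₂ : ℝ} (hR₁a : AngleLE c R₁ (π / 2)) (hR₂ : 0 < R₂)
    (hR₂a : AngleLT c R₂ π) (hloc : HasInnerBalls R₂ D)
    (hout : ∀ P ∈ frontier D, ∃ y, dist P y = R₁ ∧ D ⊆ closedBall y R₁) {Q O₂ : SpaceForm m c}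
    (hQ : Q ∈ frontier D) (hQO : dist Q O₂ = R₂) {U : Set (SpaceForm m c)} (hU : U ∈ 𝓝 Q)
    (hDU : closedBall O₂ R₂ ∩ U ⊆ D) : closedBall O₂ R₂ ⊆ D := by
  have hcl := hD.isClosed
  have hfr : frontier D ⊆ D := hcl.frontier_subset
  obtain ⟨y, hQy, hDy⟩ := hout Q hQ
  have hmain {y' : SpaceForm m c} (h : D ⊆ closedBall y' R₁) :
      closedBall O₂ R₂ ⊆ closedBall y' R₁ :=
    closedBall_subset_closedBall' (by
      have := dist_add_le_of_local hm hD hint hR₁a hR₂ hR₂a hloc (hfr hQ) hQy hDy h hQO hU hDU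
      rw [dist_comm] at this; linarith)
  intro z hz
  by_contra hzD
  obtain ⟨x, hx⟩ := hint
  have hxD := interior_subset hx
  have hxlt {y : SpaceForm m c} (h : D ⊆ closedBall y R₁) : dist y x < R₁ := by
    refine lt_of_le_of_ne (by rw [dist_comm]; exact h hxD) fun heq => ?_
    exact (mem_frontier_of_subset_closedBall hR₁a.lt_pi h hxD heq).2 hx
  have hzy : dist z y ≤ R₁ := hmain hDy hz
  have hL : AngleLT c (dist x z) π := by
    intro hc
    have h0 := hxlt hDy
    have h1 := mul_lt_mul_of_pos_left ((dist_triangle x y z).trans_lt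
      (add_lt_add_of_lt_of_le (by rw [dist_comm]; exact h0) (by rw [dist_comm]; exact hzy) :
        dist x y + dist y z < R₁ + R₁))
      (sqrt_pos.2 hc)
    linarith [hR₁a hc]
  obtain ⟨u, hu⟩ := exists_polar x z
  have hpre : IsPreconnected ((fun s => polar x s u) '' Set.Icc 0 (dist x z)) :=
    isPreconnected_Icc.image _ (continuous_polar_left x u).continuousOn
  -- the segment from an interior point to a point of the inner ball outside `D` meets the boundary
  obtain ⟨s, hs, hQ'⟩ : ∃ s ∈ Set.Icc 0 (dist x z), polar x s u ∈ frontier D := by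
    by_contra! hno
    obtain ⟨w, -, hw1, hw2⟩ := hpre _ _ isOpen_interior hcl.isOpen_compl (by
        rintro _ ⟨s, hs, rfl⟩
        by_cases h : polar x s u ∈ D
        · left
          by_contra h'
          exact hno s hs ⟨subset_closure h, h'⟩
        · exact Or.inr h)
      ⟨x, ⟨0, ⟨le_rfl, dist_nonneg⟩, polar_zero x u⟩, hx⟩
      ⟨z, ⟨dist x z, ⟨dist_nonneg, le_rfl⟩, hu⟩, hzD⟩
    exact hw2 (interior_subset hw1)
  obtain ⟨y', h1, h2⟩ := hout _ hQ'
  have hmem : polar x s u ∈ seg x z := by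
    have := polar_mem_seg x u hs.1 hs.2 hL.le
    rwa [hu] at this
  have := dist_lt_of_mem_seg hR₁a hL (by rw [dist_comm]; exact hxlt h2) (hmain h2 hz) hmem
    (by intro h; rw [← h] at hzD; exact hzD (hfr hQ'))
  linarith

end

/-! ### The radii -/

section

open Real Filter Topology Metric

section Radii

variable {c : ℝ}

lemma curvatureRadius_pos {κ : ℝ} (hzero : c = 0 → 0 < κ) (hneg : c < 0 → √(-c) < κ) :
    0 < curvatureRadius c κ := by
  rcases lt_trichotomy c 0 with hc | hc | hc
  · have h3 := sqrt_pos.2 (neg_pos.2 hc)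
    have h4 := hneg hc
    rw [curvatureRadius, if_neg hc.ne, if_neg hc.not_gt]
    refine div_pos (artanh_pos ⟨div_pos h3 (h3.trans h4), (div_lt_one (h3.trans h4)).2 h4⟩) h3
  · rw [curvatureRadius, if_pos hc]; exact one_div_pos.2 (hzero hc)
  · rw [curvatureRadius, if_neg hc.ne', if_pos hc]
    exact div_pos (by linarith [arctan_lt_pi_div_two (κ / √c)]) (sqrt_pos.2 hc)

/-- The outer balls are at most hemispheres. -/
lemma curvatureRadius_angleLE {κ : ℝ} (hpos : 0 < c → 0 ≤ κ) :
    AngleLE c (curvatureRadius c κ) (π / 2) := by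
  intro hc
  rw [curvatureRadius, if_neg hc.ne', if_pos hc, mul_div_cancel₀ _ (sqrt_pos.2 hc).ne']
  have := arctan_nonneg.2 (div_nonneg (hpos hc) (sqrt_nonneg c))
  linarith

lemma curvatureRadius_anti {κ₁ κ₂ : ℝ} (hκ : κ₁ ≤ κ₂) (hzero : c = 0 → 0 < κ₁)
    (hneg : c < 0 → √(-c) < κ₁) : curvatureRadius c κ₂ ≤ curvatureRadius c κ₁ := by
  rcases lt_trichotomy c 0 with hc | hc | hc
  · have h3 := sqrt_pos.2 (neg_pos.2 hc)
    have h4 := hneg hc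
    rw [curvatureRadius, curvatureRadius, if_neg hc.ne, if_neg hc.ne, if_neg hc.not_gt,
      if_neg hc.not_gt]
    refine div_le_div_of_nonneg_right (artanh_le_artanh ?_ ?_ ?_) h3.le
    · linarith [div_pos h3 ((h3.trans h4).trans_le hκ)]
    · exact (div_lt_one (h3.trans h4)).2 h4
    · exact div_le_div_of_nonneg_left h3.le (h3.trans h4) hκ
  · rw [curvatureRadius, curvatureRadius, if_pos hc, if_pos hc]
    exact one_div_le_one_div_of_le (hzero hc) hκ
  · rw [curvatureRadius, curvatureRadius, if_neg hc.ne', if_neg hc.ne', if_pos hc, if_pos hc]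
    refine div_le_div_of_nonneg_right ?_ (sqrt_nonneg c)
    have := arctan_mono (div_le_div_of_nonneg_right hκ (sqrt_nonneg c))
    linarith

/-- The excess of the outer radius over `R₂` is the second leg of the right triangle with
hypotenuse `R₁ - R₂` and first leg `R₁ - r`. -/
lemma outerRadiusBound_spec {R₁ R₂ r : ℝ} (h1 : R₂ ≤ r) (h2 : r ≤ R₁)
    (ha : AngleLT c (R₁ - R₂) (π / 2)) :
    R₂ ≤ outerRadiusBound c R₁ R₂ r ∧ AngleLT c (outerRadiusBound c R₁ R₂ r - R₂) (π / 2) ∧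
      md c (R₁ - R₂) =
        md c (R₁ - r) + md c (outerRadiusBound c R₁ R₂ r - R₂) * cs c (R₁ - r) := by
  have hh : 0 ≤ R₁ - r := by linarith
  have hhρ : R₁ - r ≤ R₁ - R₂ := by linarith
  have key (hc : c ≠ 0) (l : ℝ) (hl : cs c l = cs c (R₁ - R₂) / cs c (R₁ - r)) :
      md c (R₁ - R₂) = md c (R₁ - r) + md c l * cs c (R₁ - r) := by
    have h0 := cs_pos hh (ha.mono hhρ)
    rw [eq_div_iff h0.ne', cs_eq c l, cs_eq c (R₁ - R₂)] at hl
    have h3 := cs_eq c (R₁ - r)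
    exact mul_left_cancel₀ hc (by linear_combination hl - h3)
  rcases lt_trichotomy c 0 with hc | hc | hc
  · have h3 := sqrt_pos.2 (neg_pos.2 hc)
    have h4 : 1 ≤ cosh (√(-c) * (R₁ - R₂)) / cosh (√(-c) * (R₁ - r)) := by
      rw [one_le_div (cosh_pos _), cosh_le_cosh, abs_of_nonneg (by positivity),
        abs_of_nonneg (mul_nonneg h3.le (by linarith))]
      exact mul_le_mul_of_nonneg_left hhρ h3.le
    rw [outerRadiusBound, if_neg hc.ne, if_neg hc.not_gt, add_sub_cancel_right]
    refine ⟨by linarith [div_nonneg (arcosh_nonneg h4) h3.le], fun h => absurd h hc.not_gt, ?_⟩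
    refine key hc.ne _ ?_
    rw [cs_of_neg hc, cs_of_neg hc, cs_of_neg hc, mul_div_cancel₀ _ h3.ne', cosh_arcosh h4]
  · subst hc
    have h4 : 0 ≤ (R₁ - R₂) ^ 2 - (R₁ - r) ^ 2 := by nlinarith
    rw [outerRadiusBound, if_pos rfl, add_sub_cancel_right]
    refine ⟨by linarith [sqrt_nonneg ((R₁ - R₂) ^ 2 - (R₁ - r) ^ 2)],
      fun h => absurd h (lt_irrefl _), ?_⟩
    rw [md_of_zero, md_of_zero, md_of_zero, cs_of_zero, sq_sqrt h4]
    ring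
  · have h3 := sqrt_pos.2 hc
    have hcρ := cs_pos (by linarith : 0 ≤ R₁ - R₂) ha
    have hch := cs_pos hh (ha.mono hhρ)
    have hle : cs c (R₁ - R₂) ≤ cs c (R₁ - r) := by
      have := mul_le_mul_of_nonneg_left (md_le_md hh hhρ ha.half_lt_pi.le) hc.le
      rw [cs_eq, cs_eq]; linarith
    rw [cs_of_pos hc] at hcρ hch hle
    rw [cs_of_pos hc] at hle
    have h4 := div_pos hcρ hch
    have h5 := (div_le_one hch).2 hle
    rw [outerRadiusBound, if_neg hc.ne', if_pos hc, add_sub_cancel_right]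
    have h6 := arccos_nonneg (cos (√c * (R₁ - R₂)) / cos (√c * (R₁ - r)))
    refine ⟨by linarith [div_nonneg h6 h3.le],
      fun _ => ?_, ?_⟩
    · rw [mul_div_cancel₀ _ h3.ne']; exact arccos_lt_pi_div_two.2 h4
    · refine key hc.ne' _ ?_
      rw [cs_of_pos hc, cs_of_pos hc, cs_of_pos hc, mul_div_cancel₀ _ h3.ne',
        cos_arccos (by linarith) h5]

end Radii

/-! ### The estimate of the outer radius -/

variable {m : ℕ} {c : ℝ} [NeZero m] {D : Set (SpaceForm m c)}

/-- The law of cosines for the triangle formed by the centre `O` of an inscribed ball, the centre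
`z` of an inner ball, and the centre `y` of an outer ball that touches the inscribed ball at a
point making an angle of at most `π / 2` with the direction of `z`. The point `y` is approximated
by the centres of the outer balls at the feet of points approaching `O` along the geodesic to
`z`. -/
theorem md_le_of_inscribed (hD : IsClosed D) (hne : Dᶜ.Nonempty) {R₁ R₂ r : ℝ} (hR₂ : 0 < R₂)
    (hR₁a : AngleLE c R₁ (π / 2)) (hR₂r : R₂ ≤ r) (hrR₁ : r ≤ R₁)
    (hout : ∀ P ∈ frontier D, ∃ y, dist P y = R₁ ∧ D ⊆ closedBall y R₁) {O z : SpaceForm m c}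
    (hO : closedBall O r ⊆ D) (hmax : ∀ x ∈ D, infDist x Dᶜ ≤ r) (hz : closedBall z R₂ ⊆ D) :
    md c (R₁ - r) + md c (dist O z) * cs c (R₁ - r) ≤ md c (R₁ - R₂) := by
  rcases (dist_nonneg (x := O) (y := z)).eq_or_lt with hd | hd
  · rw [← hd, md_zero, zero_mul, add_zero]
    exact md_le_md (by linarith) (by linarith) (hR₁a.lt_pi.le.mono (by linarith))
  set d := dist O z with hdef
  obtain ⟨u, hu⟩ := exists_polar O z
  have hda := dist_angleLE O z
  have hr0 : 0 < r := hR₂.trans_le hR₂r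
  -- eliminating the unknown angle from the two laws of cosines at `O`, towards the points at
  -- distance `s` and `d`, gives an inequality that is continuous in `s` and `t = dist O y`
  set Φ : ℝ × ℝ → ℝ := fun p => (1 + cs c p.1) * (md c (R₁ - R₂) - md c p.2 - md c d * cs c p.2) +
    sn c d * cs c p.2 * sn c p.1 with hΦ
  have hstep (s : ℝ) (hs : 0 < s) (hsd : s < d) (hsr : s < r) :
      ∃ t, R₁ - r - s ≤ t ∧ t ≤ R₁ - r ∧ 0 ≤ Φ (s, t) := by
    have hsa := hda.of_lt hsd
    have hOx : dist O (polar O s u) = s := dist_left_polar O u hs.le hsa.le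
    have hxD : polar O s u ∈ D := hO (by rw [mem_closedBall, dist_comm, hOx]; exact hsr.le)
    obtain ⟨P, hP, hxP⟩ := exists_foot hD hne hxD
    obtain ⟨y, hPy, hDy⟩ := hout P hP
    have h1 : R₁ - r ≤ dist (polar O s u) y := by
      have := dist_triangle P (polar O s u) y
      rw [hPy, dist_comm P, hxP] at this
      linarith [hmax _ hxD]
    have h2 := dist_add_le_of_closedBall_subset hr0.le hR₁a.lt_pi (hO.trans hDy)
    have h3 := dist_add_le_of_closedBall_subset hR₂.le hR₁a.lt_pi (hz.trans hDy)
    rw [dist_comm y] at h2 h3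
    have h4 : R₁ - r - s ≤ dist O y := by
      have := dist_triangle (polar O s u) O y
      rw [dist_comm _ O, hOx] at this
      linarith
    refine ⟨dist O y, h4, by linarith, ?_⟩
    set t := dist O y with ht
    obtain ⟨B, hB⟩ := exists_md_dist_polar O y u
    have ht0 : 0 ≤ t := dist_nonneg
    have hcs : 0 ≤ cs c t := cs_nonneg ht0 (hR₁a.mono (by linarith))
    have h5 : md c t ≤ md c t * cs c s + B * sn c s + md c s := by
      rw [← hB]
      exact md_le_md ht0 (by linarith) (dist_angleLE _ _)
    have h6 : md c t * cs c d + B * sn c d + md c d ≤ md c (R₁ - R₂) := by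
      rw [← hB, hu]
      exact md_le_md dist_nonneg (by linarith) (hR₁a.lt_pi.le.mono (by linarith))
    have hsns := sn_pos hs hsa
    have hsnd := sn_nonneg dist_nonneg hda
    have e1 := cs_eq c s
    have e2 := cs_eq c d
    have e3 := cs_eq c t
    have e4 := sn_sq c s
    have hmds := md_pos hs hsa.le
    have h7 : 0 < 1 + cs c s := by
      have : 0 < md c s * (1 + cs c s) := by
        rw [e1]; nlinarith [pow_pos hsns 2]
      exact (mul_pos_iff_of_pos_left hmds).1 this
    have h8 : -(md c s * cs c t) ≤ B * sn c s := by
      rw [e1] at h5; rw [e3]; linarith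
    have h9 : B * sn c d ≤ md c (R₁ - R₂) - md c t - md c d * cs c t := by
      rw [e2] at h6; rw [e3]; linarith
    have h10 : -(md c s * cs c t) * sn c d ≤
        sn c s * (md c (R₁ - R₂) - md c t - md c d * cs c t) := by
      have := mul_le_mul_of_nonneg_right h8 hsnd
      have := mul_le_mul_of_nonneg_left h9 hsns.le
      linarith
    have h11 := mul_le_mul_of_nonneg_right h10 h7.le
    refine le_of_mul_le_mul_left ?_ hsns
    simp only [hΦ, mul_zero]
    have e5 : md c s * (1 + cs c s) = sn c s ^ 2 := by rw [e4, e1]; ring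
    linear_combination h11 + cs c t * sn c d * e5
  by_contra! hlt
  have h0 : Φ (0, R₁ - r) < 0 := by
    simp only [hΦ, cs_zero, sn_zero]
    linarith
  have hcont : Continuous Φ := by fun_prop
  obtain ⟨η, hη, hball⟩ := Metric.eventually_nhds_iff.1
    (hcont.continuousAt.eventually_lt continuousAt_const h0)
  have hmin : 0 < min η (min d r) := lt_min hη (lt_min hd hr0)
  obtain ⟨t, h1, h2, h3⟩ := hstep (min η (min d r) / 2) (by positivity)
    (by linarith [(min_le_right η (min d r)).trans (min_le_left d r)])
    (by linarith [(min_le_right η (min d r)).trans (min_le_right d r)])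
  refine absurd (hball (y := (min η (min d r) / 2, t)) ?_) (not_lt.2 h3)
  rw [Prod.dist_eq, max_lt_iff, dist_eq_norm, dist_eq_norm, norm_eq_abs, norm_eq_abs, abs_lt,
    abs_lt]
  dsimp only
  have := min_le_left η (min d r)
  refine ⟨⟨?_, ?_⟩, ?_, ?_⟩ <;> linarith

/-- The data that the local definition of a `κ₁, κ₂`-convex domain provides globally. -/
lemma exists_balls_of_isConvexDomain (hm : 2 ≤ m) {κ₁ κ₂ R₁ R₂ : ℝ}
    (hR₁ : R₁ = curvatureRadius c κ₁) (hR₂ : R₂ = curvatureRadius c κ₂) (hpos₁ : 0 < R₁) (hpos₂ : 0 < R₂)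
    (hR₁a : AngleLE c R₁ (π / 2)) (hR₂a : AngleLT c R₂ π) (h : IsConvexDomain κ₁ κ₂ D) :
    IsCompact D ∧ Dᶜ.Nonempty ∧ HasOuterBalls R₁ D ∧
      (∀ P ∈ frontier D, ∃ y, dist P y = R₁ ∧ D ⊆ closedBall y R₁) ∧
      ∀ Q ∈ frontier D, ∃ z, dist Q z = R₂ ∧ closedBall z R₂ ⊆ D := by
  obtain ⟨P₀, hP₀⟩ := h.frontier_nonempty
  have hne : Dᶜ.Nonempty := by
    rw [frontier_eq_closure_inter_closure] at hP₀
    exact closure_nonempty_iff.1 ⟨P₀, hP₀.2⟩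
  have hclosed : IsClosed D := h.closure_interior ▸ isClosed_closure
  have hpinch := h.pinched
  rw [← hR₁, ← hR₂] at hpinch
  have hloc₁ : HasOuterBalls R₁ D := fun P hP => by
    obtain ⟨O₁, O₂, h1, h2, h3, U, hU, h4, h5⟩ := hpinch P hP
    exact ⟨O₁, h1, U, hU, h4⟩
  have hloc₂ : HasInnerBalls R₂ D := fun P hP => by
    obtain ⟨O₁, O₂, h1, h2, h3, U, hU, h4, h5⟩ := hpinch P hP
    exact ⟨O₂, h2, U, hU, h5⟩
  have hout (P) (hP : P ∈ frontier D) : ∃ y, dist P y = R₁ ∧ D ⊆ closedBall y R₁ := by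
    obtain ⟨y, hy, U, hU, hDU⟩ := hloc₁ P hP
    exact ⟨y, hy, subset_closedBall_of_local hm hne h.closure_interior hpos₁ hR₁a hloc₁
      h.isConnected_interior.isPreconnected hP hy hU hDU hpos₂ hloc₂⟩
  have hcomp : IsCompact D := by
    obtain ⟨y, -, hy⟩ := hout P₀ hP₀
    exact (isCompact_closedBall y R₁).of_isClosed_subset hclosed hy
  refine ⟨hcomp, hne, hloc₁, hout, fun Q hQ => ?_⟩
  obtain ⟨z, hz, U, hU, hDU⟩ := hloc₂ Q hQ
  exact ⟨z, hz, closedBall_subset_of_local hm hcomp h.isConnected_interior.nonempty hR₁a hpos₂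
    hR₂a hloc₂ hout hQ hz hU hDU⟩

/-- The centre of an inscribed ball is a point of maximal depth. -/
lemma exists_isInscribedBall (hD : IsCompact D) (hne : Dᶜ.Nonempty) (hne' : D.Nonempty) :
    ∃ (O : SpaceForm m c) (r : ℝ), IsInscribedBall D O r := by
  obtain ⟨O, hO, hmax⟩ := hD.exists_isMaxOn hne' (continuous_infDist_pt Dᶜ).continuousOn
  refine ⟨O, infDist O Dᶜ, closedBall_depth_subset hD.isClosed hO, fun O' r' h => ?_⟩
  rcases lt_or_ge r' 0 with h0 | h0
  · exact h0.le.trans infDist_nonneg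
  · exact (le_depth_of_closedBall_subset hne h).trans (hmax (h (mem_closedBall_self h0)))

/-- The boundary point `P` is at distance `R₂` from the centre `z` of its inner ball, and the
distance from `O` to `z` is bounded by `md_le_of_inscribed`. -/
theorem shell_estimate (hm : 2 ≤ m) {κ₁ κ₂ R₁ R₂ : ℝ}
    (hR₁ : R₁ = curvatureRadius c κ₁) (hR₂ : R₂ = curvatureRadius c κ₂) (hpos₂ : 0 < R₂)
    (hle : R₂ ≤ R₁) (hR₁a : AngleLE c R₁ (π / 2)) (h : IsConvexDomain κ₁ κ₂ D)
    {O : SpaceForm m c} {r : ℝ} (hO : IsInscribedBall D O r) :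
    R₂ ≤ r ∧ r ≤ R₁ ∧ ∃ R : ℝ, r ≤ R ∧ frontier D ⊆ sphericalShell O r R ∧
      R ≤ outerRadiusBound c R₁ R₂ r := by
  have hpos₁ := hpos₂.trans_le hle
  obtain ⟨hcomp, hne, hloc, hout, hinn⟩ :=
    exists_balls_of_isConvexDomain hm hR₁ hR₂ hpos₁ hpos₂ hR₁a (hR₁a.lt_pi.mono hle) h
  obtain ⟨hOD, hmax⟩ := hO
  have hclosed := hcomp.isClosed
  have hR₂r : R₂ ≤ r := by
    obtain ⟨P, hP⟩ := h.frontier_nonempty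
    obtain ⟨z, -, hz⟩ := hinn P hP
    exact hmax z R₂ hz
  have hr0 : 0 < r := hpos₂.trans_le hR₂r
  have hrδ := le_depth_of_closedBall_subset hne hOD
  have hrR₁ : r ≤ R₁ :=
    hrδ.trans (depth_le hm hclosed hne hpos₁ hR₁a hloc (hOD (mem_closedBall_self hr0.le)))
  have hinner (P) (hP : P ∈ frontier D) : r ≤ dist O P := by
    rw [frontier_eq_closure_inter_closure] at hP
    rw [← infDist_closure] at hrδ
    exact hrδ.trans (infDist_le_dist_of_mem hP.2)
  have ha : AngleLT c (R₁ - R₂) (π / 2) := hR₁a.of_lt (by linarith)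
  obtain ⟨h1, h2, h3⟩ := outerRadiusBound_spec hR₂r hrR₁ ha
  have houter (P) (hP : P ∈ frontier D) : dist O P ≤ outerRadiusBound c R₁ R₂ r := by
    obtain ⟨z, hz, hzD⟩ := hinn P hP
    have h4 := md_le_of_inscribed hclosed hne hpos₂ hR₁a hR₂r hrR₁ hout hOD
      (fun x hx => hmax x _ (closedBall_depth_subset hclosed hx)) hzD
    have h5 := cs_pos (c := c) (s := R₁ - r) (by linarith) (ha.mono (by linarith))
    have h6 : md c (dist O z) ≤ md c (outerRadiusBound c R₁ R₂ r - R₂) :=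
      le_of_mul_le_mul_right (by linarith) h5
    have h7 := le_of_md_le (by linarith) (dist_angleLE _ _) h6
    have h8 := dist_triangle O z P
    rw [dist_comm z P, hz] at h8
    linarith
  refine ⟨hR₂r, hrR₁, outerRadiusBound c R₁ R₂ r, ?_, fun P hP => ⟨hinner P hP, houter P hP⟩,
    le_rfl⟩
  obtain ⟨P, hP⟩ := h.frontier_nonempty
  exact (hinner P hP).trans (houter P hP)

end

/-! ### Half-spaces and segments -/

section

open Real Filter Topology Metric

variable {m : ℕ} {c : ℝ} [NeZero m]

/-- The difference of the modified distances to two points satisfies the Jacobi equation along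
geodesics, hence is interpolated linearly in the generalized sine. -/
lemma md_dist_sub_of_mem_seg {x p z : SpaceForm m c} (hL : AngleLT c (dist x p) π)
    (hz : z ∈ seg x p) (y y' : SpaceForm m c) :
    (md c (dist z y') - md c (dist z y)) * sn c (dist x p) =
      (md c (dist x y') - md c (dist x y)) * sn c (dist z p) +
        (md c (dist p y') - md c (dist p y)) * sn c (dist x z) := by
  obtain ⟨u, hu⟩ := exists_polar x p
  obtain ⟨B, hB⟩ := exists_md_dist_polar x y u
  obtain ⟨B', hB'⟩ := exists_md_dist_polar x y' u
  have hzu : polar x (dist x z) u = z := by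
    rw [← hu] at hz
    exact (eq_polar_of_mem_seg dist_nonneg hL hz).symm
  have hint := jacobi_interpolation (c := c) (md c (dist x y') - md c (dist x y)) (B' - B)
    (dist x z) (dist x p)
  have hBz := hB (dist x z)
  have hBz' := hB' (dist x z)
  have hBp := hB (dist x p)
  have hBp' := hB' (dist x p)
  rw [hzu] at hBz hBz'
  rw [hu] at hBp hBp'
  have hzp : dist z p = dist x p - dist x z := by
    rw [seg, Set.mem_ofPred_eq] at hz; linarith
  rw [hBz, hBz', hBp, hBp', hzp]
  linear_combination hint

/-- Closed half-spaces are convex. -/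
lemma dist_le_dist_of_mem_seg {x p y y' z : SpaceForm m c} (hL : AngleLT c (dist x p) π)
    (hx : dist x y ≤ dist x y') (hp : dist p y ≤ dist p y') (hz : z ∈ seg x p) :
    dist z y ≤ dist z y' := by
  rcases (dist_nonneg (x := x) (y := p)).eq_or_lt with hxp | hxp
  · have h1 : dist x z = 0 := by
      rw [seg, Set.mem_ofPred_eq] at hz
      linarith [dist_nonneg (x := x) (y := z), dist_nonneg (x := z) (y := p)]
    rwa [← eq_of_dist_eq_zero h1]
  have h1 := md_le_md dist_nonneg hx (dist_angleLE _ _)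
  have h2 := md_le_md dist_nonneg hp (dist_angleLE _ _)
  have h3 := mul_nonneg (sub_nonneg.2 h1) (sn_nonneg dist_nonneg (dist_angleLE z p))
  have h4 := mul_nonneg (sub_nonneg.2 h2) (sn_nonneg dist_nonneg (dist_angleLE x z))
  refine le_of_md_le dist_nonneg (dist_angleLE _ _) (sub_nonneg.1 ?_)
  refine nonneg_of_mul_nonneg_left ?_ (sn_pos hxp hL)
  rw [md_dist_sub_of_mem_seg hL hz]
  linarith

/-- If one endpoint of a segment is in an open half-space and the other one in its closure, then
the segment except for the latter endpoint is in the open half-space. -/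
lemma dist_lt_dist_of_mem_seg {x p y y' z : SpaceForm m c} (hL : AngleLT c (dist x p) π)
    (hx : dist x y < dist x y') (hp : dist p y ≤ dist p y') (hz : z ∈ seg x p) (hzp : z ≠ p) :
    dist z y < dist z y' := by
  have h0 := dist_pos.2 hzp
  have h5 : dist x z + dist z p = dist x p := hz
  have h1 := md_lt_md dist_nonneg hx (dist_angleLE _ _)
  have h2 := md_le_md dist_nonneg hp (dist_angleLE _ _)
  have h3 := mul_pos (sub_pos.2 h1)
    (sn_pos h0 (hL.mono (by linarith [dist_nonneg (x := x) (y := z)])))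
  have h4 := mul_nonneg (sub_nonneg.2 h2) (sn_nonneg dist_nonneg (dist_angleLE x z))
  refine lt_of_md_lt dist_nonneg (dist_angleLE _ _) (sub_pos.1 ?_)
  refine pos_of_mul_pos_left ?_ (sn_nonneg dist_nonneg (dist_angleLE x p))
  rw [md_dist_sub_of_mem_seg hL hz]
  linarith

lemma isPreconnected_seg {x p : SpaceForm m c} (hL : AngleLT c (dist x p) π) :
    IsPreconnected (seg x p) := by
  obtain ⟨u, hu⟩ := exists_polar x p
  have : seg x p = (fun s => polar x s u) '' Set.Icc 0 (dist x p) := by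
    ext z
    constructor
    · intro hz
      have h5 : dist x z + dist z p = dist x p := hz
      refine ⟨dist x z, ⟨dist_nonneg, by linarith [dist_nonneg (x := z) (y := p)]⟩, ?_⟩
      rw [← hu] at hz
      exact (eq_polar_of_mem_seg dist_nonneg hL hz).symm
    · rintro ⟨s, hs, rfl⟩
      have := polar_mem_seg x u hs.1 hs.2 hL.le
      rwa [hu] at this
  rw [this]
  exact isPreconnected_Icc.image _ (continuous_polar_left x u).continuousOn

omit [NeZero m] in
lemma left_mem_seg (x p : SpaceForm m c) : x ∈ seg x p := by
  rw [seg, Set.mem_ofPred_eq, dist_self, zero_add]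

omit [NeZero m] in
lemma right_mem_seg (x p : SpaceForm m c) : p ∈ seg x p := by
  rw [seg, Set.mem_ofPred_eq, dist_self, add_zero]

/-- Beyond a half period, but not too far, the modified distance is still larger than within a
quarter period. -/
lemma md_lt_md_of_lt {R T : ℝ} (hR : 0 ≤ R) (hRT : R < T) (hRa : AngleLE c R (π / 2))
    (hT : AngleLT c T (π + π / 2)) : md c R < md c T := by
  by_cases h : AngleLE c T π
  · exact md_lt_md hR hRT h
  · simp only [AngleLE, Classical.not_imp, not_le] at h
    obtain ⟨hc, h⟩ := h
    have h1 := cs_nonneg hR hRa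
    have h2 : cs c T < 0 := by
      rw [cs_of_pos hc]
      exact cos_neg_of_pi_div_two_lt_of_lt (by linarith [pi_pos]) (by linarith [hT hc])
    rw [cs_eq] at h1 h2
    exact lt_of_mul_lt_mul_left (by linarith) hc.le

/-! ### Rounded spindles -/

/-- The right triangle behind a rounded spindle: its vertices are the midpoint of the segment
between the centres `A`, `B` of the caps, the point `A`, and the centre of an arc. Its legs are `l`
and `h`, and its hypotenuse is `R₁ - R₂`. -/
structure SpindleTriangle (c R₁ R₂ h l : ℝ) : Prop where
  pos : 0 < R₂
  le : R₂ ≤ R₁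
  angle : AngleLE c R₁ (π / 2)
  h_nonneg : 0 ≤ h
  h_le : h ≤ R₁ - R₂
  l_nonneg : 0 ≤ l
  l_angle : AngleLT c l (π / 2)
  pythagoras : md c (R₁ - R₂) = md c h + md c l * cs c h

namespace SpindleTriangle

variable {R₁ R₂ h l : ℝ}

lemma angle_hyp (T : SpindleTriangle c R₁ R₂ h l) : AngleLT c (R₁ - R₂) (π / 2) :=
  T.angle.of_lt (by linarith [T.pos])

omit [NeZero m] in
lemma l_le (T : SpindleTriangle c R₁ R₂ h l) : l ≤ R₁ - R₂ := by
  refine le_of_md_le (by linarith [T.le]) T.l_angle.half_lt_pi.le ?_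
  have h1 := cs_pos T.l_nonneg T.l_angle
  have h2 := md_nonneg T.h_nonneg (T.angle_hyp.half_lt_pi.le.mono T.h_le)
  have h3 := T.pythagoras
  rw [cs_eq] at h1 h3
  nlinarith [mul_nonneg h2 h1.le]

lemma two_l_angle (T : SpindleTriangle c R₁ R₂ h l) : AngleLT c (2 * l) π := fun hc => by
  have := T.l_angle hc; linarith

end SpindleTriangle

/-- The intersection of the balls of radius `ρ` with centres in `V`. -/
def ballHull (ρ : ℝ) (V : Set (SpaceForm m c)) : Set (SpaceForm m c) :=
  {x | ∀ y ∈ V, dist x y ≤ ρ}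

variable {R₁ R₂ h l : ℝ}

section

variable (l) (u : Dir m)

/-- The centre of one cap of the spindle with midpoint `base m c` and axis direction `u`; the other
one is obtained from `-u`. -/
abbrev tip (c l : ℝ) (u : Dir m) : SpaceForm m c := polar (base m c) l u

/-- The centres of the balls of radius `ρ` that contain both tips. -/
def lens (c l ρ : ℝ) (u : Dir m) : Set (SpaceForm m c) :=
  {y | dist y (tip c l u) ≤ ρ ∧ dist y (tip c l (-u)) ≤ ρ}

end

namespace SpindleTriangle

variable {u : Dir m}

omit [NeZero m] in
lemma dist_tip (T : SpindleTriangle c R₁ R₂ h l) (u : Dir m) : dist (base m c) (tip c l u) = l :=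
  dist_left_polar _ u T.l_nonneg T.l_angle.half_lt_pi.le

omit [NeZero m] in
lemma dist_tip_tip (T : SpindleTriangle c R₁ R₂ h l) (u : Dir m) :
    dist (tip c l u) (tip c l (-u)) = 2 * l := by
  rw [dist_comm, tip, polar_neg, tip,
    dist_polar_polar _ u (by linarith [T.l_nonneg]) (T.two_l_angle.le.mono (by linarith))]
  ring

omit [NeZero m] in
/-- The centres of the arcs are at distance `h` from the midpoint. -/
lemma dist_arcCentre_tip (T : SpindleTriangle c R₁ R₂ h l) {n u : Dir m}
    (hn : ⟪(n : EuclideanSpace ℝ (Fin m)), (u : EuclideanSpace ℝ (Fin m))⟫ = 0) :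
    dist (polar (base m c) h n) (tip c l u) = R₁ - R₂ := by
  refine eq_of_md_eq dist_nonneg (by linarith [T.le]) (dist_angleLE _ _)
    T.angle_hyp.half_lt_pi.le ?_
  rw [tip, md_dist_polar, hn, T.pythagoras, cs_eq]
  ring

omit [NeZero m] in
lemma arcCentre_mem_lens (T : SpindleTriangle c R₁ R₂ h l) {n u : Dir m}
    (hn : ⟪(n : EuclideanSpace ℝ (Fin m)), (u : EuclideanSpace ℝ (Fin m))⟫ = 0) :
    polar (base m c) h n ∈ lens c l (R₁ - R₂) u :=
  ⟨(T.dist_arcCentre_tip hn).le, (T.dist_arcCentre_tip (u := -u) (by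
    rw [coe_neg_sphere, inner_neg_right, hn, neg_zero])).le⟩

omit [NeZero m] in
lemma base_mem_lens (T : SpindleTriangle c R₁ R₂ h l) : base m c ∈ lens c l (R₁ - R₂) u :=
  ⟨(T.dist_tip u).trans_le T.l_le, (T.dist_tip (-u)).trans_le T.l_le⟩

/-- The lens is contained in the ball of radius `h` about the midpoint. -/
lemma dist_base_le_of_mem_lens (T : SpindleTriangle c R₁ R₂ h l) {y : SpaceForm m c}
    (hy : y ∈ lens c l (R₁ - R₂) u) : dist (base m c) y ≤ h := by
  obtain ⟨w, hw⟩ := exists_polar (base m c) y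
  have hρ := T.angle_hyp.half_lt_pi.le
  have h1 := md_le_md dist_nonneg hy.1 hρ
  have h2 := md_le_md dist_nonneg hy.2 hρ
  rw [← hw, tip, md_dist_polar] at h1 h2
  rw [coe_neg_sphere, inner_neg_right] at h2
  have h3 := cs_pos T.l_nonneg T.l_angle
  have h4 := T.pythagoras
  refine le_of_md_le T.h_nonneg (dist_angleLE _ _) (le_of_mul_le_mul_right ?_ h3)
  rw [cs_eq] at h4 ⊢
  linarith

omit [NeZero m] in
lemma tip_mem_ballHull (ρ : ℝ) : tip c l u ∈ ballHull ρ (lens c l ρ u) := fun y hy => by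
  rw [dist_comm]; exact hy.1

omit [NeZero m] in
lemma tip_neg_mem_ballHull (ρ : ℝ) : tip c l (-u) ∈ ballHull ρ (lens c l ρ u) := fun y hy => by
  rw [dist_comm]; exact hy.2

/-- The spindle is contained in the union of the balls of radius `R₂` whose centres are at distance
at most `R₁ - R₂` from every point of the lens. -/
lemma exists_of_mem_spindle (T : SpindleTriangle c R₁ R₂ h l) {x : SpaceForm m c}
    (hx : x ∈ roundedSpindle R₁ R₂ (tip c l u) (tip c l (-u))) :
    ∃ p ∈ ballHull (R₁ - R₂) (lens c l (R₁ - R₂) u), x ∈ closedBall p R₂ := by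
  rcases hx with (hx | hx) | ⟨y, z, hyA, hyB, hz, hyz, hyx⟩
  · exact ⟨_, tip_mem_ballHull _, hx⟩
  · exact ⟨_, tip_neg_mem_ballHull _, hx⟩
  have hAB : AngleLT c (dist (tip c l u) (tip c l (-u))) π := by
    rw [T.dist_tip_tip]; exact T.two_l_angle
  -- a point beyond `z` as seen from `y` that is not in the hull would be separated from the lens
  -- by the bisector of `y` and a point of the lens, as the tips and hence `z` are on its other side
  have key (p : SpaceForm m c) (hzp : z ∈ seg y p) (hyp : dist y p ≤ R₁ - R₂) :
      p ∈ ballHull (R₁ - R₂) (lens c l (R₁ - R₂) u) := by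
    intro y' hy'
    by_contra! hlt
    have h1 : dist z y' ≤ dist z y := by
      refine dist_le_dist_of_mem_seg hAB ?_ ?_ hz
      · rw [dist_comm _ y, hyA, dist_comm]; exact hy'.1
      · rw [dist_comm _ y, hyB, dist_comm]; exact hy'.2
    have hpy : dist p y < dist p y' := by rw [dist_comm p y]; exact hyp.trans_lt hlt
    have hyy' : dist y y < dist y y' := by
      rw [dist_self, dist_pos]
      rintro rfl
      exact lt_irrefl _ hpy
    by_cases hzp' : z = p
    · rw [hzp'] at h1; linarith
    · exact absurd h1 (not_le.2
        (dist_lt_dist_of_mem_seg (T.angle_hyp.half_lt_pi.mono hyp) hyy' hpy.le hzp hzp'))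
  rcases le_or_gt (dist y x) (R₁ - R₂) with h0 | h0
  · exact ⟨x, key x hyz h0, mem_closedBall_self T.pos.le⟩
  · have hxa : AngleLT c (dist y x) π := T.angle.lt_pi.mono hyx
    obtain ⟨w, hw⟩ := exists_polar y x
    have hzρ : dist y z ≤ R₁ - R₂ := by
      rw [dist_comm]
      exact dist_le_of_mem_seg T.angle_hyp.le hAB (by rw [dist_comm, hyA])
        (by rw [dist_comm, hyB]) hz
    have hzw : z = polar y (dist y z) w := by
      have hz' : z ∈ seg y x := hyz
      rw [← hw] at hz'
      exact eq_polar_of_mem_seg dist_nonneg hxa hz'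
    have hρa := T.angle_hyp.half_lt_pi.le
    have hρ0 : 0 ≤ R₁ - R₂ := by linarith [T.le]
    refine ⟨polar y (R₁ - R₂) w, key _ ?_ (dist_left_polar y w hρ0 hρa).le, ?_⟩
    · rw [hzw]; exact polar_mem_seg y w dist_nonneg hzρ hρa
    · have := dist_polar_polar y w h0.le (hxa.le.mono (by linarith))
      rw [hw] at this
      rw [mem_closedBall, dist_comm, this]
      linarith

omit [NeZero m] in
lemma mem_ballHull_of_mem_closedBall {x p : SpaceForm m c}
    (hp : p ∈ ballHull (R₁ - R₂) (lens c l (R₁ - R₂) u)) (hx : x ∈ closedBall p R₂) :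
    x ∈ ballHull R₁ (lens c l (R₁ - R₂) u) := fun y hy => by
  have h1 := dist_triangle x p y
  have h2 := hp y hy
  rw [mem_closedBall] at hx
  linarith

end SpindleTriangle

end

/-! ### Rounded spindles as intersections of balls -/

section

open Real Filter Topology Metric

variable {m : ℕ} {c : ℝ} [NeZero m] {R₁ R₂ h l : ℝ}

omit [NeZero m] in
lemma exists_orthogonal_decomposition (hm : 2 ≤ m) (u : Dir m) (ξ : EuclideanSpace ℝ (Fin m)) :
    ∃ (a b : ℝ) (n : Dir m), 0 ≤ b ∧
      ⟪(n : EuclideanSpace ℝ (Fin m)), (u : EuclideanSpace ℝ (Fin m))⟫ = 0 ∧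
      ξ = a • (u : EuclideanSpace ℝ (Fin m)) + b • (n : EuclideanSpace ℝ (Fin m)) := by
  set a := ⟪ξ, (u : EuclideanSpace ℝ (Fin m))⟫ with ha
  set η := ξ - a • (u : EuclideanSpace ℝ (Fin m)) with hη
  have hηu : ⟪η, (u : EuclideanSpace ℝ (Fin m))⟫ = 0 := by
    rw [hη, inner_sub_left, inner_smul_left, Dir.inner_self, ← ha]; simp
  by_cases h0 : η = 0
  · obtain ⟨n, hn⟩ := exists_orthogonal_dir hm u
    exact ⟨a, 0, n, le_rfl, by rw [real_inner_comm]; exact hn, by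
      rw [zero_smul, add_zero]; exact sub_eq_zero.1 h0⟩
  · refine ⟨a, ‖η‖, ⟨‖η‖⁻¹ • η, by simp [norm_smul, h0]⟩, norm_nonneg _, ?_, ?_⟩
    · simp [inner_smul_left, hηu]
    · change ξ = a • (u : EuclideanSpace ℝ (Fin m)) + ‖η‖ • (‖η‖⁻¹ • η)
      rw [smul_smul, mul_inv_cancel₀ (norm_ne_zero_iff.2 h0), one_smul, hη, add_sub_cancel]

/-- A point of a geodesic whose endpoints have opposite signs of the `n`-coordinate, and lie in
the plane of `u` and `n`, is on the axis of direction `u`. -/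
lemma exists_mem_seg_axis {x y : SpaceForm m c} (hL : AngleLT c (dist y x) π) {u n : Dir m}
    (hnu : ⟪(n : EuclideanSpace ℝ (Fin m)), (u : EuclideanSpace ℝ (Fin m))⟫ = 0) {a b k : ℝ}
    (hb : 0 ≤ b) (hk : 0 ≤ k) (hy : y.x = -(k • (n : EuclideanSpace ℝ (Fin m))))
    (hx : x.x = a • (u : EuclideanSpace ℝ (Fin m)) + b • (n : EuclideanSpace ℝ (Fin m))) :
    ∃ z ∈ seg y x, ∃ e : ℝ, z.x = e • (u : EuclideanSpace ℝ (Fin m)) := by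
  obtain ⟨v, hv⟩ := exists_polar y x
  obtain ⟨w, hw⟩ := exists_polar_x y v
  have hun := real_inner_comm (n : EuclideanSpace ℝ (Fin m)) (u : EuclideanSpace ℝ (Fin m))
  rw [hnu] at hun
  have hxn : ⟪(n : EuclideanSpace ℝ (Fin m)), x.x⟫ = b := by
    rw [hx, inner_add_right, inner_smul_right, inner_smul_right, hnu, Dir.inner_self]; ring
  have hyn : ⟪(n : EuclideanSpace ℝ (Fin m)), y.x⟫ = -k := by
    rw [hy, inner_neg_right, inner_smul_right, Dir.inner_self]; ring
  have hxw : x.x = cs c (dist y x) • y.x + sn c (dist y x) • w := by rw [← hw, hv]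
  rcases (dist_nonneg (x := y) (y := x)).eq_or_lt with h0 | h0
  · have hxy : y = x := eq_of_dist_eq_zero h0.symm
    subst hxy
    have hb0 : b = 0 := by linarith
    exact ⟨y, left_mem_seg y y, a, by rw [hx, hb0, zero_smul, add_zero]⟩
  · have hcont : Continuous fun s => cs c s * ⟪(n : EuclideanSpace ℝ (Fin m)), y.x⟫ +
        sn c s * ⟪(n : EuclideanSpace ℝ (Fin m)), w⟫ := by fun_prop
    have hend : cs c (dist y x) * ⟪(n : EuclideanSpace ℝ (Fin m)), y.x⟫ +
        sn c (dist y x) * ⟪(n : EuclideanSpace ℝ (Fin m)), w⟫ = b := by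
      rw [← hxn, hxw, inner_add_right, inner_smul_right, inner_smul_right]
    obtain ⟨s, hs, hs0⟩ := intermediate_value_Icc h0.le hcont.continuousOn
      (show (0 : ℝ) ∈ Set.Icc _ _ from ⟨by simp [hyn, hk], by rw [hend]; exact hb⟩)
    have hsn := sn_pos h0 hL
    refine ⟨polar y s v, ?_, sn c s * a / sn c (dist y x), ?_⟩
    · have := polar_mem_seg y v hs.1 hs.2 hL.le
      rwa [hv] at this
    · -- the `n`-coordinate vanishes, and so do the coordinates orthogonal to the plane
      have hwx : w = (sn c (dist y x))⁻¹ • (x.x - cs c (dist y x) • y.x) := by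
        rw [hxw, add_sub_cancel_left, smul_smul, inv_mul_cancel₀ hsn.ne', one_smul]
      simp only [hyn] at hs0
      have hwn : ⟪(n : EuclideanSpace ℝ (Fin m)), w⟫ =
          (sn c (dist y x))⁻¹ * (b + cs c (dist y x) * k) := by
        rw [hwx, inner_smul_right, inner_sub_right, inner_smul_right, hxn, hyn]; ring
      rw [hwn] at hs0
      rw [hw, hwx, hx, hy]
      have e2 : cs c s * k = sn c s * ((sn c (dist y x))⁻¹ * (b + cs c (dist y x) * k)) := by
        linarith
      have e3 : cs c s • -(k • (n : EuclideanSpace ℝ (Fin m))) = -(sn c s * ((sn c (dist y x))⁻¹ *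
          (b + cs c (dist y x) * k))) • (n : EuclideanSpace ℝ (Fin m)) := by
        rw [← e2, smul_neg, smul_smul, neg_smul]
      rw [e3]
      module

namespace SpindleTriangle

variable {u : Dir m}

/-- Let `x` be in all balls of radius `R₁` about the lens, but not in the ball of radius `R₂` about
the tip `A`. Then the segment from the centre `y` of an arc to `x` cannot cross the axis at a point
`z` beyond `A`: the point `y'` at distance `R₁ - R₂` from `A`, opposite to `x`, is too far from `x`
to be in the lens, so the other tip `B` is closer to `y` than to `y'`. As `y` and `x` are closer to
`y` as well, so are `z` and the point `A` between `B` and `z`; but `y` and `y'` have the same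
distance from `A`. -/
lemma axis_le (T : SpindleTriangle c R₁ R₂ h l) {x y : SpaceForm m c} {d : ℝ}
    (hx : x ∈ ballHull R₁ (lens c l (R₁ - R₂) u)) (hxA : R₂ < dist x (tip c l u))
    (hy : y ∈ lens c l (R₁ - R₂) u)
    (hyA : dist y (tip c l u) = R₁ - R₂) (hyB : dist y (tip c l (-u)) = R₁ - R₂)
    (hda : AngleLE c d (π / 2)) (hz : polar (base m c) d u ∈ seg y x) : d ≤ l := by
  by_contra! hlt
  have hl := T.l_nonneg
  have hR₁ : 0 < R₁ := T.pos.trans_le T.le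
  obtain ⟨w, hw⟩ := exists_polar x (tip c l u)
  set t := dist x (tip c l u) with ht
  set y' := polar x (t + (R₁ - R₂)) w with hy'
  have hρ0 : 0 ≤ R₁ - R₂ := by linarith [T.le]
  have hy'A : dist (tip c l u) y' = R₁ - R₂ := by
    have := dist_polar_polar x (s := t) (t := t + (R₁ - R₂)) w (by linarith)
      (T.angle_hyp.half_lt_pi.le.mono (by linarith))
    rw [hw] at this
    rw [this]; ring
  have hxy' : md c R₁ < md c (dist x y') := by
    rw [hy', md_dist_left_polar]
    refine md_lt_md_of_lt hR₁.le (by linarith) T.angle fun hc => ?_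
    have h1 := dist_angleLE x (tip c l u) hc
    have h2 := T.angle_hyp hc
    rw [mul_add]
    linarith
  have hxy : dist x y ≤ R₁ := hx y hy
  have hy'V : y' ∉ lens c l (R₁ - R₂) u := fun h => absurd
    (md_le_md dist_nonneg (hx y' h) T.angle.lt_pi.le) (not_le.2 hxy')
  have hBlt : dist (tip c l (-u)) y < dist (tip c l (-u)) y' := by
    rw [dist_comm _ y, hyB]
    by_contra! hle
    exact hy'V ⟨by rw [dist_comm, hy'A], by rw [dist_comm]; exact hle⟩
  have hzle : dist (polar (base m c) d u) y ≤ dist (polar (base m c) d u) y' := by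
    refine dist_le_dist_of_mem_seg (x := y) (p := x) ?_ (by rw [dist_self]; exact dist_nonneg) ?_ hz
    · rw [dist_comm]; exact T.angle.lt_pi.mono hxy
    · exact hxy.trans (lt_of_md_lt dist_nonneg T.angle.lt_pi.le hxy').le
  have hBz : AngleLT c (d + l) π := fun hc => by
    have h1 := hda hc
    have h2 := T.l_angle hc
    rw [mul_add]; linarith
  have e1 : dist (tip c l (-u)) (polar (base m c) d u) = d + l := by
    rw [tip, polar_neg, dist_polar_polar _ u (by linarith) (hBz.le.mono (by linarith))]; ring
  have e2 : dist (tip c l u) (polar (base m c) d u) = d - l :=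
    dist_polar_polar _ u hlt.le (hBz.le.mono (by linarith))
  have hmem : tip c l u ∈ seg (tip c l (-u)) (polar (base m c) d u) := by
    rw [seg, Set.mem_ofPred_eq, e1, e2, dist_comm, T.dist_tip_tip]; ring
  have := dist_lt_dist_of_mem_seg (by rw [e1]; exact hBz) hBlt hzle hmem (by
    intro h; rw [h, dist_self] at e2; linarith)
  rw [dist_comm _ y, hyA, hy'A] at this
  exact lt_irrefl _ this

omit [NeZero m] in
lemma lens_neg {ρ : ℝ} : lens c l ρ (-u) = lens c l ρ u := by
  ext y
  constructor
  · rintro ⟨h1, h2⟩; rw [neg_neg] at h2; exact ⟨h2, h1⟩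
  · rintro ⟨h1, h2⟩; exact ⟨h2, by rw [neg_neg]; exact h1⟩

/-- A point `x` in all balls of radius `R₁` about the lens, but in neither cap ball, lies in the
plane section of the spindle through `x` and the axis, in the part swept by the arc whose centre `y`
is on the side of the axis opposite to `x`. -/
lemma mem_spindle_of_mem_ballHull (hm : 2 ≤ m) (T : SpindleTriangle c R₁ R₂ h l)
    {x : SpaceForm m c} (hx : x ∈ ballHull R₁ (lens c l (R₁ - R₂) u)) :
    x ∈ roundedSpindle R₁ R₂ (tip c l u) (tip c l (-u)) := by
  by_cases hxA : dist x (tip c l u) ≤ R₂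
  · exact Or.inl (Or.inl hxA)
  by_cases hxB : dist x (tip c l (-u)) ≤ R₂
  · exact Or.inl (Or.inr hxB)
  refine Or.inr ?_
  obtain ⟨a, b, n, hb, hn, hxab⟩ := exists_orthogonal_decomposition hm u x.x
  have hha := T.angle_hyp.half_lt_pi.mono T.h_le
  set y := polar (base m c) h n with hy
  have hyV : y ∈ lens c l (R₁ - R₂) u := T.arcCentre_mem_lens hn
  have hyA : dist y (tip c l u) = R₁ - R₂ := T.dist_arcCentre_tip hn
  have hyB : dist y (tip c l (-u)) = R₁ - R₂ := T.dist_arcCentre_tip (by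
    rw [coe_neg_sphere, inner_neg_right, hn, neg_zero])
  have hyx : dist y x ≤ R₁ := by rw [dist_comm]; exact hx y hyV
  have hyxa : AngleLT c (dist y x) π := T.angle.lt_pi.mono hyx
  obtain ⟨z, hz, e, hze⟩ := exists_mem_seg_axis hyxa hn hb
    (sn_nonneg T.h_nonneg hha.le) (polar_base_x h n) hxab
  have hR₁ : 0 < R₁ := T.pos.trans_le T.le
  have hz0 : dist z (base m c) ≤ R₁ := dist_le_of_mem_seg T.angle hyxa
    (by rw [dist_comm, hy, dist_left_polar _ n T.h_nonneg hha.le]; linarith [T.h_le, T.pos])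
    (hx _ T.base_mem_lens) hz
  have hd : AngleLE c (dist (base m c) z) (π / 2) := T.angle.mono (by rw [dist_comm]; exact hz0)
  obtain ⟨w, hw⟩ := exists_polar (base m c) z
  -- the point `z` of the axis is between the tips
  have hzAB : ∃ d, -l ≤ d ∧ d ≤ l ∧ z = polar (base m c) d u := by
    rcases (dist_nonneg (x := base m c) (y := z)).eq_or_lt with h0 | h0
    · refine ⟨0, by linarith [T.l_nonneg], T.l_nonneg, ?_⟩
      rw [polar_zero]; exact (eq_of_dist_eq_zero h0.symm).symm
    have hsn := sn_pos h0 hd.lt_pi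
    have hwe : (w : EuclideanSpace ℝ (Fin m)) =
        -(e / sn c (dist (base m c) z)) • (u : EuclideanSpace ℝ (Fin m)) := by
      have h1 := polar_base_x (c := c) (dist (base m c) z) w
      rw [hw, hze] at h1
      rw [neg_smul, div_eq_inv_mul, mul_smul, h1, smul_neg, neg_neg, smul_smul,
        inv_mul_cancel₀ hsn.ne', one_smul]
    have habs : |e / sn c (dist (base m c) z)| = 1 := by
      have := norm_eq_of_mem_sphere w
      rwa [hwe, norm_smul, norm_eq_of_mem_sphere u, mul_one, norm_neg, norm_eq_abs] at this
    rcases eq_or_eq_neg_of_abs_eq habs with h1 | h1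
    · have hwu : w = -u := Subtype.ext (by rw [hwe, h1, coe_neg_sphere, neg_smul, one_smul])
      have h2 : dist (base m c) z ≤ l := by
        refine T.axis_le (u := -u) (x := x) (y := y) (by rw [lens_neg]; exact hx)
          (not_le.1 hxB) (by rw [lens_neg]; exact hyV) hyB (by rw [neg_neg]; exact hyA) hd ?_
        rw [← hwu, hw]; exact hz
      refine ⟨-dist (base m c) z, by linarith, by linarith [T.l_nonneg], ?_⟩
      rw [← polar_neg, ← hwu, hw]
    · have hwu : w = u := Subtype.ext (by rw [hwe, h1, neg_neg, one_smul])
      have h2 : dist (base m c) z ≤ l := by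
        refine T.axis_le (u := u) (x := x) (y := y) hx (not_le.1 hxA) hyV hyA hyB hd ?_
        rw [← hwu, hw]; exact hz
      refine ⟨dist (base m c) z, by linarith [T.l_nonneg], h2, ?_⟩
      rw [← hwu, hw]
  obtain ⟨d, hd1, hd2, hzd⟩ := hzAB
  refine ⟨y, z, hyA, hyB, ?_, hz, hyx⟩
  have h2l := T.two_l_angle.le
  rw [T.dist_tip_tip, dist_comm, hzd, tip, dist_polar_polar _ u hd2 (h2l.mono (by linarith)),
    tip, polar_neg, dist_comm, dist_polar_polar _ u hd1 (h2l.mono (by linarith))]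
  ring

/-- The rounded spindle is the intersection of the balls of radius `R₁` about the lens. -/
lemma mem_spindle_iff (hm : 2 ≤ m) (T : SpindleTriangle c R₁ R₂ h l) {x : SpaceForm m c} :
    x ∈ roundedSpindle R₁ R₂ (tip c l u) (tip c l (-u)) ↔
      x ∈ ballHull R₁ (lens c l (R₁ - R₂) u) := by
  refine ⟨fun hx => ?_, T.mem_spindle_of_mem_ballHull hm⟩
  obtain ⟨p, hp, hxp⟩ := T.exists_of_mem_spindle hx
  exact mem_ballHull_of_mem_closedBall hp hxp

lemma closedBall_subset_spindle (hm : 2 ≤ m) (T : SpindleTriangle c R₁ R₂ h l)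
    {p : SpaceForm m c} (hp : p ∈ ballHull (R₁ - R₂) (lens c l (R₁ - R₂) u)) :
    closedBall p R₂ ⊆ roundedSpindle R₁ R₂ (tip c l u) (tip c l (-u)) := fun _ hx =>
  (T.mem_spindle_iff hm).2 (mem_ballHull_of_mem_closedBall hp hx)

lemma spindle_subset_closedBall (hm : 2 ≤ m) (T : SpindleTriangle c R₁ R₂ h l)
    {y : SpaceForm m c} (hy : y ∈ lens c l (R₁ - R₂) u) :
    roundedSpindle R₁ R₂ (tip c l u) (tip c l (-u)) ⊆ closedBall y R₁ := fun _ hx =>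
  (T.mem_spindle_iff hm).1 hx y hy

end SpindleTriangle

/-! ### Convexity and sharpness of rounded spindles -/

namespace SpindleTriangle

variable {u : Dir m}

lemma isClosed_spindle (hm : 2 ≤ m) (T : SpindleTriangle c R₁ R₂ h l) :
    IsClosed (roundedSpindle R₁ R₂ (tip c l u) (tip c l (-u))) := by
  have : roundedSpindle R₁ R₂ (tip c l u) (tip c l (-u)) =
      ⋂ y ∈ lens c l (R₁ - R₂) u, closedBall y R₁ := by
    ext x
    rw [T.mem_spindle_iff hm, Set.mem_iInter₂]
    rfl
  rw [this]
  exact isClosed_biInter fun y _ => isClosed_closedBall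

/-- The union `W` of the open balls of radius `R₂` with centres in the hull is open, dense in the
spindle, and connected, as each of its points is joined to the base point by two segments. -/
lemma isConnected_interior_spindle (hm : 2 ≤ m) (T : SpindleTriangle c R₁ R₂ h l) :
    IsConnected (interior (roundedSpindle R₁ R₂ (tip c l u) (tip c l (-u)))) ∧
      closure (interior (roundedSpindle R₁ R₂ (tip c l u) (tip c l (-u)))) =
        roundedSpindle R₁ R₂ (tip c l u) (tip c l (-u)) := by
  set S := roundedSpindle R₁ R₂ (tip c l u) (tip c l (-u)) with hS
  set L := ballHull (R₁ - R₂) (lens c l (R₁ - R₂) u) with hL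
  have hball (p) (hp : p ∈ L) : ball p R₂ ⊆ interior S :=
    interior_maximal (ball_subset_closedBall.trans (T.closedBall_subset_spindle hm hp)) isOpen_ball
  set W := ⋃ p ∈ L, ball p R₂ with hW
  have hWmem {p x : SpaceForm m c} (hp : p ∈ L) (hx : dist x p < R₂) : x ∈ W :=
    Set.mem_biUnion hp hx
  have hWS : W ⊆ interior S := Set.iUnion₂_subset hball
  have hSW : S ⊆ closure W := fun x hx => by
    obtain ⟨p, hp, hxp⟩ := T.exists_of_mem_spindle hx
    exact closure_mono (Set.subset_biUnion_of_mem hp) (closedBall_subset_closure_ball p T.pos hxp)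
  have hbase : base m c ∈ L := fun y hy => (T.dist_base_le_of_mem_lens hy).trans T.h_le
  have hLL {p : SpaceForm m c} (hp : p ∈ L) : AngleLT c (dist (base m c) p) π := by
    rw [dist_comm]
    exact T.angle_hyp.half_lt_pi.mono (hp _ T.base_mem_lens)
  have hconn : IsPreconnected W := by
    refine isPreconnected_of_forall (base m c) fun x hx => ?_
    obtain ⟨p, hp, hxp⟩ := Set.mem_iUnion₂.1 hx
    rw [mem_ball, dist_comm] at hxp
    have hpx : AngleLT c (dist p x) π := T.angle.lt_pi.mono (hxp.le.trans T.le)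
    refine ⟨seg (base m c) p ∪ seg p x, Set.union_subset (fun z hz => ?_) fun z hz => ?_,
      Or.inl (left_mem_seg _ _), Or.inr (right_mem_seg _ _),
      (isPreconnected_seg (hLL hp)).union p (right_mem_seg _ _) (left_mem_seg _ _)
        (isPreconnected_seg hpx)⟩
    · refine hWmem (p := z) (fun y hy => ?_) (by rw [dist_self]; exact T.pos)
      exact dist_le_of_mem_seg T.angle_hyp.le (hLL hp) (hbase y hy) (hp y hy) hz
    · have h1 : dist p z + dist z x = dist p x := hz
      exact hWmem hp (by rw [dist_comm]; linarith [dist_nonneg (x := z) (y := x)])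
  refine ⟨⟨⟨base m c, hWS (hWmem hbase (by rw [dist_self]; exact T.pos))⟩,
    hconn.subset_closure hWS (interior_subset.trans hSW)⟩, ?_⟩
  exact (closure_minimal interior_subset (T.isClosed_spindle hm)).antisymm
    (hSW.trans (closure_mono hWS))

/-- At a boundary point `P` of the spindle, the outer ball is centred at a point `y` of the lens
farthest from `P`, and the inner one at a point `p` of the hull with `P` in its ball of radius `R₂`;
the triangle inequality for `P`, `p`, `y` shows that `P` is on the sphere about `p`. -/
lemma spindle_pinched (hm : 2 ≤ m) (T : SpindleTriangle c R₁ R₂ h l) {P : SpaceForm m c}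
    (hP : P ∈ frontier (roundedSpindle R₁ R₂ (tip c l u) (tip c l (-u)))) :
    ∃ O₁ O₂ : SpaceForm m c, dist P O₁ = R₁ ∧ dist P O₂ = R₂ ∧
      closedBall O₂ R₂ ⊆ closedBall O₁ R₁ ∧
      roundedSpindle R₁ R₂ (tip c l u) (tip c l (-u)) ⊆ closedBall O₁ R₁ ∧
      closedBall O₂ R₂ ⊆ roundedSpindle R₁ R₂ (tip c l u) (tip c l (-u)) := by
  have hPS := (T.isClosed_spindle hm).frontier_subset hP
  obtain ⟨p, hp, hPp⟩ := T.exists_of_mem_spindle hPS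
  rw [mem_closedBall] at hPp
  have hPI := (T.mem_spindle_iff hm).1 hPS
  have hcomp : IsCompact (lens c l (R₁ - R₂) u) :=
    (isCompact_closedBall (tip c l u) (R₁ - R₂)).inter
      (isCompact_closedBall (tip c l (-u)) (R₁ - R₂))
  obtain ⟨y, hy, hmax⟩ := hcomp.exists_isMaxOn ⟨base m c, T.base_mem_lens⟩
    (by fun_prop : Continuous fun y => dist P y).continuousOn
  have hPy : dist P y = R₁ := by
    refine le_antisymm (hPI y hy) ?_
    by_contra! hlt
    refine hP.2 (mem_interior.2 ⟨ball P (R₁ - dist P y), fun q hq => ?_, isOpen_ball,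
      mem_ball_self (by linarith)⟩)
    refine (T.mem_spindle_iff hm).2 fun y' hy' => ?_
    have h1 : dist P y' ≤ dist P y := hmax hy'
    have h2 := dist_triangle q P y'
    rw [mem_ball] at hq
    linarith
  have hpy := hp y hy
  have hPp' : dist P p = R₂ := by
    have := dist_triangle P p y
    linarith
  exact ⟨y, p, hPy, hPp', closedBall_subset_closedBall' (by linarith),
    T.spindle_subset_closedBall hm hy, T.closedBall_subset_spindle hm hp⟩

/-- The apex of the cap about the tip, where the ball of radius `R₁` about the point of the axis at
distance `R₁ - R₂` before the tip supports the spindle. -/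
lemma apex_mem_frontier (hm : 2 ≤ m) (T : SpindleTriangle c R₁ R₂ h l) :
    polar (base m c) (l + R₂) u ∈ frontier (roundedSpindle R₁ R₂ (tip c l u) (tip c l (-u))) := by
  have hl := T.l_nonneg
  have hlρ := T.l_le
  have hRa := T.angle.lt_pi
  have h2l := T.two_l_angle.le
  have hpos := T.pos
  have hρa := T.angle_hyp.half_lt_pi.le
  refine mem_frontier_of_subset_closedBall (y := polar (base m c) (l - (R₁ - R₂)) u) hRa
    (T.spindle_subset_closedBall hm ⟨?_, ?_⟩) (T.closedBall_subset_spindle hm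
      (tip_mem_ballHull _) ?_) ?_
  · rw [tip, dist_polar_polar _ u (by linarith) (hρa.mono (by linarith))]; linarith
  · rw [tip, polar_neg]
    rcases le_total (l - (R₁ - R₂)) (-l) with h1 | h1
    · rw [dist_polar_polar _ u h1 (hρa.mono (by linarith))]; linarith
    · rw [dist_comm, dist_polar_polar _ u h1 (hρa.mono (by linarith))]; linarith
  · rw [mem_closedBall, dist_comm, tip,
      dist_polar_polar _ u (by linarith) (hRa.le.mono (by linarith [T.le]))]
    linarith
  · rw [dist_polar_polar _ u (by linarith) (hRa.le.mono (by linarith))]; ring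

/-- Two opposite arc centres are at distance `2 * h`, which bounds the radius of a ball contained in
the two balls of radius `R₁` about them. -/
lemma isInscribedBall_spindle (hm : 2 ≤ m) (T : SpindleTriangle c R₁ R₂ h l) :
    IsInscribedBall (roundedSpindle R₁ R₂ (tip c l u) (tip c l (-u))) (base m c) (R₁ - h) := by
  refine ⟨fun x hx => (T.mem_spindle_iff hm).2 fun y hy => ?_, fun O' r' hO' => ?_⟩
  · have h1 := T.dist_base_le_of_mem_lens hy
    have h2 := dist_triangle x (base m c) y
    rw [mem_closedBall] at hx
    linarith
  · by_contra! hlt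
    obtain ⟨n, hn⟩ := exists_orthogonal_dir hm u
    rw [real_inner_comm] at hn
    have hr' : 0 ≤ r' := by linarith [T.h_le, T.pos]
    have hle (n : Dir m)
        (hn : ⟪(n : EuclideanSpace ℝ (Fin m)), (u : EuclideanSpace ℝ (Fin m))⟫ = 0) :
        dist (polar (base m c) h n) O' + r' ≤ R₁ :=
      dist_add_le_of_closedBall_subset hr' T.angle.lt_pi
        (hO'.trans (T.spindle_subset_closedBall hm (T.arcCentre_mem_lens hn)))
    have h1 := hle n hn
    have h2 := hle (-n) (by rw [coe_neg_sphere, inner_neg_left, hn, neg_zero])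
    have h3 : dist (polar (base m c) h (-n)) (polar (base m c) h n) = h - -h := by
      rw [polar_neg]
      refine dist_polar_polar _ n (by linarith [T.h_nonneg]) fun hc => ?_
      have := mul_le_mul_of_nonneg_left T.h_le (sqrt_nonneg c)
      have := T.angle_hyp hc
      rw [sub_neg_eq_add, mul_add]
      linarith
    have h4 := dist_triangle_right (polar (base m c) h (-n)) (polar (base m c) h n) O'
    linarith

end SpindleTriangle

/-- The spindle triangle that belongs to the inner radius `r`. -/
lemma spindleTriangle_of_radius (hpos : 0 < R₂) (hle : R₂ ≤ R₁)
    (hR₁a : AngleLE c R₁ (π / 2)) {r : ℝ} (h1 : R₂ ≤ r) (h2 : r ≤ R₁) :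
    SpindleTriangle c R₁ R₂ (R₁ - r) (outerRadiusBound c R₁ R₂ r - R₂) := by
  obtain ⟨h3, h4, h5⟩ := outerRadiusBound_spec h1 h2 (hR₁a.of_lt (by linarith))
  exact ⟨hpos, hle, hR₁a, by linarith, by linarith, by linarith, h4, h5⟩

end

end SpaceForm

end

theorem theorem3 (m : ℕ) (hm : 2 ≤ m) (c κ₁ κ₂ R₁ R₂ : ℝ) (hκ : κ₁ ≤ κ₂)
    (hzero : c = 0 → 0 < κ₁) (hpos : 0 < c → 0 ≤ κ₁) (hneg : c < 0 → √(-c) < κ₁)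
    (hR₁ : R₁ = curvatureRadius c κ₁) (hR₂ : R₂ = curvatureRadius c κ₂) :
    -- the estimate, for the shell about the centre of the inscribed ball
    (∀ D : Set (SpaceForm m c), IsConvexDomain κ₁ κ₂ D →
      (∃ (O : SpaceForm m c) (r : ℝ), IsInscribedBall D O r) ∧
      ∀ (O : SpaceForm m c) (r : ℝ), IsInscribedBall D O r →
        R₂ ≤ r ∧ r ≤ R₁ ∧
        ∃ R : ℝ, r ≤ R ∧ frontier D ⊆ sphericalShell O r R ∧ R ≤ outerRadiusBound c R₁ R₂ r) ∧
    -- sharpness: every value of the bound is attained by a rounded spindle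
    (∀ r : ℝ, R₂ ≤ r → r ≤ R₁ →
      ∃ O A B : SpaceForm m c,
        IsConvexDomain κ₁ κ₂ (roundedSpindle R₁ R₂ A B) ∧
        IsInscribedBall (roundedSpindle R₁ R₂ A B) O r ∧
        IsGreatest ((fun x => dist O x) '' frontier (roundedSpindle R₁ R₂ A B))
          (outerRadiusBound c R₁ R₂ r)) := by
  have hm0 : NeZero m := ⟨by omega⟩
  have hpos₂ : 0 < R₂ := hR₂ ▸ SpaceForm.curvatureRadius_pos
    (fun hc => (hzero hc).trans_le hκ) (fun hc => (hneg hc).trans_le hκ)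
  have hle : R₂ ≤ R₁ := hR₁ ▸ hR₂ ▸ SpaceForm.curvatureRadius_anti hκ hzero hneg
  have hR₁a : SpaceForm.AngleLE c R₁ (Real.pi / 2) :=
    hR₁ ▸ SpaceForm.curvatureRadius_angleLE hpos
  refine ⟨fun D hD => ⟨?_, fun O r hO =>
    SpaceForm.shell_estimate hm hR₁ hR₂ hpos₂ hle hR₁a hD hO⟩, fun r h1 h2 => ?_⟩
  · obtain ⟨hcomp, hne, -⟩ := SpaceForm.exists_balls_of_isConvexDomain hm hR₁ hR₂
      (hpos₂.trans_le hle) hpos₂ hR₁a (hR₁a.lt_pi.mono hle) hD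
    exact SpaceForm.exists_isInscribedBall hcomp hne
      (hD.isConnected_interior.nonempty.mono interior_subset)
  · have T := SpaceForm.spindleTriangle_of_radius hpos₂ hle hR₁a h1 h2
    let u : SpaceForm.Dir m := ⟨EuclideanSpace.single 0 1, by simp⟩
    set l := outerRadiusBound c R₁ R₂ r - R₂ with hl
    obtain ⟨hconn, hcl⟩ := T.isConnected_interior_spindle hm (u := u)
    have hdom : IsConvexDomain κ₁ κ₂
        (roundedSpindle R₁ R₂ (SpaceForm.tip c l u) (SpaceForm.tip c l (-u))) := by
      refine ⟨hconn, hcl, ⟨_, T.apex_mem_frontier hm⟩, fun P hP => ?_⟩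
      rw [← hR₁, ← hR₂]
      obtain ⟨O₁, O₂, h3, h4, h5, h6, h7⟩ := T.spindle_pinched hm hP
      exact ⟨O₁, O₂, h3, h4, h5, Set.univ, Filter.univ_mem, by rwa [Set.inter_univ],
        by rwa [Set.inter_univ]⟩
    have hins := T.isInscribedBall_spindle hm (u := u)
    rw [sub_sub_cancel] at hins
    refine ⟨SpaceForm.base m c, _, _, hdom, hins, ⟨_, T.apex_mem_frontier hm, ?_⟩, ?_⟩
    · have : dist (SpaceForm.base m c) (SpaceForm.polar (SpaceForm.base m c) (l + R₂) u) = l + R₂ :=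
        SpaceForm.dist_left_polar _ u (by linarith [T.l_nonneg])
          (hR₁a.lt_pi.le.mono (by linarith [T.l_le]))
      exact this.trans (by rw [hl, sub_add_cancel])
    · rintro _ ⟨x, hx, rfl⟩
      obtain ⟨-, -, R, -, h3, h4⟩ :=
        SpaceForm.shell_estimate hm hR₁ hR₂ hpos₂ hle hR₁a hdom hins
      exact (h3 hx).2.trans h4
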